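/- Fix a constant $c\in\mathbb N$ and a constant failure probability $\delta>0$. Consider the $(1+\varepsilon)$-approximate dynamic Hamming distance problem: for a text $T$ of length $n$ and a pattern $P$ of length $m$, $1\le m\le n$, over the alphabet $\{0,\dots,\sigma-1\}$ of polynomial size $\sigma\le c\,n^{c}$, maintain a data structure under updates $(j,a)$, which substitute the letter $a$ at index $j$ of one of the two strings, and queries $i$, which must return an integer $A$ with $H\le A\le(1+\varepsilon)H$, where $H$ is the Hamming distance between the current strings $P$ and $T[i,\dots,i+m-1]$. The model is a randomised word RAM: $\Theta(\log n)$-bit words, unit-cost arithmetic, bitwise, comparison and indirect memory instructions, fair coin tosses; space is the number of memory cells (words), and preprocessing of the initial strings is done by the machine within the same space, without a time bound, and terminates. Write $\operatorname{polylog} n=(1+\lfloor\log_2 n\rfloor)^{O(1)}$. All constants, including the exponents in $\operatorname{polylog}$ and the constant in the word length, depend only on $c$ and $\delta$. Then, for all $n\ge m\ge 1$, all $\sigma\le c\,n^c$ and all real $\varepsilon>1/n$, with $E=\max(1,1/\varepsilon)$ (so $E=1/\varepsilon$ if $\varepsilon\le1$): (a) if only the pattern is updated, there is a randomised data structure with update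 time $O(E^{3}\operatorname{polylog} n)$, query time $O(E^{4}\operatorname{polylog} n)$ and space $O(E^{4}\,n\operatorname{polylog} n)$; (b) if only the text is updated, there is a randomised data structure with update time $O(E^{4}\operatorname{polylog} n)$, query time $O(E^{4}\operatorname{polylog} n)$ and space $O(E^{4}\,n\operatorname{polylog} n)$. The time bounds are worst case, for every outcome of the coin tosses. For all initial strings and every fixed sequence of updates and queries, each single answer is correct with probability at least $1-\delta$. In each of (a) and (b) the programs for preprocessing, update and query are fixed for given $c$ and $\delta$; they receive $n$, $m$, $\sigma$ and $\lceil 1/\varepsilon\rceil$ as input. -/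

import Mathlib

namespace DynApproxHD

/-! ### A randomised word RAM

Cells and registers hold `w`-bit words.  A program is a fixed finite piece of syntax over numbered
registers; it mentions only finitely many of them.  Every primitive instruction, and every
evaluation of a branch or loop test, takes one step. -/

/-- Binary word operations; arithmetic is unsigned and modulo `2 ^ w`. -/
inductive BinOp
  | add | sub | mul | div | mod | and | or | xor | shl | shr | lt | eq

def BinOp.eval {w : ℕ} : BinOp → BitVec w → BitVec w → BitVec w
  | .add, x, y => x + y
  | .sub, x, y => x - y
  | .mul, x, y => x * y
  | .div, x, y => x / y
  | .mod, x, y => x % y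
  | .and, x, y => x &&& y
  | .or, x, y => x ||| y
  | .xor, x, y => x ^^^ y
  | .shl, x, y => x <<< y.toNat
  | .shr, x, y => x >>> y.toNat
  | .lt, x, y => if x.toNat < y.toNat then BitVec.ofNat w 1 else BitVec.ofNat w 0
  | .eq, x, y => if x = y then BitVec.ofNat w 1 else BitVec.ofNat w 0

/-- Programs.  Registers are named by natural numbers. -/
inductive Cmd
  /-- do nothing -/
  | skip
  /-- `reg r := v` -/
  | const (r v : ℕ)
  /-- `reg r := o (reg a) (reg b)` -/
  | op (o : BinOp) (r a b : ℕ)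
  /-- `reg r := mem (reg a)` -/
  | load (r a : ℕ)
  /-- `mem (reg a) := reg b` -/
  | store (a b : ℕ)
  /-- `reg r :=` a fresh random bit -/
  | coin (r : ℕ)
  /-- `c ; d` -/
  | seq (c d : Cmd)
  /-- `if reg r ≠ 0 then c else d` -/
  | ite (r : ℕ) (c d : Cmd)
  /-- `while reg r ≠ 0 do c` -/
  | loop (r : ℕ) (c : Cmd)

/-- A machine state: registers, memory, and the random bits not consumed so far. -/
structure State (w : ℕ) where
  reg : ℕ → BitVec w
  mem : ℕ → BitVec w
  coins : ℕ → Bool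

def State.setReg {w : ℕ} (s : State w) (r : ℕ) (x : BitVec w) : State w :=
  { s with reg := Function.update s.reg r x }

/-- One step on a machine with `S` memory cells, numbered `0, …, S - 1`.  A configuration is the
stack of commands still to be executed, and a state.  The value is `none` if the machine has
halted (empty stack) or if a cell outside the memory is addressed. -/
def step {w : ℕ} (S : ℕ) : List Cmd × State w → Option (List Cmd × State w)
  | ([], _) => none
  | (.skip :: k, s) => some (k, s)
  | (.const r v :: k, s) => some (k, s.setReg r (BitVec.ofNat w v))
  | (.op o r a b :: k, s) => some (k, s.setReg r (o.eval (s.reg a) (s.reg b)))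
  | (.load r a :: k, s) =>
      if (s.reg a).toNat < S then some (k, s.setReg r (s.mem (s.reg a).toNat)) else none
  | (.store a b :: k, s) =>
      if (s.reg a).toNat < S then
        some (k, { s with mem := Function.update s.mem (s.reg a).toNat (s.reg b) })
      else none
  | (.coin r :: k, s) =>
      some (k, { s.setReg r (if s.coins 0 then BitVec.ofNat w 1 else BitVec.ofNat w 0) with
        coins := fun i => s.coins (i + 1) })
  | (.seq c d :: k, s) => some (c :: d :: k, s)
  | (.ite r c d :: k, s) => some (if s.reg r = BitVec.ofNat w 0 then d :: k else c :: k, s)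
  | (.loop r c :: k, s) => some (if s.reg r = BitVec.ofNat w 0 then k else c :: .loop r c :: k, s)

/-- `t` consecutive steps. -/
def run {w : ℕ} (S : ℕ) : ℕ → List Cmd × State w → Option (List Cmd × State w)
  | 0, x => some x
  | t + 1, x => (step S x).bind (run S t)

/-- Program `c`, started in `s` with `S` memory cells, halts after exactly `t` steps, in `s'`,
and addresses no cell outside the memory. -/
def HaltsIn {w : ℕ} (S : ℕ) (c : Cmd) (s : State w) (t : ℕ) (s' : State w) : Prop :=
  run S t ([c], s) = some ([], s')

/-- The law of an infinite sequence of independent fair coin tosses. -/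
noncomputable def fairCoins : MeasureTheory.Measure (ℕ → Bool) :=
  MeasureTheory.Measure.infinitePi fun _ => (PMF.uniformOfFintype Bool).toMeasure

/-! ### The dynamic problem -/

/-- Which of the two strings may be updated. -/
inductive Mode
  | patternOnly | textOnly

/-- The length of the string that may be updated. -/
def Mode.len : Mode → (n m : ℕ) → ℕ
  | .patternOnly, _, m => m
  | .textOnly, n, _ => n

/-- A pattern of length `m` and a text of length `n` over the alphabet `{0, …, σ - 1}`. -/
structure Strings (n m σ : ℕ) where
  pattern : Fin m → Fin σ
  text : Fin n → Fin σ

/-- Substitute the letter at index `j` of the string that may be updated. -/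
def Strings.update {n m σ : ℕ} (x : Strings n m σ) :
    (M : Mode) → Fin (M.len n m) → Fin σ → Strings n m σ
  | .patternOnly, j, a => { x with pattern := Function.update (β := fun _ : Fin m => Fin σ) x.pattern j a }
  | .textOnly, j, a => { x with text := Function.update (β := fun _ : Fin n => Fin σ) x.text j a }

/-- The Hamming distance between the pattern and the text window that starts at `i` (counted
from `0`). -/
def Strings.dist {n m σ : ℕ} (x : Strings n m σ) (h : m ≤ n) (i : Fin (n - m + 1)) : ℕ :=
  hammingDist x.pattern fun j : Fin m => x.text ⟨i + j, by omega⟩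

inductive Request (M : Mode) (n m σ : ℕ)
  | update (j : Fin (M.len n m)) (a : Fin σ)
  | query (i : Fin (n - m + 1))

/-- The strings after a request. -/
def Request.apply {M : Mode} {n m σ : ℕ} (x : Strings n m σ) : Request M n m σ → Strings n m σ
  | .update j a => x.update M j a
  | .query _ => x

/-- `A` is a `(1 + ε)`-approximation of `H`. -/
def IsApprox (ε : ℝ) (H A : ℕ) : Prop :=
  (H : ℝ) ≤ A ∧ (A : ℝ) ≤ (1 + ε) * H

/-- A data structure: programs for preprocessing, updates and queries. -/
structure DataStructure where
  init : Cmd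
  update : Cmd
  query : Cmd

/-- The state in which preprocessing starts: the pattern is in cells `0, …, m - 1`, the text in
cells `m, …, m + n - 1`, the numbers `n`, `m`, `σ`, `⌈1 / ε⌉` are in registers `0, 1, 2, 3`;
all else is zero. -/
noncomputable def startState (w : ℕ) {n m σ : ℕ} (ε : ℝ) (x : Strings n m σ) (ω : ℕ → Bool) :
    State w where
  reg
    | 0 => BitVec.ofNat w n
    | 1 => BitVec.ofNat w m
    | 2 => BitVec.ofNat w σ
    | 3 => BitVec.ofNat w ⌈1 / ε⌉₊
    | _ => BitVec.ofNat w 0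
  mem a :=
    if h : a < m then BitVec.ofNat w (x.pattern ⟨a, h⟩)
    else if h' : a - m < n then BitVec.ofNat w (x.text ⟨a - m, h'⟩)
    else BitVec.ofNat w 0
  coins := ω

/-- The request is served in state `s`, within `tu` steps for an update and `tq` steps for a
query, and leads to state `s'`.  The arguments are passed in registers `0` and `1`; all other
registers and the memory keep the contents that the previous request left. -/
def DataStructure.Serves (D : DataStructure) {w : ℕ} (S tu tq : ℕ) {M : Mode} {n m σ : ℕ}
    (s : State w) : Request M n m σ → State w → Prop
  | .update j a, s' => ∃ t ≤ tu,
      HaltsIn S D.update ((s.setReg 0 (BitVec.ofNat w j)).setReg 1 (BitVec.ofNat w a)) t s'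
  | .query i, s' => ∃ t ≤ tq, HaltsIn S D.query (s.setReg 0 (BitVec.ofNat w i)) t s'

/-- A list of requests, the head first, is served in this way, from state `s` to state `s'`. -/
def DataStructure.ServesAll (D : DataStructure) {w : ℕ} (S tu tq : ℕ) {M : Mode} {n m σ : ℕ} :
    List (Request M n m σ) → State w → State w → Prop
  | [], s, s' => s = s'
  | r :: rs, s, s' => ∃ s₁, D.Serves S tu tq s r s₁ ∧ D.ServesAll S tu tq rs s₁ s'

/-- Preprocessing of `x` with random bits `ω` terminates, the requests `rs` are then served in
order, and the state afterwards is `s`. -/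
def DataStructure.Reaches (D : DataStructure) {w : ℕ} (S tu tq : ℕ) {M : Mode} {n m σ : ℕ}
    (ε : ℝ) (x : Strings n m σ) (ω : ℕ → Bool) (rs : List (Request M n m σ)) (s : State w) :
    Prop :=
  ∃ t s₀, HaltsIn S D.init (startState w ε x ω) t s₀ ∧ D.ServesAll S tu tq rs s₀ s

/-- On a word RAM with `w`-bit words and `S` memory cells, `D` solves the `(1 + ε)`-approximate
dynamic Hamming distance problem in worst-case update time `tu` and query time `tq`, and for each
fixed sequence of requests each answer (left in register `0`) is wrong with probability at
most `δ`. -/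
def DataStructure.Solves (D : DataStructure) (w S tu tq : ℕ) (M : Mode) {n m : ℕ} (σ : ℕ)
    (h : m ≤ n) (ε δ : ℝ) : Prop :=
  ∀ (x : Strings n m σ) (rs : List (Request M n m σ)),
    (∀ ω, ∃ s : State w, D.Reaches S tu tq ε x ω rs s) ∧
    ∀ i : Fin (n - m + 1),
      fairCoins {ω | ¬ ∃ s s' : State w, D.Reaches S tu tq ε x ω rs s ∧
        D.Serves S tu tq s (Request.query i : Request M n m σ) s' ∧
        IsApprox ε ((rs.foldl Request.apply x).dist h i) (s'.reg 0).toNat} ≤ ENNReal.ofReal δ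

/-- The number of bits of `n`, which stands for `log n`. -/
def bits (n : ℕ) : ℕ := Nat.log 2 n + 1

end DynApproxHD

/-! Write `q = ⌈1/ε⌉`, and give the letter `a` the code `a + 1`, a nonzero binary vector with `B =
Nat.size σ` digits. For each of `R = ρ q²` repetitions and each position of the dynamic string, `B`
fresh coins define a random linear functional over the field with two elements, which hashes a code
to a bit. The static string is hashed with the functionals of the positions that it is aligned with.
For a window and a repetition let `D` be the difference of the two sums of hashes.

Equal letters cancel in `D`. For different letters the difference of the two bits is in `{-1, 0,
1}`, has mean `0` because both codes are nonzero, and is nonzero with probability `1/2` because the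
codes differ. Distinct positions use disjoint coins, so with `H` mismatches `E D² = H/2` and `E D⁴ ≤
3H²/4` (`moments_sum`). The variance of `D²` is therefore at most `H²/2`, and Chebyshev's inequality
for the sum of `D²` over the `R` independent repetitions (`Layout.concentration`) shows that the
relative error exceeds `1/(2q+1)` with probability at most `2(2q+1)²/R ≤ 18/ρ ≤ δ`. Scaling by
`(2q+1)/(Rq)` turns this two-sided error into the one-sided factor `1 + 1/q ≤ 1 + ε`
(`isApprox_of_close`).

The hashes of the dynamic string are kept in one binary tree of sums per repetition. An update
changes one node on each level, and a window sum is a difference of two prefix sums. The sketches of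
the static string are tabulated for every window. Preprocessing stores all coins, so requests run
deterministically and the memory always encodes the current strings and the fixed coins (`Holds`).
Hence the history of requests matters only through the final strings, and a fixed sequence of
requests leads to one fixed pair of strings.

This takes time `O(E² log n)` per request and space `O(E² n log n)` in both modes, which is stronger
than required since `E ≥ 1`. The assumption `ε > 1/n` gives `q ≤ n`, so all numbers fit into words
of `O(log n)` bits (`good_of_le`). The rest is a small program logic: `WP` for time-bounded total
correctness, `pre` for straight-line code without overflow, `WP.rep` for counted loops, and frames
for everything that a program does not write. -/

namespace DynApproxHD

/-! ### Program logic for the word RAM -/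

/-- A machine state in which words are read as natural numbers. -/
@[ext] structure Conf where
  reg : ℕ → ℕ
  mem : ℕ → ℕ
  coins : ℕ → Bool

def Conf.set (a : Conf) (r x : ℕ) : Conf := { a with reg := Function.update a.reg r x }

def Conf.put (a : Conf) (p x : ℕ) : Conf := { a with mem := Function.update a.mem p x }

def Conf.drop (a : Conf) : Conf := { a with coins := fun i => a.coins (i + 1) }

@[simp] theorem Conf.set_reg (a : Conf) (r x i : ℕ) :
    (a.set r x).reg i = if i = r then x else a.reg i := by
  simp [Conf.set, Function.update_apply]

@[simp] theorem Conf.set_mem (a : Conf) (r x : ℕ) : (a.set r x).mem = a.mem := rfl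
@[simp] theorem Conf.set_coins (a : Conf) (r x : ℕ) : (a.set r x).coins = a.coins := rfl
@[simp] theorem Conf.put_reg (a : Conf) (p x : ℕ) : (a.put p x).reg = a.reg := rfl
@[simp] theorem Conf.put_coins (a : Conf) (p x : ℕ) : (a.put p x).coins = a.coins := rfl

@[simp] theorem Conf.put_mem (a : Conf) (p x i : ℕ) :
    (a.put p x).mem i = if i = p then x else a.mem i := by
  simp [Conf.put, Function.update_apply]

@[simp] theorem Conf.drop_reg (a : Conf) : a.drop.reg = a.reg := rfl
@[simp] theorem Conf.drop_mem (a : Conf) : a.drop.mem = a.mem := rfl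
@[simp] theorem Conf.drop_coins (a : Conf) (i : ℕ) : a.drop.coins i = a.coins (i + 1) := rfl

def State.val {w : ℕ} (s : State w) : Conf where
  reg r := (s.reg r).toNat
  mem p := (s.mem p).toNat
  coins := s.coins

theorem State.val_setReg {w : ℕ} (s : State w) (r : ℕ) (x : BitVec w) :
    (s.setReg r x).val = s.val.set r x.toNat := by
  ext i
  · simp only [State.val, State.setReg, Conf.set_reg, Function.update_apply]; split_ifs <;> rfl
  · rfl
  · rfl

theorem run_add {w S t u : ℕ} (x : List Cmd × State w) :
    run S (t + u) x = (run S t x).bind (run S u) := by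
  induction t generalizing x with
  | zero => simp [run]
  | succ t ih =>
    rw [Nat.add_right_comm]
    simp only [run]
    cases step S x with
    | none => rfl
    | some y => exact ih y

theorem step_append {w S : ℕ} {k k' : List Cmd} {s s' : State w} (l : List Cmd)
    (h : step S (k, s) = some (k', s')) : step S (k ++ l, s) = some (k' ++ l, s') := by
  match k with
  | [] => simp [step] at h
  | c :: k =>
    cases c <;> simp only [step, List.cons_append] at h ⊢ <;>
      (try split_ifs at h ⊢) <;> simp_all <;>
      (obtain ⟨h, -⟩ := h; simp [← h])

/-- A step looks only at the top of the stack, so commands waiting below do not influence the run.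
This is what makes programs compose. -/
theorem run_append {w S t : ℕ} {k k' : List Cmd} {s s' : State w} (l : List Cmd)
    (h : run S t (k, s) = some (k', s')) : run S t (k ++ l, s) = some (k' ++ l, s') := by
  induction t generalizing k s with
  | zero => simp [run] at h ⊢; simp [h]
  | succ t ih =>
    simp only [run, Option.bind_eq_some_iff] at h ⊢
    obtain ⟨⟨k₁, s₁⟩, h₁, h₂⟩ := h
    exact ⟨_, step_append l h₁, ih h₂⟩

/-- Started in a state that reads as `a`, the program `c` halts within `t` steps, in a state
satisfying `Q`. -/
def WP (w S : ℕ) (c : Cmd) (t : ℕ) (Q : Conf → Prop) (a : Conf) : Prop :=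
  ∀ s : State w, s.val = a → ∃ t' ≤ t, ∃ s', HaltsIn S c s t' s' ∧ Q s'.val

section Rules

variable {w S t u : ℕ} {c d : Cmd} {Q Q' : Conf → Prop} {a : Conf}

theorem WP.mono (h : WP w S c t Q a) (htu : t ≤ u) (hQ : ∀ b, Q b → Q' b) :
    WP w S c u Q' a := fun s hs =>
  let ⟨t', ht, s', h₁, h₂⟩ := h s hs
  ⟨t', ht.trans htu, s', h₁, hQ _ h₂⟩

theorem WP.seq (h : WP w S c t (WP w S d u Q) a) : WP w S (.seq c d) (t + u + 1) Q a := by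
  intro s hs
  obtain ⟨t', ht, s', h₁, h₂⟩ := h s hs
  obtain ⟨u', hu, s'', h₃, h₄⟩ := h₂ s' rfl
  refine ⟨t' + u' + 1, by omega, s'', ?_, h₄⟩
  have h₅ := run_append [d] h₁
  show run S _ _ = _
  simp only [run, step, Option.bind_some, run_add]
  simp only [List.cons_append, List.nil_append] at h₅
  rw [h₅]
  exact h₃

/-- Induction on the number of passes still to come. Each pass pays one step for the test; the final
`+ 1` is the test that fails. -/
theorem WP.iterate {r N : ℕ} (Inv : ℕ → Conf → Prop)
    (step : ∀ k < N, ∀ b, Inv k b → b.reg r ≠ 0 ∧ WP w S c t (Inv (k + 1)) b)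
    (halt : ∀ b, Inv N b → b.reg r = 0) (start : Inv 0 a) :
    WP w S (.loop r c) (N * (t + 1) + 1) (Inv N) a := by
  suffices H : ∀ k ≤ N, ∀ b, Inv (N - k) b →
      WP w S (.loop r c) (k * (t + 1) + 1) (Inv N) b from H N le_rfl a (by simpa using start)
  intro k
  induction k with
  | zero =>
    intro _ b hb s hs
    have h0 := halt b hb
    refine ⟨1, by omega, s, ?_, by simpa [hs] using hb⟩
    have : s.reg r = BitVec.ofNat w 0 := by
      apply BitVec.eq_of_toNat_eq
      rw [← hs] at h0
      simpa [State.val] using h0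
    simp [HaltsIn, run, DynApproxHD.step, this]
  | succ k ih =>
    intro hk b hb s hs
    obtain ⟨h0, h1⟩ := step (N - (k + 1)) (by omega) b hb
    obtain ⟨t', ht, s', h₁, h₂⟩ := h1 s hs
    rw [show N - (k + 1) + 1 = N - k by omega] at h₂
    obtain ⟨u', hu, s'', h₃, h₄⟩ := ih (by omega) _ h₂ s' rfl
    refine ⟨t' + u' + 1, ?_, s'', ?_, h₄⟩
    · have : (k + 1) * (t + 1) = k * (t + 1) + (t + 1) := by ring
      omega
    have hne : ¬ s.reg r = BitVec.ofNat w 0 := by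
      intro h
      apply h0
      rw [← hs]
      simp [State.val, h]
    have h₅ := run_append [.loop r c] h₁
    simp only [HaltsIn, run, DynApproxHD.step, hne, if_false, Option.bind_some, run_add]
    simp only [List.cons_append, List.nil_append] at h₅
    rw [h₅]
    exact h₃

end Rules

/-! ### Frames -/

/-- Does the program have an instruction that writes the register? -/
def Cmd.writes : Cmd → ℕ → Bool
  | .skip, _ => false
  | .const r _, i => i == r
  | .op _ r _ _, i => i == r
  | .load r _, i => i == r
  | .store _ _, _ => false
  | .coin r, i => i == r
  | .seq c d, i => c.writes i || d.writes i
  | .ite _ c d, i => c.writes i || d.writes i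
  | .loop _ c, i => c.writes i

/-- Does the program have an instruction that writes to memory? -/
def Cmd.stores : Cmd → Bool
  | .store _ _ => true
  | .seq c d => c.stores || d.stores
  | .ite _ c d => c.stores || d.stores
  | .loop _ c => c.stores
  | _ => false

/-- Does the program have an instruction that tosses a coin? -/
def Cmd.tosses : Cmd → Bool
  | .coin _ => true
  | .seq c d => c.tosses || d.tosses
  | .ite _ c d => c.tosses || d.tosses
  | .loop _ c => c.tosses
  | _ => false

/-- A step pushes only commands that are on the stack already or are parts of its top, so a
syntactic property of the stack persists along a run. -/
theorem step_frame {w S i : ℕ} {k k' : List Cmd} {s s' : State w}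
    (h : step S (k, s) = some (k', s')) (hk : ∀ c ∈ k, c.writes i = false) :
    s'.reg i = s.reg i ∧ ∀ c ∈ k', c.writes i = false := by
  match k with
  | [] => simp [step] at h
  | c :: k =>
    cases c <;> simp only [step] at h <;> (try split_ifs at h) <;>
      simp only [Option.some.injEq, Prod.mk.injEq] at h <;>
      obtain ⟨rfl, rfl⟩ := h <;>
      simp_all [Cmd.writes, State.setReg]

theorem step_frame_mem {w S : ℕ} {k k' : List Cmd} {s s' : State w}
    (h : step S (k, s) = some (k', s')) (hk : ∀ c ∈ k, c.stores = false) :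
    s'.mem = s.mem ∧ ∀ c ∈ k', c.stores = false := by
  match k with
  | [] => simp [step] at h
  | c :: k =>
    cases c <;> simp only [step] at h <;> (try split_ifs at h) <;>
      simp only [Option.some.injEq, Prod.mk.injEq] at h <;>
      obtain ⟨rfl, rfl⟩ := h <;>
      simp_all [Cmd.stores, State.setReg]

theorem step_frame_coins {w S : ℕ} {k k' : List Cmd} {s s' : State w}
    (h : step S (k, s) = some (k', s')) (hk : ∀ c ∈ k, c.tosses = false) :
    s'.coins = s.coins ∧ ∀ c ∈ k', c.tosses = false := by
  match k with
  | [] => simp [step] at h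
  | c :: k =>
    cases c <;> simp only [step] at h <;> (try split_ifs at h) <;>
      simp only [Option.some.injEq, Prod.mk.injEq] at h <;>
      obtain ⟨rfl, rfl⟩ := h <;>
      simp_all [Cmd.tosses, State.setReg]

theorem run_frame {w S i t : ℕ} {k k' : List Cmd} {s s' : State w}
    (h : run S t (k, s) = some (k', s')) (hk : ∀ c ∈ k, c.writes i = false) :
    s'.reg i = s.reg i := by
  induction t generalizing k s with
  | zero => simp [run] at h; simp [h]
  | succ t ih =>
    simp only [run, Option.bind_eq_some_iff] at h
    obtain ⟨⟨k₁, s₁⟩, h₁, h₂⟩ := h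
    obtain ⟨h₃, h₄⟩ := step_frame h₁ hk
    rw [← h₃]
    exact ih h₂ h₄

theorem run_frame_mem {w S t : ℕ} {k k' : List Cmd} {s s' : State w}
    (h : run S t (k, s) = some (k', s')) (hk : ∀ c ∈ k, c.stores = false) :
    s'.mem = s.mem := by
  induction t generalizing k s with
  | zero => simp [run] at h; simp [h]
  | succ t ih =>
    simp only [run, Option.bind_eq_some_iff] at h
    obtain ⟨⟨k₁, s₁⟩, h₁, h₂⟩ := h
    obtain ⟨h₃, h₄⟩ := step_frame_mem h₁ hk
    rw [← h₃]
    exact ih h₂ h₄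

theorem run_frame_coins {w S t : ℕ} {k k' : List Cmd} {s s' : State w}
    (h : run S t (k, s) = some (k', s')) (hk : ∀ c ∈ k, c.tosses = false) :
    s'.coins = s.coins := by
  induction t generalizing k s with
  | zero => simp [run] at h; simp [h]
  | succ t ih =>
    simp only [run, Option.bind_eq_some_iff] at h
    obtain ⟨⟨k₁, s₁⟩, h₁, h₂⟩ := h
    obtain ⟨h₃, h₄⟩ := step_frame_coins h₁ hk
    rw [← h₃]
    exact ih h₂ h₄

/-- The part of the state that the program does not write is the same in `a` and `b`. -/
def Cmd.Frame (c : Cmd) (a b : Conf) : Prop :=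
  (∀ r, c.writes r = false → b.reg r = a.reg r) ∧ (c.stores = false → b.mem = a.mem) ∧
    (c.tosses = false → b.coins = a.coins)

/-- Specifications need to mention only what changes. Whether a concrete program writes a given
register is a Boolean computation, closed by `rfl` at the point of use. -/
theorem WP.frame {w S t : ℕ} {c : Cmd} {Q : Conf → Prop} {a : Conf} (h : WP w S c t Q a) :
    WP w S c t (fun b => Q b ∧ c.Frame a b) a := by
  rintro s rfl
  obtain ⟨t', ht, s', h₁, h₂⟩ := h s rfl
  refine ⟨t', ht, s', h₁, h₂, fun r hr => ?_, fun hc => ?_, fun hc => ?_⟩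
  · have := run_frame (i := r) h₁ (by simpa using hr)
    simp [State.val, this]
  · have := run_frame_mem h₁ (by simpa using hc)
    simp [State.val, this]
  · have := run_frame_coins h₁ (by simpa using hc)
    simp [State.val, this]

/-! ### Straight-line code and counted loops -/

/-- Weakest preconditions of straight-line code that does not overflow. -/
def pre (w S : ℕ) : Cmd → (Conf → Prop) → Conf → Prop
  | .skip, Q, a => Q a
  | .const r v, Q, a => v < 2 ^ w ∧ Q (a.set r v)
  | .op .add r x y, Q, a => a.reg x + a.reg y < 2 ^ w ∧ Q (a.set r (a.reg x + a.reg y))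
  | .op .sub r x y, Q, a => a.reg y ≤ a.reg x ∧ Q (a.set r (a.reg x - a.reg y))
  | .op .mul r x y, Q, a => a.reg x * a.reg y < 2 ^ w ∧ Q (a.set r (a.reg x * a.reg y))
  | .op .div r x y, Q, a => Q (a.set r (a.reg x / a.reg y))
  | .op .mod r x y, Q, a => Q (a.set r (a.reg x % a.reg y))
  | .load r x, Q, a => a.reg x < S ∧ Q (a.set r (a.mem (a.reg x)))
  | .store x y, Q, a => a.reg x < S ∧ Q (a.put (a.reg x) (a.reg y))
  | .coin r, Q, a => 1 < 2 ^ w ∧ Q (a.set r (a.coins 0).toNat).drop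
  | .seq c d, Q, a => pre w S c (pre w S d Q) a
  | _, _, _ => False

def Cmd.cost : Cmd → ℕ
  | .seq c d => c.cost + d.cost + 1
  | _ => 1

theorem WP.one {w S : ℕ} {c : Cmd} {Q : Conf → Prop} {a : Conf}
    (h : ∀ s : State w, s.val = a → ∃ s', step S ([c], s) = some ([], s') ∧ Q s'.val) :
    WP w S c 1 Q a := fun s hs =>
  let ⟨s', h₁, h₂⟩ := h s hs
  ⟨1, le_rfl, s', by simp [HaltsIn, run, h₁], h₂⟩

/-- Without overflow or underflow the word operations agree with those on `ℕ`. The obligations that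
remain are inequalities in `ℕ`, mostly for `omega`. -/
theorem WP.straight {w S : ℕ} {c : Cmd} {Q : Conf → Prop} {a : Conf} (h : pre w S c Q a) :
    WP w S c c.cost Q a := by
  induction c generalizing Q a with
  | skip => exact WP.one fun s hs => ⟨s, rfl, hs ▸ h⟩
  | const r v =>
    refine WP.one fun s hs => ⟨_, rfl, ?_⟩
    rw [State.val_setReg, hs, BitVec.toNat_ofNat, Nat.mod_eq_of_lt h.1]
    exact h.2
  | op o r x y =>
    refine WP.one fun s hs => ⟨_, rfl, ?_⟩
    subst hs
    rw [State.val_setReg]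
    have hx := (s.reg x).isLt
    have hy := (s.reg y).isLt
    cases o <;> simp only [pre, State.val] at h
    · rw [BinOp.eval, BitVec.toNat_add, Nat.mod_eq_of_lt h.1]; exact h.2
    · rw [BinOp.eval, BitVec.toNat_sub_of_le (BitVec.le_def.2 h.1)]; exact h.2
    · rw [BinOp.eval, BitVec.toNat_mul, Nat.mod_eq_of_lt h.1]; exact h.2
    · rw [BinOp.eval, BitVec.toNat_udiv]; exact h
    · rw [BinOp.eval, BitVec.toNat_umod]; exact h
  | load r x =>
    refine WP.one fun s hs => ?_
    subst hs
    refine ⟨_, if_pos h.1, ?_⟩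
    rw [State.val_setReg]
    exact h.2
  | store x y =>
    refine WP.one fun s hs => ?_
    subst hs
    refine ⟨_, if_pos h.1, ?_⟩
    convert h.2 using 1
    ext i
    · rfl
    · simp only [State.val, Conf.put_mem, Function.update_apply]; split_ifs <;> rfl
    · rfl
  | coin r =>
    refine WP.one fun s hs => ⟨_, rfl, ?_⟩
    subst hs
    convert h.2 using 1
    ext i
    · simp only [State.val, State.setReg, Conf.drop_reg, Conf.set_reg, Function.update_apply]
      by_cases hi : i = r
      · cases hc : s.coins 0 <;> simp [hi, Nat.mod_eq_of_lt h.1]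
      · simp [hi]
    · rfl
    · rfl
  | seq c d ihc ihd => exact WP.seq ((ihc h).mono le_rfl fun b hb => ihd hb)
  | ite => exact h.elim
  | loop => exact h.elim

/-- A sequence of commands. -/
def Cmd.block : List Cmd → Cmd
  | [] => .skip
  | [c] => c
  | c :: d :: k => .seq c (block (d :: k))

/-- Run `c` as often as register `d` says, counting it down; register `4` holds `1`. -/
def Cmd.rep (d : ℕ) (c : Cmd) : Cmd := .loop d (.seq c (.op .sub d d 4))

/-- `closed` lets the invariant survive the decrement of the counter. The frame is carried along as
part of the invariant, so the body may use every register that the whole loop leaves alone. -/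
theorem WP.rep {w S t d N : ℕ} {c : Cmd} {a : Conf} (Inv : ℕ → Conf → Prop)
    (hd : c.writes d = false) (h4 : c.writes 4 = false) (hd4 : d ≠ 4)
    (hN : a.reg d = N) (h1 : a.reg 4 = 1)
    (closed : ∀ k b x, Inv k b → Inv k (b.set d x)) (start : Inv 0 a)
    (step : ∀ k < N, ∀ b, Inv k b → (Cmd.rep d c).Frame a b → WP w S c t (Inv (k + 1)) b) :
    WP w S (.rep d c) (N * (t + 3) + 1) (fun b => Inv N b ∧ (Cmd.rep d c).Frame a b) a := by
  apply WP.frame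
  -- Besides the body, a pass pays for the decrement, the sequencing and the loop test.
  have H : WP w S (.rep d c) (N * (t + 1 + 1 + 1) + 1)
      (fun b => (Inv N b ∧ (Cmd.rep d c).Frame a b) ∧ b.reg d = N - N) a := by
    apply WP.iterate (fun k b => (Inv k b ∧ (Cmd.rep d c).Frame a b) ∧ b.reg d = N - k)
    · rintro k hk b ⟨⟨hI, hF⟩, hb⟩
      refine ⟨by omega, ?_⟩
      have hb4 : b.reg 4 = 1 := by
        rw [hF.1 4 (by simp [Cmd.rep, Cmd.writes, h4, hd4.symm]), h1]
      refine WP.seq ((step k hk b hI hF).frame.mono le_rfl ?_)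
      rintro e ⟨he, hfe⟩
      have hed : e.reg d = N - k := by rw [hfe.1 d hd, hb]
      have he4 : e.reg 4 = 1 := by rw [hfe.1 4 h4, hb4]
      apply WP.straight
      refine ⟨by omega, ⟨closed _ _ _ he, ?_, ?_, ?_⟩, by simp; omega⟩
      · intro r hr
        rw [← hF.1 r hr]
        simp [Cmd.rep, Cmd.writes] at hr
        simp [hr.2, hfe.1 r hr.1]
      · intro hs
        rw [← hF.2.1 hs]
        simp [Cmd.rep, Cmd.stores] at hs
        simp [hfe.2.1 hs]
      · intro hs
        rw [← hF.2.2 hs]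
        simp [Cmd.rep, Cmd.tosses] at hs
        simp [hfe.2.2 hs]
    · rintro b ⟨-, hb⟩
      omega
    · exact ⟨⟨start, fun _ _ => rfl, fun _ => rfl, fun _ => rfl⟩, by omega⟩
  exact H.mono le_rfl fun b hb => hb.1.1

/-! ### The data structure in memory -/

/-- The parameters of the data structure: the lengths `n`, `m`, the number `B` of bits of a letter,
the number `R` of repetitions, the number `V` of levels of the trees, the fraction `num / den` by
which the sum of squares is scaled, and `f`, `g`, where the window `i` starts at position `f * i` of
the dynamic string and at position `g * i` of the static string. -/
structure Layout where
  (n m B R V num den f g : ℕ)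

namespace Layout

/-- Where the random bits start. -/
def cb (E : Layout) : ℕ := E.m + E.n
/-- Where the codes of the current letters of the dynamic string start. -/
def ub (E : Layout) : ℕ := E.cb + E.R * (E.n * E.B)
/-- Where the sketches of the static string start. -/
def sb (E : Layout) : ℕ := E.ub + E.n
/-- Where the trees start. -/
def tb (E : Layout) : ℕ := E.sb + E.n * E.R
/-- The number of memory cells. -/
def size (E : Layout) : ℕ := E.tb + E.R * E.V * (E.n + 1)

/-- The cell of node `x` on level `τ % V` of tree `τ / V`. -/
def cell (E : Layout) (τ x : ℕ) : ℕ := E.tb + τ * (E.n + 1) + x + 1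

theorem cell_lt (E : Layout) {τ x : ℕ} (hτ : τ < E.R * E.V) (hx : x < E.n) :
    E.cell τ x < E.size := by
  have : (τ + 1) * (E.n + 1) ≤ E.R * E.V * (E.n + 1) := Nat.mul_le_mul_right _ hτ
  unfold cell size
  linarith

theorem cell_inj (E : Layout) {τ τ' x x' : ℕ} (hx : x < E.n) (hx' : x' < E.n)
    (h : E.cell τ x = E.cell τ' x') : τ = τ' ∧ x = x' := by
  unfold cell at h
  have key : τ = τ' := by
    rcases lt_trichotomy τ τ' with hlt | heq | hlt
    · have : (τ + 1) * (E.n + 1) ≤ τ' * (E.n + 1) := Nat.mul_le_mul_right _ hlt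
      linarith
    · exact heq
    · have : (τ' + 1) * (E.n + 1) ≤ τ * (E.n + 1) := Nat.mul_le_mul_right _ hlt
      linarith
  subst key
  exact ⟨rfl, by omega⟩

/-- The numbers that occur in the computation are machine words. -/
structure Fits (E : Layout) (w : ℕ) : Prop where
  size : 2 * E.size + 4 < 2 ^ w
  levels : E.n < 2 ^ E.V
  levels_lt : E.V < 2 ^ w
  bits_lt : E.B < 2 ^ w
  pos : 1 ≤ E.m
  le : E.m ≤ E.n
  rep_pos : 1 ≤ E.R
  f_le : E.f ≤ 1
  answer : E.R * (2 * E.n * E.n) * E.num < 2 ^ w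
  num_pos : 1 ≤ E.num
  sq : 2 * E.n * E.n < 2 ^ w

end Layout

/-- The registers that hold the parameters. -/
structure Glob (E : Layout) (a : Conf) : Prop where
  one : a.reg 4 = 1
  zero : a.reg 5 = 0
  two : a.reg 6 = 2
  n : a.reg 7 = E.n
  m : a.reg 8 = E.m
  B : a.reg 9 = E.B
  R : a.reg 10 = E.R
  V : a.reg 11 = E.V
  num : a.reg 12 = E.num
  den : a.reg 13 = E.den
  cb : a.reg 14 = E.cb
  ub : a.reg 15 = E.ub
  sb : a.reg 16 = E.sb
  tb : a.reg 17 = E.tb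
  f : a.reg 18 = E.f
  row : a.reg 19 = E.n * E.B
  level : a.reg 20 = E.n + 1
  tree : a.reg 21 = E.V * (E.n + 1)

theorem Glob.of_eq {E : Layout} {a b : Conf} (h : Glob E a)
    (hab : ∀ r, 4 ≤ r → r ≤ 21 → b.reg r = a.reg r) : Glob E b := by
  obtain ⟨⟩ := h
  constructor <;> rw [hab _ (by norm_num) (by norm_num)] <;> assumption

/-- The program leaves the parameters alone. -/
def Cmd.safe (c : Cmd) : Bool := (List.range 18).all fun i => !c.writes (i + 4)

theorem Glob.frame {E : Layout} {a b : Conf} {c : Cmd} (h : Glob E a) (hF : c.Frame a b)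
    (hc : c.safe = true) : Glob E b := by
  refine h.of_eq fun r h4 h21 => hF.1 r ?_
  simp only [Cmd.safe, List.all_eq_true, List.mem_range] at hc
  have := hc (r - 4) (by omega)
  rwa [Nat.sub_add_cancel h4, Bool.not_eq_true'] at this

/-! ### Hashing a letter to a bit -/

/-- The inner product modulo `2` of the binary digits of `x` with the `B` coins from `e` on. -/
def parity (ω : ℕ → Bool) (B e x : ℕ) : ℕ :=
  (∑ t ∈ Finset.range B, (ω (e + t)).toNat * (x / 2 ^ t % 2)) % 2

theorem parity_le (ω : ℕ → Bool) (B e x : ℕ) : parity ω B e x ≤ 1 :=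
  Nat.le_of_lt_succ (Nat.mod_lt _ two_pos)

/-- `reg 24 :=` the hash of the letter code in register `22` with the coins from address
`reg 23` on. -/
def parityCmd : Cmd :=
  .seq (.block [.op .add 25 9 5, .const 24 0])
    (.seq (.rep 25 (.block [.load 26 23, .op .mod 27 22 6, .op .mul 26 26 27, .op .add 24 24 26,
      .op .div 22 22 6, .op .add 23 23 4]))
    (.op .mod 24 24 6))

/-- The coins are in memory. -/
def CoinsIn (E : Layout) (ω : ℕ → Bool) (a : Conf) : Prop :=
  ∀ i < E.R * (E.n * E.B), a.mem (E.cb + i) = (ω i).toNat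

/-- The sum is reduced modulo `2` only at the end. After `k` digits it is at most `k`, hence at most
`B`, and cannot overflow. The six instructions of the body cost `11` with their sequencing, and the
loop adds `3`. -/
theorem parityCmd_spec {E : Layout} {w : ℕ} {ω : ℕ → Bool} {a : Conf} {e : ℕ} (hf : E.Fits w)
    (hg : Glob E a) (hω : CoinsIn E ω a) (he : e + E.B ≤ E.R * (E.n * E.B))
    (ha : a.reg 23 = E.cb + e) :
    WP w E.size parityCmd (14 * E.B + 7)
      (fun b => b.reg 24 = parity ω E.B e (a.reg 22) ∧ parityCmd.Frame a b) a := by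
  apply WP.frame
  have hs : E.cb + e + E.B ≤ E.size := by unfold Layout.size Layout.tb Layout.sb Layout.ub; omega
  have hs' := hf.size
  have hB := hf.bits_lt
  refine WP.mono (t := 3 + (E.B * (11 + 3) + 1 + 1 + 1) + 1) (Q := fun b => b.reg 24 = _) ?_
    (by omega) fun _ h => h
  refine WP.seq (WP.straight ?_)
  simp only [Cmd.block, pre, hg.B, hg.zero]
  refine ⟨by omega, by omega, WP.seq (t := E.B * (11 + 3) + 1) (u := 1) ?_⟩
  refine WP.mono (WP.rep (N := E.B) (t := 11)
    (fun k b => b.reg 22 = a.reg 22 / 2 ^ k ∧ b.reg 23 = E.cb + e + k ∧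
      b.reg 24 = ∑ t ∈ Finset.range k, (ω (e + t)).toNat * (a.reg 22 / 2 ^ t % 2) ∧
      b.reg 24 ≤ k) rfl rfl (by decide) (by simp) (by simp [hg.one]) ?_ ?_ ?_) le_rfl ?_
  · intro k b x h
    simpa using h
  · simp [ha]
  · rintro k hk b ⟨h1, h2, h3, h4⟩ hF
    have g4 : b.reg 4 = 1 := by rw [hF.1 4 rfl]; simp [hg.one]
    have g6 : b.reg 6 = 2 := by rw [hF.1 6 rfl]; simp [hg.two]
    have hm : b.mem (E.cb + e + k) = (ω (e + k)).toNat := by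
      rw [hF.2.1 rfl, ← hω _ (by omega), add_assoc]; rfl
    have hle : (ω (e + k)).toNat * (a.reg 22 / 2 ^ k % 2) ≤ 1 :=
      Nat.mul_le_mul (Bool.toNat_le _) (Nat.le_of_lt_succ (Nat.mod_lt _ two_pos))
    refine WP.straight (Q := fun b => _) ?_
    simp only [pre, Conf.set_reg, h1, h2, g4, g6, hm, reduceIte,
      Nat.reduceEqDiff]
    refine ⟨by omega, by omega, by omega, by omega, ?_, by omega, ?_, by omega⟩
    · rw [Nat.div_div_eq_div_mul, pow_succ]
    · rw [Finset.sum_range_succ, h3]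
  · rintro b ⟨⟨-, -, h3, -⟩, hF⟩
    have g6 : b.reg 6 = 2 := by rw [hF.1 6 rfl]; simp [hg.two]
    refine WP.straight (Q := fun b => b.reg 24 = _) ?_
    simp [pre, g6, h3, parity]

/-! ### Prefix sums -/

/-- Node `x` on level `k` of the tree over the values `F`. -/
def node (n : ℕ) (F : ℕ → ℕ) (k x : ℕ) : ℕ :=
  ∑ j ∈ Finset.range n with j / 2 ^ k = x, F j

theorem node_le {n : ℕ} {F : ℕ → ℕ} (hF : ∀ j, F j ≤ 1) (k x : ℕ) : node n F k x ≤ n := by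
  calc node n F k x ≤ ∑ j ∈ Finset.range n with j / 2 ^ k = x, 1 :=
        Finset.sum_le_sum fun j _ => hF j
    _ ≤ n := by
        simpa using (Finset.card_filter_le (Finset.range n) fun j => j / 2 ^ k = x)

/-- The first `y` nodes of level `k` are the children of the first `y / 2` nodes of level `k + 1`,
plus node `y - 1` if `y` is odd. Iterating this over the levels computes a prefix sum. -/
theorem sum_below_level (n : ℕ) (F : ℕ → ℕ) (k y : ℕ) :
    ∑ j ∈ Finset.range n with j / 2 ^ k < y, F j =
      (if y % 2 = 1 then node n F k (y - 1) else 0) +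
        ∑ j ∈ Finset.range n with j / 2 ^ (k + 1) < y / 2, F j := by
  have h2 : ∀ j, j / 2 ^ (k + 1) = j / 2 ^ k / 2 := fun j => by
    rw [Nat.div_div_eq_div_mul, pow_succ]
  unfold node
  simp only [h2, Finset.sum_filter]
  split_ifs with hy
  · rw [← Finset.sum_add_distrib]
    refine Finset.sum_congr rfl fun j _ => ?_
    split_ifs <;> omega
  · rw [zero_add]
    refine Finset.sum_congr rfl fun j _ => ?_
    split_ifs <;> omega

/-- The trees over the values `F r` are in memory. -/
def TreesIn (E : Layout) (F : ℕ → ℕ → ℕ) (a : Conf) : Prop :=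
  ∀ r < E.R, ∀ k < E.V, ∀ x < E.n, a.mem (E.cell (r * E.V + k) x) = node E.n (F r) k x

/-- `reg 30 :=` the sum of the first `reg 28` values of the tree at address `reg 29`. -/
def prefixCmd : Cmd :=
  .seq (.block [.op .add 31 11 5, .const 30 0])
    (.rep 31 (.block [.op .add 32 29 28, .load 32 32, .op .mod 33 28 6, .op .mul 32 32 33,
      .op .add 30 30 32, .op .div 28 28 6, .op .add 29 29 20]))

/-- Invariant: the accumulator plus the sum over the first `y / 2 ^ k` nodes of level `k` is the
wanted total. After `V` levels no nodes are left, because `y ≤ n < 2 ^ V`. -/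
theorem prefixCmd_spec {E : Layout} {w : ℕ} {F : ℕ → ℕ → ℕ} {a : Conf} {r : ℕ} (hf : E.Fits w)
    (hg : Glob E a) (hT : TreesIn E F a) (hF1 : ∀ r j, F r j ≤ 1) (hr : r < E.R)
    (hy : a.reg 28 ≤ E.n) (ha : a.reg 29 = E.tb + r * (E.V * (E.n + 1))) :
    WP w E.size prefixCmd (16 * E.V + 5)
      (fun b => b.reg 30 = ∑ j ∈ Finset.range (a.reg 28), F r j ∧ prefixCmd.Frame a b) a := by
  apply WP.frame
  have hs' := hf.size
  have hV := hf.levels_lt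
  have hn : E.n ≤ E.size := by unfold Layout.size Layout.tb Layout.sb; omega
  have haddr : ∀ k ≤ E.V, E.tb + (r * E.V + k) * (E.n + 1) ≤ E.size := by
    intro k hk
    have : r * E.V + k ≤ E.R * E.V := by
      have : (r + 1) * E.V ≤ E.R * E.V := Nat.mul_le_mul_right _ hr
      linarith
    have := Nat.mul_le_mul_right (E.n + 1) this
    unfold Layout.size; omega
  set y := a.reg 28 with hy_def
  set Tot := ∑ j ∈ Finset.range y, F r j with hTot
  have hTn : Tot ≤ E.n := by
    calc Tot ≤ ∑ j ∈ Finset.range y, 1 := Finset.sum_le_sum fun j _ => hF1 r j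
      _ ≤ E.n := by simpa using hy
  refine WP.mono (t := 3 + (E.V * (13 + 3) + 1) + 1) (Q := fun b => b.reg 30 = _) ?_
    (by omega) fun _ h => h
  refine WP.seq (WP.straight ?_)
  simp only [Cmd.block, pre, hg.V, hg.zero]
  refine ⟨by omega, by omega, ?_⟩
  refine WP.mono (WP.rep (N := E.V) (t := 13)
    (fun k b => b.reg 28 = y / 2 ^ k ∧ b.reg 29 = E.tb + (r * E.V + k) * (E.n + 1) ∧
      b.reg 30 + ∑ j ∈ Finset.range E.n with j / 2 ^ k < y / 2 ^ k, F r j = Tot)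
      rfl rfl (by decide) (by simp) (by simp [hg.one]) ?_ ?_ ?_) le_rfl ?_
  · intro k b x h
    simpa using h
  · refine ⟨by simp [hy_def], by simp [ha, mul_assoc], ?_⟩
    simp only [Conf.set_reg, reduceIte, pow_zero, Nat.div_one, zero_add, hTot]
    refine Finset.sum_congr ?_ fun _ _ => rfl
    ext j; simp; omega
  · rintro k hk b ⟨h1, h2, h3⟩ hF
    have g4 : b.reg 4 = 1 := by rw [hF.1 4 rfl]; simp [hg.one]
    have g6 : b.reg 6 = 2 := by rw [hF.1 6 rfl]; simp [hg.two]
    have g20 : b.reg 20 = E.n + 1 := by rw [hF.1 20 rfl]; simp [hg.level]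
    have hyk : y / 2 ^ k ≤ E.n := (Nat.div_le_self _ _).trans hy
    have ha1 := haddr (k + 1) hk
    have hexp : (r * E.V + (k + 1)) * (E.n + 1) = (r * E.V + k) * (E.n + 1) + (E.n + 1) := by ring
    -- Node `x` sits at offset `x + 1`, so the cell at offset `y / 2 ^ k` holds node `y / 2 ^ k -
    -- 1`; for index `0` it is a padding cell or another cell inside the memory. Multiplying by the
    -- parity replaces a branch and discards the value when it is not wanted.
    have hprod : b.mem (E.tb + (r * E.V + k) * (E.n + 1) + y / 2 ^ k) * (y / 2 ^ k % 2) =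
        if y / 2 ^ k % 2 = 1 then node E.n (F r) k (y / 2 ^ k - 1) else 0 := by
      split_ifs with hodd
      · rw [hodd, mul_one, ← hT r hr k hk _ (by omega), hF.2.1 rfl]
        simp only [Conf.set_mem, Layout.cell]
        congr 1
        omega
      · rw [show y / 2 ^ k % 2 = 0 by omega, mul_zero]
    have hstep := sum_below_level E.n (F r) k (y / 2 ^ k)
    rw [Nat.div_div_eq_div_mul, ← pow_succ] at hstep
    refine WP.straight (Q := fun b => _) ?_
    simp only [pre, Conf.set_reg, Conf.set_mem, h1, h2, g6, g20, reduceIte,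
      Nat.reduceEqDiff, hprod]
    refine ⟨by omega, by omega, by omega, by omega, by omega, ?_, ?_, ?_⟩
    · rw [Nat.div_div_eq_div_mul, pow_succ]
    · rw [hexp]; omega
    · omega
  · rintro b ⟨⟨-, -, h3⟩, hF⟩
    have : y / 2 ^ E.V = 0 := Nat.div_eq_of_lt (lt_of_le_of_lt hy hf.levels)
    simpa [this] using h3

/-! ### Changing one value of a tree -/

/-- In the tree at address `reg 29 - 1`, add `reg 24` to value number `reg 28` and
subtract `reg 34`. -/
def rowCmd : Cmd :=
  .seq (.op .add 31 11 5)
    (.rep 31 (.block [.op .add 32 29 28, .load 33 32, .op .add 33 33 24, .op .sub 33 33 34,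
      .store 32 33, .op .div 28 28 6, .op .add 29 29 20]))

/-- On level `k` only the node `j / 2 ^ k` above the changed position is affected. The new hash is
added before the old one is subtracted, so the natural subtraction is exact by `heq`. Levels of all
trees are numbered consecutively by `τ`; those below the current one already hold `New`, the others
still `Old`. -/
theorem rowCmd_spec {E : Layout} {w : ℕ} {Old New : ℕ → ℕ → ℕ} {a : Conf} {r : ℕ}
    (hf : E.Fits w) (hg : Glob E a) (hr : r < E.R) (hj : a.reg 28 < E.n)
    (ha : a.reg 29 = E.tb + r * (E.V * (E.n + 1)) + 1) (hP : a.reg 24 ≤ 1)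
    (hOld : ∀ τ x, Old τ x ≤ E.n)
    (hne : ∀ k < E.V, ∀ x < E.n, x ≠ a.reg 28 / 2 ^ k →
      New (r * E.V + k) x = Old (r * E.V + k) x)
    (heq : ∀ k < E.V, New (r * E.V + k) (a.reg 28 / 2 ^ k) + a.reg 34 =
      Old (r * E.V + k) (a.reg 28 / 2 ^ k) + a.reg 24)
    (hT : ∀ τ < E.R * E.V, ∀ x < E.n,
      a.mem (E.cell τ x) = if τ < r * E.V then New τ x else Old τ x) :
    WP w E.size rowCmd (16 * E.V + 3)
      (fun b => ((∀ τ < E.R * E.V, ∀ x < E.n,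
        b.mem (E.cell τ x) = if τ < (r + 1) * E.V then New τ x else Old τ x) ∧
        ∀ p ≤ E.tb, b.mem p = a.mem p) ∧ rowCmd.Frame a b) a := by
  apply WP.frame
  have hs' := hf.size
  have hV := hf.levels_lt
  have hn : E.n ≤ E.size := by unfold Layout.size Layout.tb Layout.sb; omega
  have hrk : ∀ k ≤ E.V, r * E.V + k ≤ E.R * E.V := by
    intro k hk
    have : (r + 1) * E.V ≤ E.R * E.V := Nat.mul_le_mul_right _ hr
    linarith
  have haddr : ∀ k ≤ E.V, E.tb + (r * E.V + k) * (E.n + 1) ≤ E.size := by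
    intro k hk
    have := Nat.mul_le_mul_right (E.n + 1) (hrk k hk)
    unfold Layout.size; omega
  set y := a.reg 28 with hy_def
  refine WP.mono (t := 1 + (E.V * (13 + 3) + 1) + 1) (Q := fun b => _ ∧ _) ?_
    (by omega) fun _ h => h
  refine WP.seq (WP.straight (c := .op .add 31 11 5) ?_)
  simp only [pre, hg.V, hg.zero]
  refine ⟨by omega, ?_⟩
  refine WP.mono (WP.rep (N := E.V) (t := 13)
    (fun k b => b.reg 28 = y / 2 ^ k ∧ b.reg 29 = E.tb + (r * E.V + k) * (E.n + 1) + 1 ∧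
      (∀ τ < E.R * E.V, ∀ x < E.n,
        b.mem (E.cell τ x) = if τ < r * E.V + k then New τ x else Old τ x) ∧
        ∀ p ≤ E.tb, b.mem p = a.mem p)
      rfl rfl (by decide) (by simp) (by simp [hg.one]) ?_ ?_ ?_) le_rfl ?_
  · intro k b x h
    simpa using h
  · refine ⟨by simp [hy_def], by simp [ha, mul_assoc], hT, fun _ _ => rfl⟩
  · rintro k hk b ⟨h1, h2, h3, h4⟩ hF
    have g6 : b.reg 6 = 2 := by rw [hF.1 6 rfl]; simp [hg.two]
    have g20 : b.reg 20 = E.n + 1 := by rw [hF.1 20 rfl]; simp [hg.level]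
    have g24 : b.reg 24 = a.reg 24 := by rw [hF.1 24 rfl]; simp
    have g34 : b.reg 34 = a.reg 34 := by rw [hF.1 34 rfl]; simp
    have hyk : y / 2 ^ k < E.n := (Nat.div_le_self _ _).trans_lt hj
    have ha1 := haddr (k + 1) hk
    have hexp : (r * E.V + (k + 1)) * (E.n + 1) = (r * E.V + k) * (E.n + 1) + (E.n + 1) := by ring
    have hcell : E.tb + (r * E.V + k) * (E.n + 1) + 1 + y / 2 ^ k =
        E.cell (r * E.V + k) (y / 2 ^ k) := by unfold Layout.cell; omega
    have hτ : r * E.V + k < E.R * E.V := hrk (k + 1) hk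
    have hlt := E.cell_lt hτ hyk
    have hm := h3 _ hτ _ hyk
    rw [if_neg (lt_irrefl _)] at hm
    have hO := hOld (r * E.V + k) (y / 2 ^ k)
    have he := heq k hk
    refine WP.straight (Q := fun b => _) ?_
    simp only [Cmd.block, pre, Conf.set_reg, Conf.set_mem, Conf.put_reg, Conf.put_mem, h1, h2, g6,
      g20, g24, g34, reduceIte, Nat.reduceEqDiff, hcell, hm]
    refine ⟨by omega, by omega, by omega, by omega, by omega, by omega, ?_, by omega, ?_, ?_⟩
    · rw [Nat.div_div_eq_div_mul, pow_succ]
    · intro τ hτ' x hx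
      split_ifs with hc hc' hc'
      · obtain ⟨rfl, rfl⟩ := E.cell_inj hx hyk hc
        omega
      · obtain ⟨rfl, rfl⟩ := E.cell_inj hx hyk hc
        omega
      · rw [h3 τ hτ' x hx]
        split_ifs with h5
        · rfl
        · obtain rfl : τ = r * E.V + k := by omega
          exact (hne k hk x hx fun h => hc (by rw [h])).symm
      · rw [h3 τ hτ' x hx, if_neg (by omega)]
    · intro p hp
      rw [if_neg, h4 p hp]
      unfold Layout.cell
      omega
  · rintro b ⟨⟨-, -, h3, h4⟩, hF⟩
    refine ⟨?_, h4⟩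
    rwa [add_mul, one_mul]

/-! ### Updates and queries -/

/-- The hash in repetition `r` of the letter code `x` at position `j`. -/
def Layout.hash (E : Layout) (ω : ℕ → Bool) (r j x : ℕ) : ℕ := parity ω E.B ((r * E.n + j) * E.B) x

theorem Layout.hash_le (E : Layout) (ω : ℕ → Bool) (r j x : ℕ) : E.hash ω r j x ≤ 1 :=
  parity_le _ _ _ _

/-- Repetition `r` of the sketch of window `i` of the string with letter codes `y`. -/
def Layout.dyn (E : Layout) (ω : ℕ → Bool) (y : ℕ → ℕ) (r i : ℕ) : ℕ :=
  ∑ p ∈ Finset.range E.m, E.hash ω r (E.f * i + p) (y (E.f * i + p))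

/-- Repetition `r` of the sketch of the static string for window `i`. -/
def Layout.stat (E : Layout) (ω : ℕ → Bool) (z : ℕ → ℕ) (r i : ℕ) : ℕ :=
  ∑ p ∈ Finset.range E.m, E.hash ω r (E.f * i + p) (z (E.g * i + p))

theorem Layout.dyn_le (E : Layout) (ω : ℕ → Bool) (y : ℕ → ℕ) (r i : ℕ) : E.dyn ω y r i ≤ E.m :=
  (Finset.sum_le_sum fun p _ => E.hash_le ω r (E.f * i + p) (y (E.f * i + p))).trans (by simp)

theorem Layout.stat_le (E : Layout) (ω : ℕ → Bool) (z : ℕ → ℕ) (r i : ℕ) :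
    E.stat ω z r i ≤ E.m :=
  (Finset.sum_le_sum fun p _ => E.hash_le ω r (E.f * i + p) (z (E.g * i + p))).trans (by simp)

/-- The square of the difference of the sketches. -/
def Layout.gap (E : Layout) (ω : ℕ → Bool) (y z : ℕ → ℕ) (r i : ℕ) : ℕ :=
  E.dyn ω y r i * E.dyn ω y r i + E.stat ω z r i * E.stat ω z r i -
    E.dyn ω y r i * E.stat ω z r i - E.dyn ω y r i * E.stat ω z r i

def Layout.answer (E : Layout) (ω : ℕ → Bool) (y z : ℕ → ℕ) (i : ℕ) : ℕ :=
  (∑ r ∈ Finset.range E.R, E.gap ω y z r i) * E.num / E.den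

/-- The memory represents the dynamic string with letter codes `y` and the static string with
letter codes `z`; code `0` means that there is no letter. -/
structure Holds (E : Layout) (w : ℕ) (ω : ℕ → Bool) (y z : ℕ → ℕ) (a : Conf) : Prop where
  glob : Glob E a
  coins : CoinsIn E ω a
  cur : ∀ j < E.n, a.mem (E.ub + j) = y j
  sketch : ∀ i, i + E.m ≤ E.n → ∀ r < E.R, a.mem (E.sb + (i * E.R + r)) = E.stat ω z r i
  trees : TreesIn E (fun r j => E.hash ω r j (y j)) a
  word : ∀ j, y j < 2 ^ w

theorem Holds.congr {E : Layout} {w : ℕ} {ω : ℕ → Bool} {y z : ℕ → ℕ} {a b : Conf}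
    (h : Holds E w ω y z a) (hm : b.mem = a.mem) (hg : Glob E b) : Holds E w ω y z b :=
  ⟨hg, fun i hi => by rw [hm]; exact h.coins i hi, fun i hi => by rw [hm]; exact h.cur i hi,
    fun i hi r hr => by rw [hm]; exact h.sketch i hi r hr,
    fun r hr k hk x hx => by rw [hm]; exact h.trees r hr k hk x hx, h.word⟩

/-- One repetition of an update. Registers `37` and `35` hold the old and the new code, `38` the
address of the coins for this repetition and position, `39` the tree address plus one. Both codes
are hashed with the same coins. -/
def updateLoop : Cmd :=
  .seq (.block [.op .add 22 37 5, .op .add 23 38 5])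
    (.seq parityCmd
    (.seq (.block [.op .add 34 24 5, .op .add 22 35 5, .op .add 23 38 5])
    (.seq parityCmd
    (.seq (.block [.op .add 28 0 5, .op .add 29 39 5])
    (.seq rowCmd
    (.block [.op .add 38 38 19, .op .add 39 39 21]))))))

/-- Substitute the letter in register `1` at the index in register `0` of the dynamic string. -/
def updateCmd : Cmd :=
  .seq (.block [.op .add 35 1 4, .op .add 36 15 0, .load 37 36, .store 36 35, .op .mul 38 0 9,
      .op .add 38 38 14, .op .add 39 17 4, .op .add 40 10 5])
    (.rep 40 updateLoop)

theorem Layout.tree_index {E : Layout} {τ : ℕ} (hτ : τ < E.R * E.V) :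
    τ / E.V < E.R ∧ τ % E.V < E.V ∧ τ / E.V * E.V + τ % E.V = τ := by
  have hV : 0 < E.V := Nat.pos_of_ne_zero fun h => by simp [h] at hτ
  refine ⟨(Nat.div_lt_iff_lt_mul hV).2 hτ, Nat.mod_lt _ hV, ?_⟩
  rw [mul_comm]; exact Nat.div_add_mod _ _

/-- The position `j` contributes to exactly one node per level. The statement avoids subtraction by
moving the old value to the other side. -/
theorem node_update_eq {n : ℕ} {F G : ℕ → ℕ} {j : ℕ} (hj : j < n) (h : ∀ i ≠ j, G i = F i)
    (k : ℕ) : node n G k (j / 2 ^ k) + F j = node n F k (j / 2 ^ k) + G j := by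
  unfold node
  have hmem : j ∈ Finset.filter (fun i => i / 2 ^ k = j / 2 ^ k) (Finset.range n) := by
    simpa using hj
  rw [← Finset.add_sum_erase _ _ hmem, ← Finset.add_sum_erase _ F hmem,
    Finset.sum_congr rfl fun i hi => h i (Finset.ne_of_mem_erase hi)]
  ring

theorem node_update_ne {n : ℕ} {F G : ℕ → ℕ} {j : ℕ} (h : ∀ i ≠ j, G i = F i)
    {k x : ℕ} (hx : x ≠ j / 2 ^ k) : node n G k x = node n F k x := by
  refine Finset.sum_congr rfl fun i hi => h i ?_
  rintro rfl
  exact hx (Finset.mem_filter.1 hi).2.symm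

/-- The second conclusion, that the input strings below `E.cb` stay intact, is needed by
preprocessing: it inserts the dynamic string with this same program while reading its letters from
there. -/
theorem updateCmd_spec {E : Layout} {w : ℕ} {ω : ℕ → Bool} {y z : ℕ → ℕ} {a : Conf}
    (hf : E.Fits w) (h : Holds E w ω y z a) (hj : a.reg 0 < E.n) (hl : a.reg 1 + 1 < 2 ^ w) :
    WP w E.size updateCmd (E.R * (28 * E.B + 16 * E.V + 41) + 17)
      (fun b => Holds E w ω (Function.update y (a.reg 0) (a.reg 1 + 1)) z b ∧
        ∀ p < E.cb, b.mem p = a.mem p) a := by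
  have hg := h.glob
  have hs' := hf.size
  have hRp := hf.rep_pos
  have hnB : E.n * E.B ≤ E.R * (E.n * E.B) := Nat.le_mul_of_pos_left _ hRp
  have hRV : E.R * E.V * (E.n + 1) = E.R * (E.V * (E.n + 1)) := mul_assoc _ _ _
  have hsz : E.cb + E.R * (E.n * E.B) + E.n + E.n * E.R + E.R * (E.V * (E.n + 1)) = E.size := by
    rw [← hRV]; rfl
  have hub : E.ub = E.cb + E.R * (E.n * E.B) := rfl
  have hsb : E.sb = E.ub + E.n := rfl
  have htb : E.tb = E.sb + E.n * E.R := rfl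
  have hRle : E.R ≤ E.n * E.R := Nat.le_mul_of_pos_left _ (hf.pos.trans hf.le)
  have hjB : (a.reg 0 + 1) * E.B ≤ E.n * E.B := Nat.mul_le_mul_right _ hj
  rw [add_mul, one_mul] at hjB
  set j := a.reg 0 with hj_def
  set y' := Function.update y j (a.reg 1 + 1) with hy'_def
  have hcur := h.cur j hj
  have hyj := h.word j
  have hy'j : y' j = a.reg 1 + 1 := by simp [hy'_def]
  have hy'ne : ∀ i ≠ j, y' i = y i := fun i hi => by simp [hy'_def, hi]
  -- The global level number `τ` splits into the repetition `τ / V` and the level `τ % V` inside its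
  -- tree.
  let Old : ℕ → ℕ → ℕ := fun τ x => node E.n (fun i => E.hash ω (τ / E.V) i (y i)) (τ % E.V) x
  let New : ℕ → ℕ → ℕ := fun τ x => node E.n (fun i => E.hash ω (τ / E.V) i (y' i)) (τ % E.V) x
  have hstat_lt : ∀ i, i + E.m ≤ E.n → ∀ r < E.R, i * E.R + r < E.n * E.R := by
    intro i hi r hr
    have := hf.pos
    have : (i + 1) * E.R ≤ E.n * E.R := Nat.mul_le_mul_right _ (by omega)
    rw [add_mul, one_mul] at this
    omega
  refine WP.mono (t := 15 + (E.R * (28 * E.B + 16 * E.V + 38 + 3) + 1) + 1)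
    (Q := fun b => Holds E w ω y' z b ∧ ∀ p < E.cb, b.mem p = a.mem p) ?_ (by
      show 15 + (E.R * (28 * E.B + 16 * E.V + 41) + 1) + 1 ≤ _; omega) fun _ h => h
  refine WP.seq (WP.straight ?_)
  simp only [Cmd.block, pre, hg.one, hg.B, hg.zero, hg.ub, hg.tb, hg.cb, hg.R, Conf.set_reg,
    Conf.set_mem, Conf.put_reg, reduceIte, Nat.reduceEqDiff,
    OfNat.zero_ne_ofNat, ← hj_def, hcur]
  refine ⟨by omega, by omega, by omega, by omega, by omega, by omega, by omega, by omega, ?_⟩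
  set a' : Conf := _
  change WP _ _ _ _ _ a'
  have ha'm : ∀ p, a'.mem p = if p = E.ub + j then a.reg 1 + 1 else a.mem p := fun p => by
    simp [a']
  have ha'r : ∀ r < 35, a'.reg r = a.reg r := fun r hr => by
    simp only [a', Conf.set_reg, Conf.put_reg]
    repeat rw [if_neg (by omega)]
  have h35 : a'.reg 35 = a.reg 1 + 1 := by simp [a']
  have h37 : a'.reg 37 = y j := by simp [a']
  have hg' : Glob E a' := hg.of_eq fun r _ _ => ha'r r (by omega)
  have hω' : CoinsIn E ω a' := fun i hi => by
    rw [ha'm, if_neg (by omega)]; exact h.coins i hi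
  refine WP.mono (WP.rep (N := E.R) (t := 28 * E.B + 16 * E.V + 38)
    (fun r b => b.reg 38 = E.cb + (r * E.n + j) * E.B ∧
      b.reg 39 = E.tb + r * (E.V * (E.n + 1)) + 1 ∧
      (∀ τ < E.R * E.V, ∀ x < E.n,
        b.mem (E.cell τ x) = if τ < r * E.V then New τ x else Old τ x) ∧
        ∀ p ≤ E.tb, b.mem p = a'.mem p)
      rfl rfl (by decide) (by simp [a']) (by simp [a', hg.one]) ?_ ?_ ?_) le_rfl ?_
  · intro k b x h
    simpa using h
  · refine ⟨by simp [a']; ring, by simp [a'], fun τ hτ x hx => ?_, fun _ _ => rfl⟩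
    obtain ⟨h1, h2, h3⟩ := E.tree_index hτ
    rw [ha'm, if_neg (by unfold Layout.cell; omega), if_neg (by omega)]
    have := h.trees _ h1 _ h2 x hx
    rwa [h3] at this
  · rintro r hr b ⟨h1, h2, h3, h4⟩ hF
    have hgb := hg'.frame hF rfl
    have hωb : CoinsIn E ω b := fun i hi => by
      rw [h4 _ (by omega)]; exact hω' i hi
    have b0 : b.reg 0 = j := by rw [hF.1 0 rfl, ha'r 0 (by omega)]
    have b35 : b.reg 35 = a.reg 1 + 1 := by rw [hF.1 35 rfl, h35]
    have b37 : b.reg 37 = y j := by rw [hF.1 37 rfl, h37]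
    have hr1 : (r + 1) * (E.n * E.B) ≤ E.R * (E.n * E.B) := Nat.mul_le_mul_right _ hr
    have hr2 : (r + 1) * (E.V * (E.n + 1)) ≤ E.R * (E.V * (E.n + 1)) := Nat.mul_le_mul_right _ hr
    rw [add_mul, one_mul] at hr1 hr2
    have hexp : (r * E.n + j) * E.B = r * (E.n * E.B) + j * E.B := by ring
    refine WP.mono (t := 3 + (14 * E.B + 7 + (5 + (14 * E.B + 7 + (3 + (16 * E.V + 3 + 3 + 1) + 1)
      + 1) + 1) + 1) + 1) ?_ (by omega) fun _ h => h
    refine WP.seq (WP.straight ?_)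
    simp only [Cmd.block, pre, Conf.set_reg, reduceIte, Nat.reduceEqDiff, h1, b37, hgb.zero]
    refine ⟨by omega, by omega, ?_⟩
    refine WP.seq (WP.mono (parityCmd_spec (ω := ω) (e := (r * E.n + j) * E.B) hf
      (hgb.of_eq fun r _ _ => ?_) (fun i hi => hωb i hi) (by omega) (by simp)) le_rfl ?_)
    · simp only [Conf.set_reg]
      repeat rw [if_neg (by omega)]
    rintro c ⟨hc24, hcF⟩
    have c24 : c.reg 24 = E.hash ω r j (y j) := by simpa [Layout.hash] using hc24
    have hgc := (hgb.of_eq fun r _ _ => by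
      simp only [Conf.set_reg]; repeat rw [if_neg (by omega)] : Glob E _).frame hcF rfl
    have hcm := hcF.2.1 rfl
    have c0 := hcF.1 0 rfl
    have c35 := hcF.1 35 rfl
    have c38 := hcF.1 38 rfl
    have c39 := hcF.1 39 rfl
    simp only [Conf.set_reg, Conf.set_mem, reduceIte, Nat.reduceEqDiff, OfNat.zero_ne_ofNat,
      b0, b35, h1, h2] at hcm c0 c35 c38 c39
    have hle1 := E.hash_le ω r j (y j)
    have hle2 := E.hash_le ω r j (y' j)
    refine WP.seq (WP.straight ?_)
    simp only [pre, Conf.set_reg, reduceIte, Nat.reduceEqDiff, c24, c35, c38, hgc.zero]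
    refine ⟨by omega, by omega, by omega, ?_⟩
    refine WP.seq (WP.mono (parityCmd_spec (ω := ω) (e := (r * E.n + j) * E.B) hf
      (hgc.of_eq fun r _ _ => ?_) (fun i hi => by simpa [hcm] using hωb i hi)
      (by omega) (by simp)) le_rfl ?_)
    · simp only [Conf.set_reg]
      repeat rw [if_neg (by omega)]
    rintro d ⟨hd24, hdF⟩
    have d24 : d.reg 24 = E.hash ω r j (y' j) := by
      rw [hy'j]; simpa [Layout.hash] using hd24
    have hgd := (hgc.of_eq fun r _ _ => by
      simp only [Conf.set_reg]; repeat rw [if_neg (by omega)] : Glob E _).frame hdF rfl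
    have hdm := hdF.2.1 rfl
    have d0 := hdF.1 0 rfl
    have d34 := hdF.1 34 rfl
    have d38 := hdF.1 38 rfl
    have d39 := hdF.1 39 rfl
    simp only [Conf.set_reg, Conf.set_mem, reduceIte, Nat.reduceEqDiff, OfNat.zero_ne_ofNat,
      c0, c38, c39, hcm] at hdm d0 d34 d38 d39
    refine WP.seq (WP.straight ?_)
    simp only [pre, Conf.set_reg, reduceIte, Nat.reduceEqDiff, d0, d39, hgd.zero]
    refine ⟨by omega, by omega, ?_⟩
    have hdiv : ∀ k < E.V, (r * E.V + k) / E.V = r ∧ (r * E.V + k) % E.V = k := by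
      intro k hk
      rw [mul_comm r, Nat.mul_add_div (by omega), Nat.div_eq_of_lt hk, Nat.mul_add_mod,
        Nat.mod_eq_of_lt hk]
      exact ⟨by omega, rfl⟩
    refine WP.seq (t := 16 * E.V + 3) (u := 3) (WP.mono (rowCmd_spec (Old := Old) (New := New) (r := r) hf
      (hgd.of_eq fun r _ _ => ?_) hr (by simpa using hj) (by simp) (by simpa [d24] using hle2)
      (fun τ x => node_le (fun i => E.hash_le _ _ _ _) _ _) ?_ ?_ ?_) le_rfl ?_)
    · simp only [Conf.set_reg]
      repeat rw [if_neg (by omega)]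
    · intro k hk x hx hne
      simp only [Old, New, (hdiv k hk).1, (hdiv k hk).2]
      refine node_update_ne (j := j) (fun i hi => by rw [hy'ne i hi]) ?_
      simpa using hne
    · intro k hk
      simp only [Old, New, (hdiv k hk).1, (hdiv k hk).2, Conf.set_reg, reduceIte, Nat.reduceEqDiff,
        d34, d24, add_zero]
      exact node_update_eq (F := fun i => E.hash ω r i (y i)) (G := fun i => E.hash ω r i (y' i))
        hj (fun i hi => by rw [hy'ne i hi]) k
    · intro τ hτ x hx
      simp only [Conf.set_mem, hdm]
      exact h3 τ hτ x hx
    rintro e ⟨⟨he1, he2⟩, heF⟩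
    have hge := (hgd.of_eq fun r _ _ => by
      simp only [Conf.set_reg]; repeat rw [if_neg (by omega)] : Glob E _).frame heF rfl
    have e38 := heF.1 38 rfl
    have e39 := heF.1 39 rfl
    simp only [Conf.set_reg, reduceIte, Nat.reduceEqDiff, d38, d39] at e38 e39
    refine WP.straight (Q := fun b => _) ?_
    simp only [pre, Conf.set_reg, Conf.set_mem, reduceIte, Nat.reduceEqDiff, e38, e39,
      hge.row, hge.tree]
    refine ⟨by omega, by omega, by rw [hexp]; ring, by ring, he1, fun p hp => ?_⟩
    rw [he2 p hp]
    simp only [Conf.set_mem, hdm, h4 p hp]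
  · rintro b ⟨⟨-, -, h3, h4⟩, hF⟩
    refine ⟨⟨hg'.frame hF rfl, fun i hi => ?_, fun i hi => ?_, fun i hi r hr => ?_,
      fun r hr k hk x hx => ?_, fun i => ?_⟩, fun p hp => ?_⟩
    · rw [h4 _ (by omega)]; exact hω' i hi
    · rw [h4 _ (by omega), ha'm]
      split_ifs with hc
      · obtain rfl : i = j := by omega
        exact hy'j.symm
      · rw [h.cur i hi, hy'ne i (by omega)]
    · have := hstat_lt i hi r hr
      rw [h4 _ (by omega), ha'm, if_neg (by omega)]
      exact h.sketch i hi r hr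
    · have hlt : r * E.V + k < E.R * E.V := by
        have : (r + 1) * E.V ≤ E.R * E.V := Nat.mul_le_mul_right _ hr
        linarith
      rw [h3 _ hlt x hx, if_pos hlt]
      have e1 : (r * E.V + k) / E.V = r := by
        rw [mul_comm r, Nat.mul_add_div (by omega), Nat.div_eq_of_lt hk, add_zero]
      have e2 : (r * E.V + k) % E.V = k := by
        rw [mul_comm r, Nat.mul_add_mod, Nat.mod_eq_of_lt hk]
      simp only [New, e1, e2]
    · by_cases hi : i = j
      · rw [hi, hy'j]; exact hl
      · rw [hy'ne i hi]; exact h.word i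
    · rw [h4 _ (by omega), ha'm, if_neg (by omega)]

/-- One repetition of a query. Registers `35` and `36` hold the two ends of the window, `37` the
address of the static sketch, `38` the tree, `39` the sum of squares so far. -/
def queryLoop : Cmd :=
  .seq (.block [.op .add 28 36 5, .op .add 29 38 5])
    (.seq prefixCmd
    (.seq (.block [.op .add 41 30 5, .op .add 28 35 5, .op .add 29 38 5])
    (.seq prefixCmd
    (.block [.op .sub 41 41 30, .load 42 37, .op .mul 43 41 41, .op .mul 44 42 42,
      .op .add 43 43 44, .op .mul 44 41 42, .op .sub 43 43 44, .op .sub 43 43 44,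
      .op .add 39 39 43, .op .add 37 37 4, .op .add 38 38 21]))))

/-- Answer the query for the window in register `0`. -/
def queryCmd : Cmd :=
  .seq (.block [.op .mul 35 18 0, .op .add 36 35 8, .op .mul 37 0 10, .op .add 37 37 16,
      .op .add 38 17 5, .const 39 0, .op .add 40 10 5])
    (.seq (.rep 40 queryLoop)
    (.block [.op .mul 39 39 12, .op .div 0 39 13]))

/-- This keeps the natural subtractions in `Layout.gap` from truncating, so that `gap` is a true
square of a possibly negative difference. -/
theorem two_mul_mul_le_sq_add_sq (x y : ℕ) : x * y + x * y ≤ x * x + y * y := by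
  zify; nlinarith [sq_nonneg ((x : ℤ) - y)]

theorem Layout.gap_le (E : Layout) (ω : ℕ → Bool) (y z : ℕ → ℕ) (r i : ℕ) (h : E.m ≤ E.n) :
    E.gap ω y z r i ≤ 2 * E.n * E.n := by
  have h1 := (E.dyn_le ω y r i).trans h
  have h2 := (E.stat_le ω z r i).trans h
  have h3 := Nat.mul_le_mul h1 h1
  have h4 := Nat.mul_le_mul h2 h2
  have h5 : 2 * E.n * E.n = E.n * E.n + E.n * E.n := by ring
  unfold gap
  omega

theorem queryCmd_spec {E : Layout} {w : ℕ} {ω : ℕ → Bool} {y z : ℕ → ℕ} {a : Conf}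
    (hf : E.Fits w) (h : Holds E w ω y z a) (hi : a.reg 0 + E.m ≤ E.n) :
    WP w E.size queryCmd (E.R * (32 * E.V + 46) + 20)
      (fun b => Holds E w ω y z b ∧ b.reg 0 = E.answer ω y z (a.reg 0)) a := by
  have hg := h.glob
  have hs' := hf.size
  have hRp := hf.rep_pos
  have hm := hf.pos
  have hRV : E.R * E.V * (E.n + 1) = E.R * (E.V * (E.n + 1)) := mul_assoc _ _ _
  have hsz : E.cb + E.R * (E.n * E.B) + E.n + E.n * E.R + E.R * (E.V * (E.n + 1)) = E.size := by
    rw [← hRV]; rfl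
  have hub : E.ub = E.cb + E.R * (E.n * E.B) := rfl
  have hsb : E.sb = E.ub + E.n := rfl
  have htb : E.tb = E.sb + E.n * E.R := rfl
  have hiR : (a.reg 0 + 1) * E.R ≤ E.n * E.R := Nat.mul_le_mul_right _ (by omega)
  rw [add_mul, one_mul] at hiR
  have hRle : E.R ≤ E.n * E.R := Nat.le_mul_of_pos_left _ (hf.pos.trans hf.le)
  have hfi : E.f * a.reg 0 ≤ a.reg 0 := by
    simpa using Nat.mul_le_mul_right (a.reg 0) hf.f_le
  have hans := hf.answer
  have hnum := hf.num_pos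
  set i := a.reg 0 with hi_def
  have hsum : ∀ k, ∑ r ∈ Finset.range k, E.gap ω y z r i ≤ k * (2 * E.n * E.n) := fun k =>
    (Finset.sum_le_sum fun r _ => E.gap_le ω y z r i hf.le).trans (by simp)
  have hacc : E.R * (2 * E.n * E.n) < 2 ^ w := lt_of_le_of_lt (Nat.le_mul_of_pos_right _ hnum) hans
  -- A query has no store instruction and does not touch the parameter registers, so `Holds` follows
  -- from the frame.
  suffices H : WP w E.size queryCmd (E.R * (32 * E.V + 46) + 20)
      (fun b => b.reg 0 = E.answer ω y z i) a by
    exact H.frame.mono le_rfl fun b ⟨hb, hF⟩ => ⟨h.congr (hF.2.1 rfl) (hg.frame hF rfl), hb⟩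
  refine WP.mono (t := 13 + (E.R * (32 * E.V + 43 + 3) + 1 + 3 + 1) + 1)
    (Q := fun b => b.reg 0 = E.answer ω y z i) ?_
    (by show 13 + (E.R * (32 * E.V + 46) + 1 + 3 + 1) + 1 ≤ _; omega) fun _ h => h
  refine WP.seq (WP.straight ?_)
  simp only [Cmd.block, pre, hg.m, hg.zero, hg.f, hg.sb, hg.tb, hg.R, Conf.set_reg,
    reduceIte, Nat.reduceEqDiff, OfNat.zero_ne_ofNat, ← hi_def]
  refine ⟨by omega, by omega, by omega, by omega, by omega, by omega, by omega, ?_⟩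
  set a' : Conf := _
  change WP _ _ _ _ _ a'
  have ha'm : a'.mem = a.mem := rfl
  have ha'r : ∀ r < 35, a'.reg r = a.reg r := fun r hr => by
    simp only [a', Conf.set_reg]
    repeat rw [if_neg (by omega)]
  have h35 : a'.reg 35 = E.f * i := by simp [a']
  have h36 : a'.reg 36 = E.f * i + E.m := by simp [a']
  have hg' : Glob E a' := hg.of_eq fun r _ _ => ha'r r (by omega)
  refine WP.seq (t := E.R * (32 * E.V + 43 + 3) + 1) (u := 3)
    (WP.mono (WP.rep (N := E.R) (t := 32 * E.V + 43)
    (fun r b => b.reg 37 = E.sb + (i * E.R + r) ∧ b.reg 38 = E.tb + r * (E.V * (E.n + 1)) ∧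
      b.reg 39 = ∑ r ∈ Finset.range r, E.gap ω y z r i)
      rfl rfl (by decide) (by simp [a']) (by simp [a', hg.one]) ?_ ?_ ?_) le_rfl ?_)
  · intro k b x h
    simpa using h
  · exact ⟨by simp [a']; ring, by simp [a'], by simp [a']⟩
  · rintro r hr b ⟨h1, h2, h3⟩ hF
    have hgb := hg'.frame hF rfl
    have hbm : b.mem = a.mem := by rw [hF.2.1 rfl, ha'm]
    have b35 : b.reg 35 = E.f * i := by rw [hF.1 35 rfl, h35]
    have b36 : b.reg 36 = E.f * i + E.m := by rw [hF.1 36 rfl, h36]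
    have hr2 : (r + 1) * (E.V * (E.n + 1)) ≤ E.R * (E.V * (E.n + 1)) := Nat.mul_le_mul_right _ hr
    rw [add_mul, one_mul] at hr2
    have hT : ∀ c : Conf, c.mem = a.mem → TreesIn E (fun r j => E.hash ω r j (y j)) c :=
      fun c hc r hr k hk x hx => by rw [hc]; exact h.trees r hr k hk x hx
    refine WP.mono (t := 3 + (16 * E.V + 5 + (5 + (16 * E.V + 5 + 21 + 1)
      + 1) + 1) + 1) ?_ (by omega) fun _ h => h
    refine WP.seq (WP.straight ?_)
    simp only [Cmd.block, pre, Conf.set_reg, reduceIte, Nat.reduceEqDiff, b36, h2, hgb.zero]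
    refine ⟨by omega, by omega, ?_⟩
    refine WP.seq (t := 16 * E.V + 5) (u := 5 + (16 * E.V + 5 + 21 + 1) + 1)
      (WP.mono (prefixCmd_spec (F := fun r j => E.hash ω r j (y j)) (r := r) hf
      (hgb.of_eq fun r _ _ => ?_) (hT _ hbm) (fun _ _ => E.hash_le _ _ _ _) hr (by simp; omega)
      (by simp)) le_rfl ?_)
    · simp only [Conf.set_reg]
      repeat rw [if_neg (by omega)]
    rintro c ⟨c30, hcF⟩
    have hgc := (hgb.of_eq fun r _ _ => by
      simp only [Conf.set_reg]; repeat rw [if_neg (by omega)] : Glob E _).frame hcF rfl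
    have hcm := hcF.2.1 rfl
    have c35 := hcF.1 35 rfl
    have c37 := hcF.1 37 rfl
    have c38 := hcF.1 38 rfl
    have c39 := hcF.1 39 rfl
    simp only [Conf.set_reg, Conf.set_mem, reduceIte, Nat.reduceEqDiff, hbm, b35, h1, h2, h3,
      add_zero] at hcm c35 c37 c38 c39 c30
    have hle1 : ∑ j ∈ Finset.range (E.f * i + E.m), E.hash ω r j (y j) ≤ E.f * i + E.m :=
      (Finset.sum_le_sum fun j _ => E.hash_le ω r j (y j)).trans (by simp)
    refine WP.seq (WP.straight ?_)
    simp only [pre, Conf.set_reg, reduceIte, Nat.reduceEqDiff, c30, c35, c38, hgc.zero]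
    refine ⟨by omega, by omega, by omega, ?_⟩
    refine WP.seq (t := 16 * E.V + 5) (u := 21)
      (WP.mono (prefixCmd_spec (F := fun r j => E.hash ω r j (y j)) (r := r) hf
      (hgc.of_eq fun r _ _ => ?_) (hT _ hcm) (fun _ _ => E.hash_le _ _ _ _) hr (by simp; omega)
      (by simp)) le_rfl ?_)
    · simp only [Conf.set_reg]
      repeat rw [if_neg (by omega)]
    rintro d ⟨d30, hdF⟩
    have hgd := (hgc.of_eq fun r _ _ => by
      simp only [Conf.set_reg]; repeat rw [if_neg (by omega)] : Glob E _).frame hdF rfl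
    have hdm := hdF.2.1 rfl
    have d37 := hdF.1 37 rfl
    have d38 := hdF.1 38 rfl
    have d39 := hdF.1 39 rfl
    have d41 := hdF.1 41 rfl
    simp only [Conf.set_reg, Conf.set_mem, reduceIte, Nat.reduceEqDiff, hcm, c37, c38, c39,
      add_zero] at hdm d37 d38 d39 d41 d30
    -- The sketch of the window is the prefix sum at its end minus the prefix sum at its start.
    have hsplit : ∑ j ∈ Finset.range (E.f * i + E.m), E.hash ω r j (y j) =
        ∑ j ∈ Finset.range (E.f * i), E.hash ω r j (y j) + E.dyn ω y r i := by
      rw [Finset.sum_range_add]; rfl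
    have hsub : d.reg 41 - d.reg 30 = E.dyn ω y r i := by rw [d41, d30, hsplit]; simp
    have hle : d.reg 30 ≤ d.reg 41 := by rw [d41, d30, hsplit]; simp
    have hst := h.sketch i hi r hr
    have hgap := E.gap_le ω y z r i hf.le
    have hdd := E.dyn_le ω y r i
    have hss := E.stat_le ω z r i
    have hd1 := Nat.mul_le_mul (hdd.trans hf.le) (hdd.trans hf.le)
    have hs1 := Nat.mul_le_mul (hss.trans hf.le) (hss.trans hf.le)
    have hsq := two_mul_mul_le_sq_add_sq (E.dyn ω y r i) (E.stat ω z r i)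
    have hnn : 2 * E.n * E.n = E.n * E.n + E.n * E.n := by ring
    have hfsq := hf.sq
    have hacc' : ∑ r ∈ Finset.range (r + 1), E.gap ω y z r i < 2 ^ w :=
      ((hsum _).trans (Nat.mul_le_mul_right _ hr)).trans_lt hacc
    rw [Finset.sum_range_succ] at hacc'
    have hgdef : E.gap ω y z r i = E.dyn ω y r i * E.dyn ω y r i +
      E.stat ω z r i * E.stat ω z r i - E.dyn ω y r i * E.stat ω z r i -
        E.dyn ω y r i * E.stat ω z r i := rfl
    refine WP.straight (Q := fun b => _) ?_
    simp only [pre, Conf.set_reg, Conf.set_mem, reduceIte, Nat.reduceEqDiff, d37, d38, d39,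
      hsub, hgd.one, hgd.tree, hdm, hst, ← hgdef]
    refine ⟨hle, by omega, by omega, by omega, by omega, by omega, by omega, by omega, hacc',
      by omega, by omega, by omega, by ring, ?_⟩
    rw [Finset.sum_range_succ]
  · rintro b ⟨⟨-, -, h3⟩, hF⟩
    have hgb := hg'.frame hF rfl
    refine WP.straight (Q := fun b => b.reg 0 = _) ?_
    simp only [pre, Conf.set_reg, reduceIte, Nat.reduceEqDiff, h3, hgb.num, hgb.den]
    exact ⟨(Nat.mul_le_mul_right _ (hsum _)).trans_lt hans, rfl⟩

/-! ### Preprocessing -/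

/-- Add to register `r` the number of binary digits of register `22`. -/
def sizeCmd (r : ℕ) : Cmd := .loop 22 (.block [.op .add r r 4, .op .div 22 22 6])

/-- Repeated halving reaches zero after exactly `Nat.size` passes. -/
theorem sizeCmd_spec {w S r : ℕ} {a : Conf} (hr : r ≠ 22) (hr4 : r ≠ 4) (hr6 : r ≠ 6)
    (h4 : a.reg 4 = 1) (h6 : a.reg 6 = 2) (hr0 : a.reg r = 0) (hx : Nat.size (a.reg 22) < 2 ^ w) :
    WP w S (sizeCmd r) (Nat.size (a.reg 22) * (3 + 1) + 1)
      (fun b => b.reg r = Nat.size (a.reg 22) ∧ (sizeCmd r).Frame a b) a := by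
  apply WP.frame
  refine (WP.iterate (N := Nat.size (a.reg 22)) (t := 3) (fun k b => b.reg r = k ∧
    b.reg 22 = a.reg 22 / 2 ^ k ∧ b.reg 4 = 1 ∧ b.reg 6 = 2) ?_ ?_ ?_).mono le_rfl fun b hb => hb.1
  · rintro k hk b ⟨h1, h2, h3, h5⟩
    have := Nat.lt_size.1 hk
    refine ⟨?_, WP.straight ?_⟩
    · rw [h2]
      exact (Nat.div_pos this (by positivity)).ne'
    · simp only [Cmd.block, pre, Conf.set_reg, h1, h2, h3, h5, reduceIte, hr.symm, hr4.symm,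
        hr6.symm, hr, Nat.reduceEqDiff, and_true, true_and]
      exact ⟨by omega, by rw [Nat.div_div_eq_div_mul, pow_succ]⟩
  · rintro b ⟨-, h2, -⟩
    rw [h2]
    exact Nat.div_eq_of_lt (Nat.lt_size_self _)
  · exact ⟨hr0, by simp, h4, h6⟩

/-- Windows slide along the text. The start of window `i` therefore moves in the dynamic string
exactly when that is the text (`f = 1`), and otherwise in the static string (`g = 1 - f`). -/
def Mode.flag : Mode → ℕ
  | .patternOnly => 0
  | .textOnly => 1

/-- Where the dynamic string starts. -/
def Mode.dynBase : Mode → ℕ → ℕ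
  | .patternOnly, _ => 0
  | .textOnly, m => m

/-- Where the static string starts. -/
def Mode.statBase : Mode → ℕ → ℕ
  | .patternOnly, m => m
  | .textOnly, _ => 0

/-- The layout for `ρ * q ^ 2` repetitions. -/
def layout (M : Mode) (ρ n m σ q : ℕ) : Layout where
  n := n
  m := m
  B := Nat.size σ
  R := ρ * (q * q)
  V := Nat.size n
  num := 2 * q + 1
  den := ρ * (q * q) * q
  f := M.flag
  g := 1 - M.flag

/-- Registers `50`, `51`, `52`, `53` receive the length and the address of the dynamic string, the
address of the static string, and `g`. -/
def modeCmd : Mode → Cmd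
  | .patternOnly => .block [.const 18 0, .const 53 1, .op .add 50 8 5, .const 51 0, .op .add 52 8 5]
  | .textOnly => .block [.const 18 1, .const 53 0, .op .add 50 7 5, .op .add 51 8 5, .const 52 0]

/-- Compute the parameters. -/
def setupCmd (M : Mode) (ρ : ℕ) : Cmd :=
  .seq (.block [.const 4 1, .const 5 0, .const 6 2, .op .add 7 0 5, .op .add 8 1 5,
      .op .mul 10 3 3, .const 22 ρ, .op .mul 10 22 10, .op .mul 12 6 3, .op .add 12 12 4,
      .op .mul 13 10 3, .const 9 0, .const 11 0, .op .add 22 2 5])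
    (.seq (sizeCmd 9)
    (.seq (.op .add 22 7 5)
    (.seq (sizeCmd 11)
    (.seq (.block [.op .mul 19 7 9, .op .add 20 7 4, .op .mul 21 11 20, .op .add 14 8 7,
      .op .mul 22 10 19, .op .add 15 14 22, .op .add 16 15 7, .op .mul 22 7 10, .op .add 17 16 22])
    (modeCmd M)))))

theorem setupCmd_spec {M : Mode} {ρ n m σ q w : ℕ} {a : Conf} {E : Layout}
    (hE : E = layout M ρ n m σ q) (hf : E.Fits w) (hq : q * q < 2 ^ w) (hρ : ρ < 2 ^ w)
    (hden : E.den < 2 ^ w) (hnum : E.num < 2 ^ w) (hσ : σ < 2 ^ w)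
    (h0 : a.reg 0 = n) (h1 : a.reg 1 = m) (h2 : a.reg 2 = σ) (h3 : a.reg 3 = q) :
    ∃ t, WP w E.size (setupCmd M ρ) t (fun b => (Glob E b ∧ b.reg 50 = M.len n m ∧
      b.reg 51 = M.dynBase m ∧ b.reg 52 = M.statBase m ∧ b.reg 53 = E.g) ∧
      (setupCmd M ρ).Frame a b) a := by
  suffices H : ∃ t, WP w E.size (setupCmd M ρ) t (fun b => (Glob E b ∧ b.reg 50 = M.len n m ∧
      b.reg 51 = M.dynBase m ∧ b.reg 52 = M.statBase m ∧ b.reg 53 = E.g)) a by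
    obtain ⟨t, H⟩ := H
    exact ⟨t, H.frame⟩
  have hs' := hf.size
  have hRp := hf.rep_pos
  have hm := hf.pos
  have hmn := hf.le
  have hnB : E.n * E.B ≤ E.R * (E.n * E.B) := Nat.le_mul_of_pos_left _ hRp
  have hVn : E.V * (E.n + 1) ≤ E.R * (E.V * (E.n + 1)) := Nat.le_mul_of_pos_left _ hRp
  have hRV : E.R * E.V * (E.n + 1) = E.R * (E.V * (E.n + 1)) := mul_assoc _ _ _
  have hsz : E.cb + E.R * (E.n * E.B) + E.n + E.n * E.R + E.R * (E.V * (E.n + 1)) = E.size := by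
    rw [← hRV]; rfl
  have hub : E.ub = E.cb + E.R * (E.n * E.B) := rfl
  have hsb : E.sb = E.ub + E.n := rfl
  have htb : E.tb = E.sb + E.n * E.R := rfl
  have hcb : E.cb = E.m + E.n := rfl
  have hRle : E.R ≤ E.n * E.R := Nat.le_mul_of_pos_left _ (hf.pos.trans hf.le)
  have hB := hf.bits_lt
  have hV := hf.levels_lt
  have en : E.n = n := by rw [hE]; rfl
  have em : E.m = m := by rw [hE]; rfl
  have eB : E.B = Nat.size σ := by rw [hE]; rfl
  have eR : E.R = ρ * (q * q) := by rw [hE]; rfl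
  have eV : E.V = Nat.size n := by rw [hE]; rfl
  have enum : E.num = 2 * q + 1 := by rw [hE]; rfl
  have eden : E.den = E.R * q := by rw [hE]; rfl
  have ef : E.f = M.flag := by rw [hE]; rfl
  have eg : E.g = 1 - M.flag := by rw [hE]; rfl
  clear hE
  refine ⟨_, WP.seq (t := 27) (u := Nat.size σ * (3 + 1) + 1 +
    (1 + (Nat.size n * (3 + 1) + 1 + (17 + 9 + 1) + 1) + 1) + 1) (WP.straight ?_)⟩
  simp only [Cmd.block, pre, Conf.set_reg, reduceIte, Nat.reduceEqDiff, OfNat.zero_ne_ofNat,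
    OfNat.one_ne_ofNat, h0, h1, h2, h3, ← eR]
  refine ⟨by omega, by omega, by omega, by omega, by omega, by omega, by omega, by omega, by omega,
    by omega, by omega, by omega, by omega, by omega, ?_⟩
  refine WP.seq (t := Nat.size σ * (3 + 1) + 1)
    (u := 1 + (Nat.size n * (3 + 1) + 1 + (17 + 9 + 1) + 1) + 1)
    (WP.mono (sizeCmd_spec (by decide) (by decide) (by decide) (by simp) (by simp)
    (by simp) ?_) (by simp) ?_)
  · simp only [Conf.set_reg, reduceIte]; rw [add_zero, ← eB]; exact hB
  rintro b ⟨b9, hbF⟩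
  simp only [Conf.set_reg, reduceIte, add_zero, ← eB] at b9
  have b4 := hbF.1 4 rfl
  have b5 := hbF.1 5 rfl
  have b6 := hbF.1 6 rfl
  have b7 := hbF.1 7 rfl
  have b8 := hbF.1 8 rfl
  have b10 := hbF.1 10 rfl
  have b11 := hbF.1 11 rfl
  have b12 := hbF.1 12 rfl
  have b13 := hbF.1 13 rfl
  simp only [Conf.set_reg, reduceIte, Nat.reduceEqDiff, add_zero] at b4 b5 b6 b7 b8 b10 b11 b12 b13
  refine WP.seq (t := 1) (u := Nat.size n * (3 + 1) + 1 + (17 + 9 + 1) + 1)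
    (WP.straight (c := .op .add 22 7 5) ?_)
  simp only [pre, b7, b5]
  refine ⟨by omega, ?_⟩
  refine WP.seq (t := Nat.size n * (3 + 1) + 1) (u := 17 + 9 + 1)
    (WP.mono (sizeCmd_spec (by decide) (by decide) (by decide) (by simp [b4])
    (by simp [b6]) (by simp [b11]) ?_) (by simp) ?_)
  · simp only [Conf.set_reg, reduceIte]; rw [add_zero, ← eV]; exact hV
  rintro c ⟨c11, hcF⟩
  simp only [Conf.set_reg, reduceIte, add_zero, ← eV] at c11
  have c4 := hcF.1 4 rfl
  have c5 := hcF.1 5 rfl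
  have c6 := hcF.1 6 rfl
  have c7 := hcF.1 7 rfl
  have c8 := hcF.1 8 rfl
  have c9 := hcF.1 9 rfl
  have c10 := hcF.1 10 rfl
  have c12 := hcF.1 12 rfl
  have c13 := hcF.1 13 rfl
  simp only [Conf.set_reg, reduceIte, Nat.reduceEqDiff, b4, b5, b6, b7, b8, b9, b10, b12, b13,
    ← enum, ← eden] at c4 c5 c6 c7 c8 c9 c10 c12 c13
  refine WP.seq (t := 17) (u := 9) (WP.straight ?_)
  simp only [pre, Conf.set_reg, reduceIte, Nat.reduceEqDiff, c4, c7, c8, c9, c10,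
    c11, ← en, ← em]
  rw [← hcb, ← hub, ← hsb, ← htb]
  refine ⟨by omega, by omega, by omega, by omega, by omega, by omega, by omega, by omega, by omega,
    ?_⟩
  cases M
  all_goals
    refine WP.straight ?_
    simp only [Mode.flag] at ef eg
    simp only [modeCmd, Cmd.block, pre, Conf.set_reg, reduceIte, Nat.reduceEqDiff, c5, c7, c8,
      add_zero, Mode.len, Mode.dynBase, Mode.statBase]
    refine ⟨by omega, by omega, by omega, by omega, by omega, ?_, ?_, ?_, ?_, ?_⟩
    · constructor <;> simp [c4, c5, c6, c7, c8, c9, c10, c11, c12, c13, en, em, ef]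
    all_goals first | trivial | exact em.symm | exact en.symm | exact eg.symm

/-- Store the random bits. -/
def coinsCmd : Cmd :=
  .seq (.block [.op .add 22 14 5, .op .mul 23 10 19])
    (.rep 23 (.block [.coin 24, .store 22 24, .op .add 22 22 4]))

/-- This is the only program that tosses coins. Coin `i` ends up in cell `cb + i`, so the stored
bits are literally an initial segment of the random sequence. -/
theorem coinsCmd_spec {E : Layout} {w : ℕ} {a : Conf} (hf : E.Fits w) (hg : Glob E a) :
    ∃ t, WP w E.size coinsCmd t (fun b => (CoinsIn E a.coins b ∧
      ∀ p, p < E.cb ∨ E.ub ≤ p → b.mem p = a.mem p) ∧ coinsCmd.Frame a b) a := by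
  have hs' := hf.size
  have hub : E.ub = E.cb + E.R * (E.n * E.B) := rfl
  have hsz : E.ub ≤ E.size := by unfold Layout.size Layout.tb Layout.sb; omega
  suffices H : ∃ t, WP w E.size coinsCmd t (fun b => CoinsIn E a.coins b ∧
      ∀ p, p < E.cb ∨ E.ub ≤ p → b.mem p = a.mem p) a by
    obtain ⟨t, H⟩ := H
    exact ⟨t, H.frame⟩
  refine ⟨_, WP.seq (t := 3) (u := E.R * (E.n * E.B) * (5 + 3) + 1) (WP.straight ?_)⟩
  simp only [Cmd.block, pre, Conf.set_reg, reduceIte, Nat.reduceEqDiff, hg.zero, hg.cb, hg.R,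
    hg.row]
  refine ⟨by omega, by omega, WP.mono (WP.rep (N := E.R * (E.n * E.B)) (t := 5)
    (fun k b => b.reg 22 = E.cb + k ∧ (∀ i, b.coins i = a.coins (k + i)) ∧
      (∀ i < k, b.mem (E.cb + i) = (a.coins i).toNat) ∧
      ∀ p, p < E.cb ∨ E.ub ≤ p → b.mem p = a.mem p) rfl rfl (by decide) (by simp)
      (by simp [hg.one]) ?_ ?_ ?_) le_rfl ?_⟩
  · intro k b x h
    simpa using h
  · simp
  · rintro k hk b ⟨h1, h2, h3, h4⟩ hF
    have g4 : b.reg 4 = 1 := by rw [hF.1 4 rfl]; simp [hg.one]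
    refine WP.straight (Q := fun b => _) ?_
    simp only [pre, Conf.set_reg, Conf.put_reg, Conf.drop_reg, reduceIte,
      Nat.reduceEqDiff, Conf.set_mem, Conf.put_mem, Conf.set_coins, Conf.put_coins, Conf.drop_mem,
      Conf.drop_coins, h1, h2, g4]
    refine ⟨by omega, by omega, by omega, by omega, fun i => by congr 1; omega, fun i hi => ?_,
      fun p hp => ?_⟩
    · split_ifs with hc
      · obtain rfl : i = k := by omega
        simp
      · exact h3 i (by omega)
    · rw [if_neg (by omega)]
      exact h4 p hp
  · rintro b ⟨⟨-, -, h3, h4⟩, -⟩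
    exact ⟨h3, h4⟩

/-- One term of the sketch of the static string. -/
def termCmd : Cmd :=
  .seq (.block [.load 22 61, .op .add 22 22 4, .op .add 23 62 5])
    (.seq parityCmd
    (.block [.op .add 63 63 24, .op .add 61 61 4, .op .add 62 62 9]))

/-- One repetition of the sketch of the static string for one window. -/
def entryCmd : Cmd :=
  .seq (.block [.op .add 61 55 5, .op .add 62 59 5, .const 63 0, .op .add 64 8 5])
    (.seq (.rep 64 termCmd)
    (.block [.store 57 63, .op .add 57 57 4, .op .add 59 59 19]))

/-- The sketch of the static string for one window. -/
def windowCmd : Cmd :=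
  .seq (.block [.op .add 59 56 5, .op .add 60 10 5])
    (.seq (.rep 60 entryCmd)
    (.block [.op .add 55 55 53, .op .add 56 56 58]))

/-- Compute all sketches of the static string. -/
def sketchCmd : Cmd :=
  .seq (.block [.op .sub 54 7 8, .op .add 54 54 4, .op .add 55 52 5, .op .add 56 14 5,
      .op .add 57 16 5, .op .mul 58 18 9])
    (.rep 54 windowCmd)

/-- Insert the letters of the dynamic string. -/
def insertCmd : Cmd :=
  .seq (.block [.const 65 0, .op .add 66 51 5, .op .add 67 50 5])
    (.rep 67 (.seq (.block [.op .add 0 65 5, .load 1 66])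
      (.seq updateCmd
      (.block [.op .add 65 65 4, .op .add 66 66 4]))))

/-- The hash functions belong to positions of the dynamic string. The static letter aligned with
position `f * i + p` is hashed with the coins of that position, which is why there is a separate
sketch for each window. -/
theorem entryCmd_spec {E : Layout} {w : ℕ} {ω : ℕ → Bool} {z : ℕ → ℕ} {a : Conf} {i r ζ : ℕ}
    (hf : E.Fits w) (hg : Glob E a) (hω : CoinsIn E ω a) (hi : i + E.m ≤ E.n) (hr : r < E.R)
    (hz : ∀ p < E.m, a.mem (ζ + p) + 1 = z (E.g * i + p)) (hz' : ζ + E.m ≤ E.cb)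
    (hzw : ∀ p, z p < 2 ^ w) (h55 : a.reg 55 = ζ)
    (h59 : a.reg 59 = E.cb + (r * E.n + E.f * i) * E.B)
    (h57 : a.reg 57 = E.sb + (i * E.R + r)) :
    WP w E.size entryCmd (E.m * (14 * E.B + 22) + 15)
      (fun b => (b.reg 57 = a.reg 57 + 1 ∧ b.reg 59 = a.reg 59 + E.n * E.B ∧
        ∀ p, b.mem p = if p = a.reg 57 then E.stat ω z r i else a.mem p) ∧ entryCmd.Frame a b) a := by
  apply WP.frame
  have hs' := hf.size
  have hm := hf.pos
  have hub : E.ub = E.cb + E.R * (E.n * E.B) := rfl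
  have hsb : E.sb = E.ub + E.n := rfl
  have htb : E.tb = E.sb + E.n * E.R := rfl
  have hsz : E.tb ≤ E.size := by unfold Layout.size; omega
  have hiR : (i + 1) * E.R ≤ E.n * E.R := Nat.mul_le_mul_right _ (by omega)
  rw [add_mul, one_mul] at hiR
  have hfi : E.f * i ≤ i := by simpa using Nat.mul_le_mul_right i hf.f_le
  have hr1 : (r + 1) * (E.n * E.B) ≤ E.R * (E.n * E.B) := Nat.mul_le_mul_right _ hr
  have hpos : ∀ k ≤ E.m, (r * E.n + E.f * i + k) * E.B ≤ (r + 1) * (E.n * E.B) := by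
    intro k hk
    calc _ ≤ ((r + 1) * E.n) * E.B := Nat.mul_le_mul_right _ (by rw [add_mul]; omega)
      _ = _ := mul_assoc _ _ _
  have hnB : E.n * E.B ≤ E.R * (E.n * E.B) := Nat.le_mul_of_pos_left _ hf.rep_pos
  have hpos0 := hpos 0 (by omega)
  rw [add_zero] at hpos0
  have hstat := E.stat_le ω z r i
  refine WP.mono (t := 7 + (E.m * (14 * E.B + 19 + 3) + 1 + 5 + 1) + 1)
    (Q := fun b => _ ∧ _) ?_ (by show 7 + (E.m * (14 * E.B + 22) + 1 + 5 + 1) + 1 ≤ _; omega)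
    fun _ h => h
  refine WP.seq (WP.straight ?_)
  simp only [Cmd.block, pre, Conf.set_reg, reduceIte, Nat.reduceEqDiff, hg.zero, h55, h59, hg.m]
  refine ⟨by omega, by omega, by omega, by omega, ?_⟩
  set a' : Conf := _
  change WP _ _ _ _ _ a'
  have ha'r : ∀ r < 60, a'.reg r = a.reg r := fun r hr => by
    simp only [a', Conf.set_reg]
    repeat rw [if_neg (by omega)]
  have ha'm : a'.mem = a.mem := rfl
  have hg' : Glob E a' := hg.of_eq fun r _ _ => ha'r r (by omega)
  refine WP.seq (t := E.m * (14 * E.B + 19 + 3) + 1) (u := 5)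
    (WP.mono (WP.rep (N := E.m) (t := 14 * E.B + 19) (fun k b => b.reg 61 = ζ + k ∧
      b.reg 62 = E.cb + (r * E.n + E.f * i + k) * E.B ∧
      b.reg 63 = ∑ p ∈ Finset.range k, E.hash ω r (E.f * i + p) (z (E.g * i + p))) rfl rfl
      (by decide) (by simp [a']) (by simp [a', hg.one]) ?_ ?_ ?_) le_rfl ?_)
  · intro k b x h
    simpa using h
  · simp [a']
  · rintro k hk b ⟨h1, h2, h3⟩ hF
    have hgb := hg'.frame hF rfl
    have hbm : b.mem = a.mem := by rw [hF.2.1 rfl, ha'm]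
    have hzk := hz k hk
    have hpk := hpos (k + 1) hk
    rw [← add_assoc, add_mul _ 1, one_mul] at hpk
    have hpe : (r * E.n + E.f * i + (k + 1)) * E.B = (r * E.n + E.f * i + k) * E.B + E.B := by ring
    have hzl := hzw (E.g * i + k)
    refine WP.mono (t := 5 + (14 * E.B + 7 + 5 + 1) + 1) ?_ (by omega) fun _ h => h
    refine WP.seq (WP.straight ?_)
    simp only [Cmd.block, pre, Conf.set_reg, reduceIte, Nat.reduceEqDiff, h1, h2,
      hgb.zero, hgb.one, hbm, hzk]
    refine ⟨by omega, by omega, by omega, ?_⟩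
    refine WP.seq (t := 14 * E.B + 7) (u := 5) (WP.mono (parityCmd_spec (ω := ω) (e := (r * E.n + E.f * i + k) * E.B) hf
      (hgb.of_eq fun r _ _ => ?_) (fun i hi => by simpa [hbm] using hω i hi) (by omega)
      (by simp)) le_rfl ?_)
    · simp only [Conf.set_reg]
      repeat rw [if_neg (by omega)]
    rintro c ⟨hc24, hcF⟩
    have c24 : c.reg 24 = E.hash ω r (E.f * i + k) (z (E.g * i + k)) := by
      simpa [Layout.hash, add_assoc] using hc24
    have hgc := (hgb.of_eq fun r _ _ => by
      simp only [Conf.set_reg]; repeat rw [if_neg (by omega)] : Glob E _).frame hcF rfl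
    have c61 := hcF.1 61 rfl
    have c62 := hcF.1 62 rfl
    have c63 := hcF.1 63 rfl
    simp only [Conf.set_reg, reduceIte, Nat.reduceEqDiff, h1, h2, h3] at c61 c62 c63
    have hle : ∑ p ∈ Finset.range (k + 1), E.hash ω r (E.f * i + p) (z (E.g * i + p)) ≤ k + 1 :=
      (Finset.sum_le_sum fun p _ => E.hash_le ω r _ _).trans (by simp)
    rw [Finset.sum_range_succ] at hle
    refine WP.straight (Q := fun b => _) ?_
    simp only [pre, Conf.set_reg, reduceIte, Nat.reduceEqDiff, c61, c62, c63, c24,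
      hgc.one, hgc.B]
    refine ⟨by omega, by omega, by omega, by omega, by omega, ?_⟩
    rw [Finset.sum_range_succ]
  · rintro b ⟨⟨-, -, h3⟩, hF⟩
    have hgb := hg'.frame hF rfl
    have hbm : b.mem = a.mem := by rw [hF.2.1 rfl, ha'm]
    have b57 : b.reg 57 = E.sb + (i * E.R + r) := by rw [hF.1 57 rfl, ha'r 57 (by omega), h57]
    have b59 : b.reg 59 = a.reg 59 := by rw [hF.1 59 rfl, ha'r 59 (by omega)]
    change b.reg 63 = E.stat ω z r i at h3
    refine WP.straight (Q := fun b => _) ?_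
    simp only [pre, Conf.set_reg, Conf.set_mem, Conf.put_reg, Conf.put_mem, reduceIte,
      Nat.reduceEqDiff, b57, b59, h3, h57, h59, hbm, hgb.one, hgb.row]
    exact ⟨by omega, by omega, by omega, trivial, trivial, fun _ => trivial⟩

theorem sketchCmd_spec {E : Layout} {w : ℕ} {ω : ℕ → Bool} {z : ℕ → ℕ} {a : Conf} {ζ : ℕ}
    (hf : E.Fits w) (hg : Glob E a) (hω : CoinsIn E ω a)
    (hz : ∀ p < E.g * (E.n - E.m) + E.m, a.mem (ζ + p) + 1 = z p)
    (hz' : ζ + E.g * (E.n - E.m) + E.m ≤ E.cb) (hgle : E.g ≤ 1)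
    (hzw : ∀ p, z p < 2 ^ w) (h52 : a.reg 52 = ζ) (h53 : a.reg 53 = E.g) :
    ∃ t, WP w E.size sketchCmd t (fun b =>
      ((∀ i, i + E.m ≤ E.n → ∀ r < E.R, b.mem (E.sb + (i * E.R + r)) = E.stat ω z r i) ∧
        ∀ p, p < E.sb ∨ E.tb ≤ p → b.mem p = a.mem p) ∧ sketchCmd.Frame a b) a := by
  have hs' := hf.size
  have hm := hf.pos
  have hmn := hf.le
  have hcb : E.cb = E.m + E.n := rfl
  have hub : E.ub = E.cb + E.R * (E.n * E.B) := rfl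
  have hsb : E.sb = E.ub + E.n := rfl
  have htb : E.tb = E.sb + E.n * E.R := rfl
  have hsz : E.tb ≤ E.size := by unfold Layout.size; omega
  have hfB : E.f * E.B ≤ E.B := by simpa using Nat.mul_le_mul_right E.B hf.f_le
  have hnB : E.n * E.B ≤ E.R * (E.n * E.B) := Nat.le_mul_of_pos_left _ hf.rep_pos
  have hRle : E.R ≤ E.n * E.R := Nat.le_mul_of_pos_left _ (hf.pos.trans hf.le)
  have hBlt := hf.bits_lt
  -- The table is filled in order, entry `κ = i * R + r` for window `i` and repetition `r`; a single
  -- index makes the invariants of both loops uniform.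
  suffices H : ∃ t, WP w E.size sketchCmd t (fun b => (∀ κ < (E.n - E.m + 1) * E.R,
      b.mem (E.sb + κ) = E.stat ω z (κ % E.R) (κ / E.R)) ∧
        ∀ p, p < E.sb ∨ E.tb ≤ p → b.mem p = a.mem p) a by
    obtain ⟨t, H⟩ := H
    refine ⟨t, H.frame.mono le_rfl ?_⟩
    rintro b ⟨⟨h1, h2⟩, hF⟩
    refine ⟨⟨fun i hi r hr => ?_, h2⟩, hF⟩
    have : (i + 1) * E.R ≤ (E.n - E.m + 1) * E.R := Nat.mul_le_mul_right _ (by omega)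
    rw [add_mul, one_mul] at this
    rw [h1 _ (by omega)]
    rw [mul_comm i, Nat.mul_add_mod, Nat.mod_eq_of_lt hr, Nat.mul_add_div (by omega),
      Nat.div_eq_of_lt hr, add_zero]
  refine ⟨_, WP.seq (t := 11) (u := (E.n - E.m + 1) *
    (3 + ((E.R * (E.m * (14 * E.B + 22) + 15 + 3) + 1) + 3 + 1) + 1 + 3) + 1) (WP.straight ?_)⟩
  simp only [Cmd.block, pre, Conf.set_reg, reduceIte, Nat.reduceEqDiff, hg.zero, hg.one, hg.m,
    hg.n, hg.cb, hg.sb, hg.f, hg.B, h52]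
  refine ⟨by omega, by omega, by omega, by omega, by omega, by omega, ?_⟩
  set a' : Conf := _
  change WP _ _ _ _ _ a'
  have ha'm : a'.mem = a.mem := rfl
  have hg' : Glob E a' := hg.of_eq fun r _ _ => by
    simp only [a', Conf.set_reg]
    repeat rw [if_neg (by omega)]
  have h53' : a'.reg 53 = E.g := by simp [a', h53]
  have h58' : a'.reg 58 = E.f * E.B := by simp [a']
  refine WP.mono (WP.rep (N := E.n - E.m + 1)
    (t := 3 + ((E.R * (E.m * (14 * E.B + 22) + 15 + 3) + 1) + 3 + 1) + 1)
    (fun i b => b.reg 55 = ζ + E.g * i ∧ b.reg 56 = E.cb + E.f * i * E.B ∧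
      b.reg 57 = E.sb + i * E.R ∧
      (∀ κ < i * E.R, b.mem (E.sb + κ) = E.stat ω z (κ % E.R) (κ / E.R)) ∧
      ∀ p, p < E.sb ∨ E.tb ≤ p → b.mem p = a.mem p) rfl rfl (by decide) (by simp [a'])
      (by simp [a', hg.one]) ?_ ?_ ?_) le_rfl ?_
  · intro k b x h
    simpa using h
  · simp [a']
  · rintro i hi b ⟨h1, h2, h3, h4, h5⟩ hF
    have hgb := hg'.frame hF rfl
    have b53 : b.reg 53 = E.g := by rw [hF.1 53 rfl, h53']
    have b58 : b.reg 58 = E.f * E.B := by rw [hF.1 58 rfl, h58']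
    have hiR : (i + 1) * E.R ≤ E.n * E.R := Nat.mul_le_mul_right _ (by omega)
    rw [add_mul, one_mul] at hiR
    have hfi : E.f * i ≤ i := by simpa using Nat.mul_le_mul_right i hf.f_le
    have hfiB : E.f * i * E.B ≤ E.n * E.B := Nat.mul_le_mul_right _ (by omega)
    have hfiB' : E.f * (i + 1) * E.B = E.f * i * E.B + E.f * E.B := by ring
    have hBn : E.B ≤ E.n * E.B := Nat.le_mul_of_pos_left _ (hm.trans hmn)
    have hgi : E.g * i ≤ E.g * (E.n - E.m) := Nat.mul_le_mul_left _ (by omega)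
    refine WP.seq (WP.straight ?_)
    simp only [Cmd.block, pre, Conf.set_reg, reduceIte, Nat.reduceEqDiff, hgb.zero, hgb.R, h2]
    refine ⟨by omega, by omega, ?_⟩
    set b' : Conf := _
    change WP _ _ _ _ _ b'
    have hb'm : b'.mem = b.mem := rfl
    have hb'r : ∀ r < 59, b'.reg r = b.reg r := fun r hr => by
      simp only [b', Conf.set_reg]
      repeat rw [if_neg (by omega)]
    have hgb' : Glob E b' := hgb.of_eq fun r _ _ => hb'r r (by omega)
    refine WP.seq (t := E.R * (E.m * (14 * E.B + 22) + 15 + 3) + 1) (u := 3)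
      (WP.mono (WP.rep (N := E.R) (t := E.m * (14 * E.B + 22) + 15)
      (fun r c => c.reg 59 = E.cb + (r * E.n + E.f * i) * E.B ∧
        c.reg 57 = E.sb + (i * E.R + r) ∧
        (∀ κ < i * E.R + r, c.mem (E.sb + κ) = E.stat ω z (κ % E.R) (κ / E.R)) ∧
        ∀ p, p < E.sb ∨ E.tb ≤ p → c.mem p = a.mem p) rfl rfl (by decide) (by simp [b'])
        (by simp [b', hgb.one]) ?_ ?_ ?_) le_rfl ?_)
    · intro k b x h
      simpa using h
    · exact ⟨by simp [b'], by simp [b', h3], h4, h5⟩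
    · rintro r hr c ⟨h6, h7, h8, h9⟩ hF'
      have hgc := hgb'.frame hF' rfl
      refine WP.mono (entryCmd_spec (ω := ω) (z := z) (i := i) (r := r) (ζ := ζ + E.g * i) hf hgc
        (fun i hi => ?_) (by omega) hr (fun p hp => ?_) (by omega) hzw ?_ h6 h7) le_rfl ?_
      · rw [h9 _ (by omega)]; exact hω i hi
      · rw [h9 _ (by omega), add_assoc]
        exact hz _ (by omega)
      · rw [hF'.1 55 rfl, hb'r 55 (by omega), h1]
      · rintro d ⟨⟨d57, d59, dm⟩, -⟩
        refine ⟨by rw [d59, h6]; ring, by rw [d57, h7]; ring, fun κ hκ => ?_, fun p hp => ?_⟩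
        · rw [dm, h7]
          split_ifs with hc
          · obtain rfl : κ = i * E.R + r := by omega
            rw [mul_comm i, Nat.mul_add_mod, Nat.mod_eq_of_lt hr, Nat.mul_add_div (by omega),
              Nat.div_eq_of_lt hr, add_zero]
          · exact h8 κ (by omega)
        · rw [dm, h7, if_neg (by omega)]
          exact h9 p hp
    · rintro c ⟨⟨-, h7, h8, h9⟩, hF'⟩
      have c53 : c.reg 53 = E.g := by rw [hF'.1 53 rfl, hb'r 53 (by omega), b53]
      have c58 : c.reg 58 = E.f * E.B := by rw [hF'.1 58 rfl, hb'r 58 (by omega), b58]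
      have c55 : c.reg 55 = ζ + E.g * i := by rw [hF'.1 55 rfl, hb'r 55 (by omega), h1]
      have c56 : c.reg 56 = E.cb + E.f * i * E.B := by rw [hF'.1 56 rfl, hb'r 56 (by omega), h2]
      refine WP.straight (Q := fun b => _) ?_
      simp only [pre, Conf.set_reg, Conf.set_mem, reduceIte, Nat.reduceEqDiff, c53, c55,
        c56, c58, h7]
      refine ⟨by omega, by omega, by ring, by ring, by ring, fun κ hκ => h8 κ ?_, h9⟩
      rwa [add_mul, one_mul] at hκ
  · rintro b ⟨⟨-, -, -, h4, h5⟩, -⟩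
    exact ⟨h4, h5⟩

/-- The trees are not built separately: the letters are inserted one at a time by the update program
into a string that has no letters at first. -/
theorem insertCmd_spec {E : Layout} {w : ℕ} {ω : ℕ → Bool} {z T : ℕ → ℕ} {a : Conf} {η ℓ : ℕ}
    (hf : E.Fits w) (h : Holds E w ω (fun _ => 0) z a) (hℓ : ℓ ≤ E.n) (hη : η + ℓ ≤ E.cb)
    (hT : ∀ p < E.cb, a.mem p = T p) (hTw : ∀ p, T p + 1 < 2 ^ w) (h50 : a.reg 50 = ℓ)
    (h51 : a.reg 51 = η) :
    ∃ t, WP w E.size insertCmd t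
      (Holds E w ω (fun j => if j < ℓ then T (η + j) + 1 else 0) z) a := by
  have hs' := hf.size
  have hg := h.glob
  have hcb : E.cb ≤ E.size := by
    unfold Layout.size Layout.tb Layout.sb Layout.ub; omega
  have hn : E.n ≤ E.cb := by unfold Layout.cb; omega
  refine ⟨_, WP.seq (t := 5) (u := ℓ * (3 + (E.R * (28 * E.B + 16 * E.V + 41) + 17 + 3 + 1) + 1 + 3)
    + 1) (WP.straight ?_)⟩
  simp only [Cmd.block, pre, Conf.set_reg, reduceIte, Nat.reduceEqDiff, hg.zero, h50, h51]
  refine ⟨by omega, by omega, by omega, ?_⟩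
  set a' : Conf := _
  change WP _ _ _ _ _ a'
  have hg' : Glob E a' := hg.of_eq fun r _ _ => by
    simp only [a', Conf.set_reg]
    repeat rw [if_neg (by omega)]
  -- Overwriting register `67` by `0` inside the invariant makes it insensitive to the loop counter,
  -- as the `closed` hypothesis of `WP.rep` demands.
  refine WP.mono (WP.rep (N := ℓ)
    (t := 3 + (E.R * (28 * E.B + 16 * E.V + 41) + 17 + 3 + 1) + 1)
    (fun k b => b.reg 65 = k ∧ b.reg 66 = η + k ∧ (∀ p < E.cb, b.mem p = T p) ∧
      Holds E w ω (fun j => if j < k then T (η + j) + 1 else 0) z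
        { b with reg := Function.update b.reg 67 0 })
      rfl rfl (by decide) (by simp [a']) (by simp [a', hg.one]) ?_ ?_ ?_) le_rfl ?_
  · intro k b x ⟨h1, h2, h3, h4⟩
    refine ⟨by simpa using h1, by simpa using h2, h3, ?_⟩
    simpa [Conf.set] using h4
  · refine ⟨by simp [a'], by simp [a'], hT, ?_⟩
    simp only [Nat.not_lt_zero, if_false]
    exact h.congr rfl (hg'.of_eq fun r _ _ => Function.update_of_ne (by omega) _ _)
  · rintro k hk b ⟨h1, h2, h3, h4⟩ hF
    have hgb := hg'.frame hF rfl
    have hTk := h3 (η + k) (by omega)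
    refine WP.seq (WP.straight ?_)
    simp only [pre, Conf.set_reg, Conf.set_mem, reduceIte, OfNat.ofNat_ne_zero, h1, h2, hgb.zero, hTk]
    refine ⟨by omega, by omega, ?_⟩
    have hgb' : Glob E ((b.set 0 (k + 0)).set 1 (T (η + k))) := hgb.of_eq fun r _ _ => by
      simp only [Conf.set_reg]
      repeat rw [if_neg (by omega)]
    refine WP.seq (t := E.R * (28 * E.B + 16 * E.V + 41) + 17) (u := 3)
      (WP.mono (updateCmd_spec (a := (b.set 0 (k + 0)).set 1 (T (η + k))) (ω := ω) (z := z) hf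
        (h4.congr rfl hgb')
        (by simp; omega) (by simpa using hTw (η + k))).frame le_rfl ?_)
    rintro c ⟨⟨hc, hcT⟩, hcF⟩
    have c65 := hcF.1 65 rfl
    have c66 := hcF.1 66 rfl
    simp only [Conf.set_reg, reduceIte, OfNat.ofNat_ne_zero, OfNat.ofNat_ne_one,
      h1, h2] at c65 c66
    refine WP.straight (Q := fun b => _) ?_
    simp only [pre, Conf.set_reg, Conf.set_mem, reduceIte, Nat.reduceEqDiff, c65, c66,
      hc.glob.one]
    refine ⟨by omega, by omega, trivial, by omega, fun p hp => ?_, ?_⟩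
    · rw [hcT p hp]; exact h3 p hp
    · have hfun : (fun j => if j < k + 1 then T (η + j) + 1 else 0) =
          Function.update (fun j => if j < k then T (η + j) + 1 else 0)
            (((b.set 0 (k + 0)).set 1 (T (η + k))).reg 0)
            (((b.set 0 (k + 0)).set 1 (T (η + k))).reg 1 + 1) := by
        funext j
        simp only [Conf.set_reg, reduceIte, zero_ne_one, add_zero,
          Function.update_apply]
        split_ifs with h5 h6 h7 h8 <;> first | omega | rfl | (subst h6; rfl)
      rw [hfun]
      refine hc.congr rfl (hc.glob.of_eq fun r _ _ => ?_)
      simp only [Function.update_apply, Conf.set_reg]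
      repeat rw [if_neg (by omega)]
  · rintro b ⟨⟨-, -, -, h4⟩, hF⟩
    exact h4.congr rfl (hg'.frame hF rfl)

/-! ### Correctness of the data structure for given random bits -/

def initCmd (M : Mode) (ρ : ℕ) : Cmd :=
  .seq (setupCmd M ρ) (.seq coinsCmd (.seq sketchCmd insertCmd))

/-- The data structure with `ρ * q ^ 2` repetitions. -/
def sketchStructure (M : Mode) (ρ : ℕ) : DataStructure := ⟨initCmd M ρ, updateCmd, queryCmd⟩

/-- The parameters and the intermediate results of preprocessing are machine words. -/
structure Good (M : Mode) (ρ n m σ q w : ℕ) : Prop where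
  fits : (layout M ρ n m σ q).Fits w
  sq : q * q < 2 ^ w
  rho : ρ < 2 ^ w
  den : (layout M ρ n m σ q).den < 2 ^ w
  num : (layout M ρ n m σ q).num < 2 ^ w
  letter : σ + 1 < 2 ^ w

theorem State.val_injective {w : ℕ} : Function.Injective (State.val (w := w)) := by
  intro s s' h
  have h1 := congrArg Conf.reg h
  have h2 := congrArg Conf.mem h
  have h3 := congrArg Conf.coins h
  cases s
  cases s'
  simp only [State.val, funext_iff] at h1 h2 h3
  congr
  · exact funext fun i => BitVec.eq_of_toNat_eq (h1 i)
  · exact funext fun i => BitVec.eq_of_toNat_eq (h2 i)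
  · exact funext h3

/-- The time of `d` may depend on the state that `c` leaves. Since `State.val` is injective, at most
one start state reads as `a`, so the bounds of one run from it can be fixed in advance. -/
theorem WP.seq_exists {w S : ℕ} {c d : Cmd} {Q : Conf → Prop} {a : Conf}
    (h : ∃ t, WP w S c t (fun b => ∃ u, WP w S d u Q b) a) : ∃ t, WP w S (.seq c d) t Q a := by
  obtain ⟨t, h⟩ := h
  by_cases hs : ∃ s : State w, s.val = a
  · obtain ⟨s, hs⟩ := hs
    obtain ⟨t', -, s', h₁, u, h₂⟩ := h s hs
    refine ⟨t' + u + 1, WP.seq fun s₂ hs₂ => ?_⟩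
    rw [State.val_injective (hs₂.trans hs.symm)]
    exact ⟨t', le_rfl, s', h₁, h₂⟩
  · exact ⟨0, fun s hs' => (hs ⟨s, hs'⟩).elim⟩

/-- The code `0` of an absent letter contributes nothing, so all-zero memory is a correct set of
trees for the empty dynamic string. -/
theorem parity_zero (ω : ℕ → Bool) (B e : ℕ) : parity ω B e 0 = 0 := by simp [parity]

theorem Mode.len_le (M : Mode) {n m : ℕ} (h : m ≤ n) : M.len n m ≤ n := by
  cases M <;> simp [Mode.len, h]

theorem initCmd_spec {M : Mode} {ρ n m σ q w : ℕ} (H : Good M ρ n m σ q w) {a : Conf}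
    {T z : ℕ → ℕ} (h0 : a.reg 0 = n) (h1 : a.reg 1 = m) (h2 : a.reg 2 = σ) (h3 : a.reg 3 = q)
    (hT : ∀ p, a.mem p = T p) (hT0 : ∀ p, m + n ≤ p → T p = 0) (hTw : ∀ p, T p + 1 < 2 ^ w)
    (hz : ∀ p < (1 - M.flag) * (n - m) + m, T (M.statBase m + p) + 1 = z p)
    (hzw : ∀ p, z p < 2 ^ w) :
    ∃ t, WP w (layout M ρ n m σ q).size (initCmd M ρ) t
      (Holds (layout M ρ n m σ q) w a.coins
        (fun j => if j < M.len n m then T (M.dynBase m + j) + 1 else 0) z) a := by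
  obtain ⟨E, hE⟩ : ∃ E, E = layout M ρ n m σ q := ⟨_, rfl⟩
  have hf := H.fits
  have hden := H.den
  have hnum := H.num
  rw [← hE] at hf hden hnum ⊢
  have en : E.n = n := by rw [hE]; rfl
  have em : E.m = m := by rw [hE]; rfl
  have eg : E.g = 1 - M.flag := by rw [hE]; rfl
  have hcb : E.cb = E.m + E.n := rfl
  have hub : E.ub = E.cb + E.R * (E.n * E.B) := rfl
  have hsb : E.sb = E.ub + E.n := rfl
  have htb : E.tb = E.sb + E.n * E.R := rfl
  have hle := hf.le
  have hlen := M.len_le (en ▸ em ▸ hle : m ≤ n)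
  have hbase : M.statBase m + E.g * (E.n - E.m) + E.m ≤ E.cb := by
    rw [eg]; cases M <;> simp [Mode.statBase, Mode.flag] <;> omega
  have hbase' : M.dynBase m + M.len n m ≤ E.cb := by
    cases M <;> simp [Mode.dynBase, Mode.len] <;> omega
  obtain ⟨t₁, H₁⟩ := setupCmd_spec hE hf H.sq H.rho hden hnum
    (by have := H.letter; omega) h0 h1 h2 h3
  refine WP.seq_exists ⟨t₁, H₁.mono le_rfl ?_⟩
  rintro b ⟨⟨bg, b50, b51, b52, b53⟩, bF⟩
  have bm : b.mem = a.mem := bF.2.1 (by cases M <;> rfl)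
  have bc : b.coins = a.coins := bF.2.2 (by cases M <;> rfl)
  obtain ⟨t₂, H₂⟩ := coinsCmd_spec hf bg
  refine WP.seq_exists ⟨t₂, H₂.mono le_rfl ?_⟩
  rintro c ⟨⟨cω, cm⟩, cF⟩
  rw [bc] at cω
  have cg := bg.frame cF rfl
  have cT : ∀ p, p < E.cb ∨ E.ub ≤ p → c.mem p = T p := fun p hp => by rw [cm p hp, bm, hT]
  obtain ⟨t₃, H₃⟩ := sketchCmd_spec (z := z) hf cg cω (ζ := M.statBase m)
    (fun p hp => by rw [cT _ (by omega)]; exact hz p (by rwa [eg, en, em] at hp)) hbase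
    (by rw [eg]; omega) hzw (by rw [cF.1 52 rfl, b52]) (by rw [cF.1 53 rfl, b53])
  refine WP.seq_exists ⟨t₃, H₃.mono le_rfl ?_⟩
  rintro d ⟨⟨d1, d2⟩, dF⟩
  have dT : ∀ p, p < E.cb ∨ E.ub ≤ p ∧ p < E.sb ∨ E.tb ≤ p → d.mem p = T p := fun p hp => by
    rw [d2 p (by omega), cT p (by omega)]
  refine insertCmd_spec (η := M.dynBase m) (ℓ := M.len n m) (T := T) hf
    ⟨cg.frame dF rfl, fun i hi => ?_, fun j hj => ?_, d1, fun r hr k hk x hx => ?_,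
      fun _ => by positivity⟩ (by omega) hbase' (fun p hp => dT p (by omega)) hTw
    (by rw [dF.1 50 rfl, cF.1 50 rfl, b50]) (by rw [dF.1 51 rfl, cF.1 51 rfl, b51])
  · rw [d2 _ (by omega)]; exact cω i hi
  · rw [dT _ (by omega), hT0 _ (by omega)]
  · rw [dT _ (by unfold Layout.cell; omega), hT0 _ (by unfold Layout.cell; omega)]
    simp [node, Layout.hash, parity_zero]

/-! ### Running the data structure -/

/-- The letter codes of the dynamic string. -/
def Strings.dynCode {n m σ : ℕ} (x : Strings n m σ) : Mode → ℕ → ℕ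
  | .patternOnly, j => if h : j < m then x.pattern ⟨j, h⟩ + 1 else 0
  | .textOnly, j => if h : j < n then x.text ⟨j, h⟩ + 1 else 0

/-- The letter codes of the static string. -/
def Strings.statCode {n m σ : ℕ} (x : Strings n m σ) : Mode → ℕ → ℕ
  | .patternOnly, j => if h : j < n then x.text ⟨j, h⟩ + 1 else 0
  | .textOnly, j => if h : j < m then x.pattern ⟨j, h⟩ + 1 else 0

theorem Strings.dynCode_le {n m σ : ℕ} (x : Strings n m σ) (M : Mode) (j : ℕ) :
    x.dynCode M j ≤ σ := by
  cases M <;> simp only [dynCode] <;> split_ifs <;> omega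

theorem Strings.statCode_le {n m σ : ℕ} (x : Strings n m σ) (M : Mode) (j : ℕ) :
    x.statCode M j ≤ σ := by
  cases M <;> simp only [statCode] <;> split_ifs <;> omega

theorem code_update {k σ : ℕ} (v : Fin k → Fin σ) (j : Fin k) (a : Fin σ) (i : ℕ) :
    (if h : i < k then (Function.update v j a ⟨i, h⟩ : ℕ) + 1 else 0) =
      if i = j then (a : ℕ) + 1 else if h : i < k then (v ⟨i, h⟩ : ℕ) + 1 else 0 := by
  by_cases hi : i = j
  · subst hi
    simp
  · rw [if_neg hi]
    split_ifs with h
    · rw [Function.update_of_ne (by simpa [Fin.ext_iff] using hi)]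
    · rfl

theorem Strings.dynCode_update {n m σ : ℕ} (x : Strings n m σ) (M : Mode) (j : Fin (M.len n m))
    (a : Fin σ) :
    (x.update M j a).dynCode M = Function.update (x.dynCode M) j (a + 1) := by
  funext i
  rw [Function.update_apply]
  cases M
  · exact code_update x.pattern j a i
  · exact code_update x.text j a i

theorem Strings.statCode_apply {M : Mode} {n m σ : ℕ} (x : Strings n m σ) (r : Request M n m σ) :
    (r.apply x).statCode M = x.statCode M := by
  cases r <;> cases M <;> rfl

theorem Strings.statCode_foldl {M : Mode} {n m σ : ℕ} (rs : List (Request M n m σ))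
    (x : Strings n m σ) : (rs.foldl Request.apply x).statCode M = x.statCode M := by
  induction rs generalizing x with
  | nil => rfl
  | cons r rs ih => rw [List.foldl_cons, ih, statCode_apply]

/-- The time of an update. -/
def Layout.updateTime (E : Layout) : ℕ := E.R * (28 * E.B + 16 * E.V + 41) + 17
/-- The time of a query. -/
def Layout.queryTime (E : Layout) : ℕ := E.R * (32 * E.V + 46) + 20

section Serving

variable {M : Mode} {ρ n m σ q w : ℕ} {ε : ℝ}

local notation "𝓔" => layout M ρ n m σ q

theorem exists_serves_query (H : Good M ρ n m σ q w) {s : State w} {ω : ℕ → Bool} {y z : ℕ → ℕ}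
    (hs : Holds 𝓔 w ω y z s.val) (i : Fin (n - m + 1)) :
    ∃ s' : State w, (sketchStructure M ρ).Serves (𝓔).size (𝓔).updateTime (𝓔).queryTime s
      (Request.query i : Request M n m σ) s' ∧ Holds 𝓔 w ω y z s'.val ∧
        (s'.reg 0).toNat = (𝓔).answer ω y z i := by
  have hf := H.fits
  have hle : m ≤ n := hf.le
  have hs' := hf.size
  have hn : n ≤ (𝓔).size := by
    show (𝓔).n ≤ _
    unfold Layout.size Layout.tb Layout.sb; omega
  have hi : (BitVec.ofNat w i).toNat = i := by
    rw [BitVec.toNat_ofNat, Nat.mod_eq_of_lt (by omega)]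
  have hval : (s.setReg 0 (BitVec.ofNat w i)).val = s.val.set 0 i := by
    rw [State.val_setReg, hi]
  have := queryCmd_spec (a := s.val.set 0 i) hf
    (hs.congr rfl (hs.glob.of_eq fun r _ _ => by rw [Conf.set_reg, if_neg (by omega)]))
    (by show _ + m ≤ n; simp; omega)
  obtain ⟨t, ht, s', h₁, h₂, h₃⟩ := this _ hval
  exact ⟨s', ⟨t, ht, h₁⟩, h₂, by simpa [State.val] using h₃⟩

theorem exists_serves (H : Good M ρ n m σ q w) {s : State w} {ω : ℕ → Bool} {x : Strings n m σ}
    {z : ℕ → ℕ} (hs : Holds 𝓔 w ω (x.dynCode M) z s.val) (r : Request M n m σ) :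
    ∃ s' : State w, (sketchStructure M ρ).Serves (𝓔).size (𝓔).updateTime (𝓔).queryTime s r s' ∧
      Holds 𝓔 w ω ((r.apply x).dynCode M) z s'.val := by
  cases r with
  | query i =>
    obtain ⟨s', h₁, h₂, -⟩ := exists_serves_query H hs i
    exact ⟨s', h₁, h₂⟩
  | update j a =>
    have hf := H.fits
    have hle : m ≤ n := hf.le
    have hs' := hf.size
    have hl := H.letter
    have hn : n ≤ (𝓔).size := by
      show (𝓔).n ≤ _
      unfold Layout.size Layout.tb Layout.sb; omega
    have hj : (j : ℕ) < n := lt_of_lt_of_le j.isLt (M.len_le hle)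
    have hj' : (BitVec.ofNat w j).toNat = j := by
      rw [BitVec.toNat_ofNat, Nat.mod_eq_of_lt (by omega)]
    have ha' : (BitVec.ofNat w a).toNat = a := by
      rw [BitVec.toNat_ofNat, Nat.mod_eq_of_lt (by omega)]
    have hval : ((s.setReg 0 (BitVec.ofNat w j)).setReg 1 (BitVec.ofNat w a)).val =
        (s.val.set 0 j).set 1 a := by
      rw [State.val_setReg, State.val_setReg, hj', ha']
    have := updateCmd_spec (a := (s.val.set 0 j).set 1 a) hf
      (hs.congr rfl (hs.glob.of_eq fun r _ _ => by
        rw [Conf.set_reg, if_neg (by omega), Conf.set_reg, if_neg (by omega)]))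
      (by show _ < n; simpa using hj) (by simp; omega)
    obtain ⟨t, ht, s', h₁, h₂, -⟩ := this _ hval
    refine ⟨s', ⟨t, ht, h₁⟩, ?_⟩
    simp only [Request.apply, Strings.dynCode_update]
    simpa using h₂

theorem exists_servesAll (H : Good M ρ n m σ q w) {ω : ℕ → Bool} {z : ℕ → ℕ}
    (rs : List (Request M n m σ)) {s : State w} {x : Strings n m σ}
    (hs : Holds 𝓔 w ω (x.dynCode M) z s.val) :
    ∃ s' : State w,
      (sketchStructure M ρ).ServesAll (𝓔).size (𝓔).updateTime (𝓔).queryTime rs s s' ∧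
      Holds 𝓔 w ω ((rs.foldl Request.apply x).dynCode M) z s'.val := by
  induction rs generalizing s x with
  | nil => exact ⟨s, rfl, hs⟩
  | cons r rs ih =>
    obtain ⟨s₁, h₁, h₂⟩ := exists_serves H hs r
    obtain ⟨s', h₃, h₄⟩ := ih h₂
    exact ⟨s', ⟨s₁, h₁, h₃⟩, h₄⟩

/-- For every `ω` the state reached encodes the stored coins and the current strings, independently
of the path of updates. Randomness enters the later analysis only through these coins. -/
theorem exists_reaches (H : Good M ρ n m σ q w) (hq : ⌈1 / ε⌉₊ = q) (hqw : q < 2 ^ w)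
    (x : Strings n m σ) (rs : List (Request M n m σ)) (ω : ℕ → Bool) :
    ∃ s : State w,
      (sketchStructure M ρ).Reaches (𝓔).size (𝓔).updateTime (𝓔).queryTime ε x ω rs s ∧
      Holds 𝓔 w ω ((rs.foldl Request.apply x).dynCode M) (x.statCode M) s.val := by
  have hf := H.fits
  have hle : m ≤ n := hf.le
  have hs' := hf.size
  have hl := H.letter
  have hn : n ≤ (𝓔).size := by
    show (𝓔).n ≤ _
    unfold Layout.size Layout.tb Layout.sb; omega
  have hval : ∀ k, k < 2 ^ w → (BitVec.ofNat w k).toNat = k := fun k hk => by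
    rw [BitVec.toNat_ofNat, Nat.mod_eq_of_lt hk]
  let T : ℕ → ℕ := fun p => if h : p < m then x.pattern ⟨p, h⟩
    else if h' : p - m < n then x.text ⟨p - m, h'⟩ else 0
  have hTw : ∀ p, T p + 1 < 2 ^ w := by
    intro p
    simp only [T]
    split_ifs <;> omega
  obtain ⟨t, h⟩ := initCmd_spec H (a := (startState w ε x ω).val) (T := T) (z := x.statCode M)
    (hval n (by omega)) (hval m (by omega)) (hval σ (by omega)) (hq ▸ hval q hqw)
    (fun p => by
      simp only [State.val, startState, T]
      split_ifs <;> exact hval _ (by omega))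
    (fun p hp => by
      simp only [T]
      rw [dif_neg (by omega), dif_neg (by omega)])
    hTw
    (fun p hp => by
      cases M
      · simp only [Mode.flag, Mode.statBase, T, Strings.statCode] at hp ⊢
        rw [dif_neg (by omega), dif_pos (by omega : m + p - m < n), dif_pos (by omega)]
        simp
      · simp only [Mode.flag, Mode.statBase, T, Strings.statCode] at hp ⊢
        rw [dif_pos (by omega : 0 + p < m), dif_pos (by omega)]
        simp)
    (fun p => lt_of_le_of_lt (x.statCode_le M p) (by omega))
  obtain ⟨t', -, s₀, h₁, h₂⟩ := h _ rfl
  have hdyn : (fun j => if j < M.len n m then T (M.dynBase m + j) + 1 else 0) = x.dynCode M := by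
    funext j
    cases M
    · simp only [Mode.len, Mode.dynBase, Strings.dynCode, T, zero_add]
      split_ifs <;> rfl
    · simp only [Mode.len, Mode.dynBase, Strings.dynCode, T]
      by_cases hj : j < n <;> simp [hj]
  rw [hdyn] at h₂
  obtain ⟨s', h₃, h₄⟩ := exists_servesAll H rs h₂
  exact ⟨s', ⟨t', s₀, h₁, h₃⟩, h₄⟩

end Serving

open MeasureTheory ProbabilityTheory

/-! ### Functions of finitely many coin tosses -/

instance : IsProbabilityMeasure fairCoins := by
  unfold fairCoins; infer_instance

section Coins

variable {f g : (ℕ → Bool) → ℝ} {S T : Finset ℕ}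

theorem exists_comp_restrict (hf : DependsOn f S) :
    ∃ φ : (S → Bool) → ℝ, f = fun ω => φ fun i => ω i := by
  obtain ⟨φ, hφ⟩ := dependsOn_iff_exists_comp.1 hf
  exact ⟨φ, hφ⟩

theorem measurable_of_dependsOn (hf : DependsOn f S) : Measurable f := by
  obtain ⟨φ, rfl⟩ := exists_comp_restrict hf
  exact (measurable_of_finite φ).comp (by fun_prop)

theorem memLp_of_dependsOn (hf : DependsOn f S) (p : ENNReal) : MemLp f p fairCoins := by
  have hm := measurable_of_dependsOn hf
  obtain ⟨φ, rfl⟩ := exists_comp_restrict hf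
  exact MemLp.of_bound hm.aestronglyMeasurable (∑ x, ‖φ x‖) (.of_forall fun ω =>
    Finset.single_le_sum (f := fun x => ‖φ x‖) (fun _ _ => norm_nonneg _) (Finset.mem_univ _))

theorem integrable_of_dependsOn (hf : DependsOn f S) : Integrable f fairCoins :=
  memLp_one_iff_integrable.1 (memLp_of_dependsOn hf 1)

/-- Each function factors through the restriction to its own finite set of coordinates, and the
coordinates of the product measure are independent. -/
theorem indepFun_of_dependsOn (hf : DependsOn f S) (hg : DependsOn g T) (hST : Disjoint S T) :
    IndepFun f g fairCoins := by
  obtain ⟨φ, rfl⟩ := exists_comp_restrict hf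
  obtain ⟨ψ, rfl⟩ := exists_comp_restrict hg
  have h : iIndepFun (fun (i : ℕ) (ω : ℕ → Bool) => ω i) fairCoins :=
    iIndepFun_infinitePi (X := fun _ b => b) fun _ => measurable_id
  exact (h.indepFun_finset S T hST fun i => measurable_pi_apply i).comp
    (measurable_of_finite φ) (measurable_of_finite ψ)

theorem integral_mul_of_dependsOn (hf : DependsOn f S) (hg : DependsOn g T) (hST : Disjoint S T) :
    ∫ ω, f ω * g ω ∂fairCoins = (∫ ω, f ω ∂fairCoins) * ∫ ω, g ω ∂fairCoins :=
  (indepFun_of_dependsOn hf hg hST).integral_fun_mul_eq_mul_integral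
    (measurable_of_dependsOn hf).aestronglyMeasurable
    (measurable_of_dependsOn hg).aestronglyMeasurable

end Coins

theorem integral_coin (φ : Bool → ℝ) (i : ℕ) :
    ∫ ω, φ (ω i) ∂fairCoins = (φ true + φ false) / 2 := by
  have h := measurePreserving_eval_infinitePi
    (fun _ : ℕ => (PMF.uniformOfFintype Bool).toMeasure) i
  have h2 := integral_map (μ := fairCoins) (φ := fun ω : ℕ → Bool => ω i) (f := φ)
    (measurable_pi_apply i).aemeasurable (measurable_of_finite φ).aestronglyMeasurable
  rw [← h2, fairCoins, h.map_eq, PMF.integral_eq_sum]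
  simp
  ring

/-- The character of the coins from `e` on with the exponents `x`. -/
noncomputable def chi (B e : ℕ) (x : ℕ → ℕ) (ω : ℕ → Bool) : ℝ :=
  ∏ t ∈ Finset.range B, (-1) ^ ((ω (e + t)).toNat * x t)

theorem dependsOn_chi (B e : ℕ) (x : ℕ → ℕ) : DependsOn (chi B e x) (Finset.Ico e (e + B)) := by
  intro ω ω' h
  refine Finset.prod_congr rfl fun t ht => ?_
  rw [h (e + t) (by simpa using ht)]

/-- A coin with odd exponent contributes an independent factor `±1` of mean zero. -/
theorem integral_chi {B e t : ℕ} {x : ℕ → ℕ} (ht : t < B) (hx : Odd (x t)) :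
    ∫ ω, chi B e x ω ∂fairCoins = 0 := by
  have hsplit : ∀ ω, chi B e x ω = (-1) ^ ((ω (e + t)).toNat * x t) *
      ∏ t ∈ (Finset.range B).erase t, (-1) ^ ((ω (e + t)).toNat * x t) := fun ω =>
    (Finset.mul_prod_erase _ _ (Finset.mem_range.2 ht)).symm
  simp only [hsplit]
  rw [integral_mul_of_dependsOn (S := {e + t}) (T := ((Finset.range B).erase t).image (e + ·)),
    integral_coin (fun b => (-1) ^ (b.toNat * x t))]
  · simp [hx.neg_one_pow]
  · intro ω ω' h
    simp only
    rw [h (e + t) (by simp)]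
  · intro ω ω' h
    refine Finset.prod_congr rfl fun i hi => ?_
    rw [h (e + i) (by simpa [and_comm] using hi)]
  · simp

theorem neg_one_pow_parity (ω : ℕ → Bool) (B e x : ℕ) :
    (-1 : ℝ) ^ parity ω B e x = chi B e (fun t => x / 2 ^ t % 2) ω := by
  rw [parity, chi, Finset.prod_pow_eq_pow_sum, ← neg_one_pow_eq_pow_mod_two]

theorem parity_eq (ω : ℕ → Bool) (B e x : ℕ) :
    (parity ω B e x : ℝ) = (1 - chi B e (fun t => x / 2 ^ t % 2) ω) / 2 := by
  rw [← neg_one_pow_parity]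
  have := parity_le ω B e x
  interval_cases parity ω B e x <;> norm_num

theorem dependsOn_parity (B e x : ℕ) :
    DependsOn (fun ω => (parity ω B e x : ℝ)) (Finset.Ico e (e + B)) := by
  intro ω ω' h
  simp only [parity_eq]
  rw [dependsOn_chi B e _ h]

theorem exists_digit_ne {B x y : ℕ} (hx : x < 2 ^ B) (hy : y < 2 ^ B) (hxy : x ≠ y) :
    ∃ t < B, x / 2 ^ t % 2 ≠ y / 2 ^ t % 2 := by
  by_contra! h
  refine hxy (Nat.eq_of_testBit_eq fun t => ?_)
  rw [Nat.testBit_eq_decide_div_mod_eq, Nat.testBit_eq_decide_div_mod_eq]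
  by_cases ht : t < B
  · rw [h t ht]
  · have h2 : 2 ^ B ≤ 2 ^ t := Nat.pow_le_pow_right two_pos (not_lt.1 ht)
    rw [Nat.div_eq_of_lt (hx.trans_le h2), Nat.div_eq_of_lt (hy.trans_le h2)]

/-- The difference of the hashes of two letters. -/
noncomputable def hashDiff (B e x y : ℕ) (ω : ℕ → Bool) : ℝ := parity ω B e x - parity ω B e y

theorem dependsOn_hashDiff (B e x y : ℕ) :
    DependsOn (hashDiff B e x y) (Finset.Ico e (e + B)) := fun ω ω' h => by
  have h1 := dependsOn_parity B e x h
  have h2 := dependsOn_parity B e y h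
  simp only at h1 h2
  rw [hashDiff, hashDiff, h1, h2]

/-- The values are `-1`, `0`, `1`. In `moments_sum` this reduces third moments to first ones and
fourth moments to second ones. -/
theorem hashDiff_pow_three (B e x y : ℕ) (ω : ℕ → Bool) :
    hashDiff B e x y ω ^ 3 = hashDiff B e x y ω := by
  unfold hashDiff
  have h1 := parity_le ω B e x
  have h2 := parity_le ω B e y
  interval_cases parity ω B e x <;> interval_cases parity ω B e y <;> norm_num

theorem integral_chi_digits {B e x : ℕ} (hx : x < 2 ^ B) (h0 : x ≠ 0) :
    ∫ ω, chi B e (fun t => x / 2 ^ t % 2) ω ∂fairCoins = 0 := by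
  obtain ⟨t, ht, h⟩ := exists_digit_ne hx (by positivity) h0
  refine integral_chi ht (Nat.odd_iff.2 ?_)
  simp only [Nat.zero_div, Nat.zero_mod] at h
  simp only [Nat.mod_mod]
  omega

/-- A nonzero code has an unbiased hash. Code `0` would always hash to `0`, which is why letters are
shifted by one. -/
theorem integral_hashDiff {B e x y : ℕ} (hx : x < 2 ^ B) (hy : y < 2 ^ B) (hx0 : x ≠ 0)
    (hy0 : y ≠ 0) : ∫ ω, hashDiff B e x y ω ∂fairCoins = 0 := by
  have h : ∀ ω, hashDiff B e x y ω = chi B e (fun t => y / 2 ^ t % 2) ω / 2 -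
      chi B e (fun t => x / 2 ^ t % 2) ω / 2 := fun ω => by
    rw [hashDiff, parity_eq, parity_eq]; ring
  simp only [h]
  rw [integral_sub ((integrable_of_dependsOn (dependsOn_chi _ _ _)).div_const _)
    ((integrable_of_dependsOn (dependsOn_chi _ _ _)).div_const _), integral_div, integral_div,
    integral_chi_digits hx hx0, integral_chi_digits hy hy0]
  simp

/-- For bits, the squared difference is `(1 - χ_x χ_y) / 2`. The product of the two characters has
as exponents the sums of the digits, one of which is odd when the codes differ, so its mean is zero.
-/
theorem integral_hashDiff_sq {B e x y : ℕ} (hx : x < 2 ^ B) (hy : y < 2 ^ B) (hxy : x ≠ y) :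
    ∫ ω, hashDiff B e x y ω ^ 2 ∂fairCoins = 1 / 2 := by
  have hchi : ∀ ω z, chi B e z ω ^ 2 = 1 := fun ω z => by
    rw [chi, ← Finset.prod_pow]
    exact Finset.prod_eq_one fun t _ => by rw [← pow_mul, mul_comm, pow_mul]; simp
  have h : ∀ ω, hashDiff B e x y ω ^ 2 = 1 / 2 -
      chi B e (fun t => x / 2 ^ t % 2 + y / 2 ^ t % 2) ω / 2 := fun ω => by
    have hmul : chi B e (fun t => x / 2 ^ t % 2 + y / 2 ^ t % 2) ω =
        chi B e (fun t => x / 2 ^ t % 2) ω * chi B e (fun t => y / 2 ^ t % 2) ω := by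
      rw [chi, chi, chi, ← Finset.prod_mul_distrib]
      exact Finset.prod_congr rfl fun t _ => by rw [mul_add, pow_add]
    rw [hashDiff, parity_eq, parity_eq, hmul]
    linear_combination (1 / 4) * hchi ω (fun t => x / 2 ^ t % 2) +
      (1 / 4) * hchi ω (fun t => y / 2 ^ t % 2)
  obtain ⟨t, ht, hne⟩ := exists_digit_ne hx hy hxy
  simp only [h]
  rw [integral_sub (integrable_const _)
    ((integrable_of_dependsOn (dependsOn_chi _ _ _)).div_const _), integral_div _ (chi B e _),
    integral_chi ht (Nat.odd_iff.2 (by omega))]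
  simp

/-! ### Moments of sums -/

/-- Induction on the set, expanding powers of `X p + Y` with `Y` the sum over the rest, which is
independent of `X p`. The first and third moments of `X p` vanish, so only the even powers of `X p`
remain in the second and fourth moments. -/
theorem moments_sum {ι : Type*} [DecidableEq ι] (F : Finset ι) {X : ι → (ℕ → Bool) → ℝ}
    {I : ι → Finset ℕ} (hdep : ∀ p ∈ F, DependsOn (X p) (I p))
    (hdisj : ∀ p ∈ F, ∀ p' ∈ F, p ≠ p' → Disjoint (I p) (I p'))
    (h3 : ∀ p ω, X p ω ^ 3 = X p ω) (hmean : ∀ p ∈ F, ∫ ω, X p ω ∂fairCoins = 0)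
    (hsq : ∀ p ∈ F, ∫ ω, X p ω ^ 2 ∂fairCoins = 1 / 2) :
    ∫ ω, ∑ p ∈ F, X p ω ∂fairCoins = 0 ∧ ∫ ω, (∑ p ∈ F, X p ω) ^ 2 ∂fairCoins = F.card / 2 ∧
      ∫ ω, (∑ p ∈ F, X p ω) ^ 4 ∂fairCoins ≤ 3 / 4 * (F.card : ℝ) ^ 2 := by
  induction F using Finset.induction_on with
  | empty => simp
  | insert p F hp ih =>
    obtain ⟨h1, h2, h4⟩ := ih (fun q hq => hdep q (Finset.mem_insert_of_mem hq))
      (fun q hq q' hq' => hdisj q (Finset.mem_insert_of_mem hq) q' (Finset.mem_insert_of_mem hq'))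
      (fun q hq => hmean q (Finset.mem_insert_of_mem hq))
      (fun q hq => hsq q (Finset.mem_insert_of_mem hq))
    have hX := hdep p (Finset.mem_insert_self _ _)
    have m1 := hmean p (Finset.mem_insert_self _ _)
    have m2 := hsq p (Finset.mem_insert_self _ _)
    have hY : DependsOn (fun ω => ∑ q ∈ F, X q ω) (F.biUnion I : Finset ℕ) := fun ω ω' h =>
      Finset.sum_congr rfl fun q hq => hdep q (Finset.mem_insert_of_mem hq) fun i hi =>
        h i (Finset.mem_coe.2 (Finset.mem_biUnion.2 ⟨q, hq, hi⟩))
    have hd : Disjoint (I p) (F.biUnion I) := (Finset.disjoint_biUnion_right _ _ _).2 fun q hq =>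
      hdisj p (Finset.mem_insert_self _ _) q (Finset.mem_insert_of_mem hq)
        fun h => hp (h ▸ hq)
    set Y : (ℕ → Bool) → ℝ := fun ω => ∑ q ∈ F, X q ω with hYdef
    set x := X p with hx
    change ∫ ω, Y ω ^ 2 ∂fairCoins = _ at h2
    change ∫ ω, Y ω ^ 4 ∂fairCoins ≤ _ at h4
    have dx : ∀ k : ℕ, DependsOn (fun ω => x ω ^ k) (I p) := fun k ω ω' h => by
      simp only; rw [hX h]
    have dY : ∀ k : ℕ, DependsOn (fun ω => Y ω ^ k) (F.biUnion I : Finset ℕ) := fun k ω ω' h => by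
      simp only; rw [hY h]
    have hmul : ∀ j k : ℕ, ∫ ω, x ω ^ j * Y ω ^ k ∂fairCoins =
        (∫ ω, x ω ^ j ∂fairCoins) * ∫ ω, Y ω ^ k ∂fairCoins := fun j k =>
      integral_mul_of_dependsOn (dx j) (dY k) hd
    have hint : ∀ j k : ℕ, Integrable (fun ω => x ω ^ j * Y ω ^ k) fairCoins := fun j k =>
      integrable_of_dependsOn (S := I p ∪ F.biUnion I) fun ω ω' h => by
        rw [hX fun i hi => h i (by simp_all), hY fun i hi => h i (by
          rw [Finset.coe_union]; exact Or.inr hi)]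
    have hpow : ∀ k : ℕ, ∫ ω, (∑ q ∈ insert p F, X q ω) ^ k ∂fairCoins =
        ∑ j ∈ Finset.range (k + 1), (∫ ω, x ω ^ j ∂fairCoins) *
          (∫ ω, Y ω ^ (k - j) ∂fairCoins) * k.choose j := fun k => by
      simp only [Finset.sum_insert hp]
      simp only [add_pow, ← hmul]
      rw [integral_finsetSum _ fun j _ => (hint j (k - j)).mul_const _]
      simp only [integral_mul_const, hx, hYdef]
    have x3 : ∫ ω, x ω ^ 3 ∂fairCoins = 0 := by simp only [hx, h3]; exact m1
    have x4 : ∫ ω, x ω ^ 4 ∂fairCoins = 1 / 2 := by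
      rw [← m2]
      congr 1
      funext ω
      linear_combination x ω * h3 p ω
    have e1 := hpow 1
    have e2 := hpow 2
    have e4 := hpow 4
    simp only [pow_one] at e1
    rw [e1, e2, e4]
    simp only [Finset.sum_range_succ, Finset.sum_range_zero, x3, x4, m1, m2, h1, h2,
      Finset.card_insert_of_notMem hp, pow_zero, pow_one, Nat.sub_self, Nat.reduceSub, Nat.choose,
      tsub_zero, integral_const, probReal_univ, smul_eq_mul]
    push_cast
    refine ⟨by ring, by ring, ?_⟩
    -- With `k` the old cardinality, the claim is `3k²/4 + 6 · (1/2) · (k/2) + 1/2 ≤ 3(k + 1)²/4`.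
    nlinarith

/-! ### The quality of the estimate -/

theorem disjoint_blocks {B κ κ' : ℕ} (h : κ ≠ κ') :
    Disjoint (Finset.Ico (κ * B) (κ * B + B)) (Finset.Ico (κ' * B) (κ' * B + B)) := by
  rw [Finset.disjoint_left]
  intro i h1 h2
  rw [Finset.mem_Ico] at h1 h2
  rcases lt_or_gt_of_ne h with hlt | hlt
  · have : (κ + 1) * B ≤ κ' * B := Nat.mul_le_mul_right _ hlt
    rw [add_mul, one_mul] at this
    omega
  · have : (κ' + 1) * B ≤ κ * B := Nat.mul_le_mul_right _ hlt
    rw [add_mul, one_mul] at this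
    omega

namespace Layout

/-- The positions of the window where the letter codes differ. -/
def mismatches (E : Layout) (y z : ℕ → ℕ) (i : ℕ) : Finset ℕ :=
  (Finset.range E.m).filter fun p => y (E.f * i + p) ≠ z (E.g * i + p)

/-- The difference of the sketches. -/
noncomputable def diff (E : Layout) (y z : ℕ → ℕ) (i r : ℕ) (ω : ℕ → Bool) : ℝ :=
  ∑ p ∈ E.mismatches y z i, hashDiff E.B ((r * E.n + (E.f * i + p)) * E.B)
    (y (E.f * i + p)) (z (E.g * i + p)) ω

variable (E : Layout) (y z : ℕ → ℕ) (i : ℕ)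

/-- Positions with equal codes drop out because both strings are hashed with the same coins there.
-/
theorem diff_eq (r : ℕ) (ω : ℕ → Bool) :
    E.diff y z i r ω = (E.dyn ω y r i : ℝ) - E.stat ω z r i := by
  rw [diff, mismatches, Finset.sum_filter, dyn, stat, Nat.cast_sum, Nat.cast_sum,
    ← Finset.sum_sub_distrib]
  refine Finset.sum_congr rfl fun p _ => ?_
  split_ifs with h
  · rfl
  · rw [not_not.1 h]; simp [hash]

theorem gap_eq (r : ℕ) (ω : ℕ → Bool) : (E.gap ω y z r i : ℝ) = E.diff y z i r ω ^ 2 := by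
  have h := two_mul_mul_le_sq_add_sq (E.dyn ω y r i) (E.stat ω z r i)
  rw [diff_eq, gap, Nat.cast_sub (by omega), Nat.cast_sub (by omega)]
  push_cast
  ring

/-- The coins of repetition `r`. -/
def rowCoins (r : ℕ) : Finset ℕ := Finset.Ico (r * (E.n * E.B)) (r * (E.n * E.B) + E.n * E.B)

variable {E y z i}

theorem dependsOn_diff (hi : E.f * i + E.m ≤ E.n) (r : ℕ) :
    DependsOn (E.diff y z i r) (E.rowCoins r) := by
  intro ω ω' h
  refine Finset.sum_congr rfl fun p hp => ?_
  refine dependsOn_hashDiff _ _ _ _ fun j hj => h j ?_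
  have hp' := Finset.mem_range.1 (Finset.mem_filter.1 hp).1
  have h1 : (E.f * i + p + 1) * E.B ≤ E.n * E.B := Nat.mul_le_mul_right _ (by omega)
  have h2 : (r * E.n + (E.f * i + p)) * E.B = r * (E.n * E.B) + (E.f * i + p) * E.B := by ring
  rw [add_mul _ 1, one_mul] at h1
  simp only [Finset.coe_Ico, Set.mem_Ico, rowCoins] at hj ⊢
  omega

theorem moments_diff (hy : ∀ p < E.m, y (E.f * i + p) ≠ 0 ∧ y (E.f * i + p) < 2 ^ E.B)
    (hz : ∀ p < E.m, z (E.g * i + p) ≠ 0 ∧ z (E.g * i + p) < 2 ^ E.B) (r : ℕ) :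
    ∫ ω, E.diff y z i r ω ^ 2 ∂fairCoins = (E.mismatches y z i).card / 2 ∧
      ∫ ω, E.diff y z i r ω ^ 4 ∂fairCoins ≤ 3 / 4 * ((E.mismatches y z i).card : ℝ) ^ 2 := by
  have hlt : ∀ p ∈ E.mismatches y z i, p < E.m ∧ y (E.f * i + p) ≠ z (E.g * i + p) := by
    intro p hp
    simpa [mismatches] using hp
  exact (moments_sum (E.mismatches y z i)
    (X := fun p => hashDiff E.B ((r * E.n + (E.f * i + p)) * E.B) (y (E.f * i + p))
      (z (E.g * i + p)))
    (fun p _ => dependsOn_hashDiff _ _ _ _) (fun p _ p' _ h => disjoint_blocks (by omega))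
    (fun _ _ => hashDiff_pow_three _ _ _ _ _)
    (fun p hp => integral_hashDiff (hy p (hlt p hp).1).2 (hz p (hlt p hp).1).2
      (hy p (hlt p hp).1).1 (hz p (hlt p hp).1).1)
    (fun p hp => integral_hashDiff_sq (hy p (hlt p hp).1).2 (hz p (hlt p hp).1).2
      (hlt p hp).2)).2

theorem memLp_diff_sq (hi : E.f * i + E.m ≤ E.n) (r : ℕ) :
    MemLp (fun ω => E.diff y z i r ω ^ 2) 2 fairCoins :=
  memLp_of_dependsOn (S := E.rowCoins r) (fun ω ω' h => by
    rw [dependsOn_diff hi r h]) 2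

/-- The sum of the squares of the differences of the sketches is close to its mean. -/
theorem concentration (hi : E.f * i + E.m ≤ E.n)
    (hy : ∀ p < E.m, y (E.f * i + p) ≠ 0 ∧ y (E.f * i + p) < 2 ^ E.B)
    (hz : ∀ p < E.m, z (E.g * i + p) ≠ 0 ∧ z (E.g * i + p) < 2 ^ E.B) {c : ℝ} (hc : 0 < c) :
    fairCoins {ω | c ≤ |((∑ r ∈ Finset.range E.R, E.gap ω y z r i : ℕ) : ℝ) -
      E.R * (E.mismatches y z i).card / 2|} ≤
      ENNReal.ofReal (E.R * ((E.mismatches y z i).card : ℝ) ^ 2 / 2 / c ^ 2) := by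
  set H : ℝ := ((E.mismatches y z i).card : ℝ)
  let W : ℕ → (ℕ → Bool) → ℝ := fun r ω => E.diff y z i r ω ^ 2
  have hW : ∀ r, MemLp (W r) 2 fairCoins := fun r => memLp_diff_sq hi r
  have hWdep : ∀ r, DependsOn (W r) (E.rowCoins r) := fun r ω ω' h => by
    simp only [W]; rw [dependsOn_diff hi r h]
  have hsum : MemLp (∑ r ∈ Finset.range E.R, W r) 2 fairCoins := memLp_finsetSum' _ fun r _ => hW r
  have hmean : ∫ ω, (∑ r ∈ Finset.range E.R, W r) ω ∂fairCoins = E.R * H / 2 := by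
    simp only [Finset.sum_apply]
    rw [integral_finsetSum _ fun r _ => integrable_of_dependsOn (hWdep r),
      Finset.sum_congr rfl fun r _ => (moments_diff hy hz r).1]
    simp [H, mul_div_assoc]
  -- Repetitions use disjoint rows of coins, so variances add; each is at most `3H²/4 - (H/2)² =
  -- H²/2`.
  have hvar : Var[∑ r ∈ Finset.range E.R, W r; fairCoins] ≤ E.R * H ^ 2 / 2 := by
    rw [IndepFun.variance_sum (fun r _ => hW r) fun r _ r' _ h =>
      indepFun_of_dependsOn (hWdep r) (hWdep r') (disjoint_blocks h)]
    calc ∑ r ∈ Finset.range E.R, Var[W r; fairCoins] ≤ ∑ r ∈ Finset.range E.R, H ^ 2 / 2 := by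
          refine Finset.sum_le_sum fun r _ => ?_
          obtain ⟨h2, h4⟩ := moments_diff (E := E) (i := i) hy hz r
          rw [variance_eq_sub (hW r)]
          have e4 : ∫ ω, (W r ^ 2) ω ∂fairCoins = ∫ ω, E.diff y z i r ω ^ 4 ∂fairCoins := by
            congr 1
            funext ω
            simp only [W, Pi.pow_apply]
            ring
          rw [e4, h2]
          change _ ≤ 3 / 4 * H ^ 2 at h4
          change _ - (H / 2) ^ 2 ≤ _
          linarith
      _ = E.R * H ^ 2 / 2 := by simp [mul_div_assoc]
  have := meas_ge_le_variance_div_sq hsum hc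
  rw [hmean] at this
  refine le_trans (le_of_eq ?_) (this.trans (ENNReal.ofReal_le_ofReal (by gcongr)))
  congr 1
  ext ω
  simp only [Set.mem_ofPred_eq, Nat.cast_sum, gap_eq, Finset.sum_apply, W]

end Layout

/-- The scaled estimate is a `(1 + ε)`-approximation if it is close to its mean. -/
theorem isApprox_of_close {ε : ℝ} {R q H Y : ℕ} (hε : 0 < ε) (hq : 1 / ε ≤ q) (hR : 0 < R)
    (hclose : |(Y : ℝ) - R * H / 2| ≤ R * H / (2 * (2 * q + 1))) :
    IsApprox ε H (Y * (2 * q + 1) / (R * q)) := by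
  have hq0 : (0 : ℝ) < q := lt_of_lt_of_le (by positivity) hq
  have hqn : 0 < q := by exact_mod_cast hq0
  have hR' : (0 : ℝ) < R := by exact_mod_cast hR
  rw [abs_le] at hclose
  obtain ⟨h1, h2⟩ := hclose
  -- The ends of the interval are in the ratio `q : (q + 1)`, so scaling the lower end to `H` puts
  -- the upper end at `(1 + 1/q) H`.
  have e1 : (R : ℝ) * H / 2 - R * H / (2 * (2 * q + 1)) = R * H * q / (2 * q + 1) := by
    field_simp
    ring
  have e2 : (R : ℝ) * H / 2 + R * H / (2 * (2 * q + 1)) = R * H * (q + 1) / (2 * q + 1) := by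
    field_simp
    ring
  have h3 : (R : ℝ) * H * q / (2 * q + 1) ≤ Y := by linarith
  have h4 : (Y : ℝ) ≤ R * H * (q + 1) / (2 * q + 1) := by linarith
  rw [div_le_iff₀ (by positivity)] at h3
  rw [le_div_iff₀ (by positivity)] at h4
  constructor
  -- Rounding down keeps the lower bound because `H` is an integer.
  · rw [Nat.cast_le, Nat.le_div_iff_mul_le (by positivity)]
    have : ((H * (R * q) : ℕ) : ℝ) ≤ (Y * (2 * q + 1) : ℕ) := by push_cast; linarith
    exact_mod_cast this
  · refine (Nat.cast_div_le (α := ℝ)).trans ?_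
    push_cast
    rw [div_le_iff₀ (by positivity)]
    refine h4.trans ?_
    have h5 : 1 ≤ ε * q := by
      rw [div_le_iff₀ hε] at hq
      linarith
    have h6 : (0 : ℝ) ≤ R * H := by positivity
    nlinarith [mul_le_mul_of_nonneg_left h5 h6]

theorem Layout.answer_isApprox {M : Mode} {ρ n m σ q : ℕ} {y z : ℕ → ℕ} {i : ℕ} {ε δ : ℝ}
    (hε : 0 < ε) (hq : 1 / ε ≤ q) (hδ : 0 < δ) (hρ : 18 / δ ≤ ρ)
    (hi : M.flag * i + m ≤ n)
    (hy : ∀ p < m, y (M.flag * i + p) ≠ 0 ∧ y (M.flag * i + p) ≤ σ)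
    (hz : ∀ p < m, z ((1 - M.flag) * i + p) ≠ 0 ∧ z ((1 - M.flag) * i + p) ≤ σ) :
    fairCoins {ω | ¬ IsApprox ε ((layout M ρ n m σ q).mismatches y z i).card
      ((layout M ρ n m σ q).answer ω y z i)} ≤ ENNReal.ofReal δ := by
  obtain ⟨E, hE⟩ : ∃ E, E = layout M ρ n m σ q := ⟨_, rfl⟩
  rw [← hE]
  have ef : E.f = M.flag := by rw [hE]; rfl
  have eg : E.g = 1 - M.flag := by rw [hE]; rfl
  have em : E.m = m := by rw [hE]; rfl
  have en : E.n = n := by rw [hE]; rfl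
  have eB : E.B = Nat.size σ := by rw [hE]; rfl
  have eR : E.R = ρ * (q * q) := by rw [hE]; rfl
  have enum : E.num = 2 * q + 1 := by rw [hE]; rfl
  have eden : E.den = E.R * q := by rw [hE]; rfl
  have hq0 : (0 : ℝ) < q := lt_of_lt_of_le (by positivity) hq
  have hρ0 : (0 : ℝ) < ρ := lt_of_lt_of_le (by positivity) hρ
  have hqn : 1 ≤ q := by exact_mod_cast hq0
  have hρn : 0 < ρ := by exact_mod_cast hρ0
  have hR : 0 < E.R := by rw [eR]; positivity
  have hR' : (0 : ℝ) < E.R := by exact_mod_cast hR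
  set H := (E.mismatches y z i).card with hH
  have hσ := Nat.lt_size_self σ
  rw [← eB] at hσ
  -- Without mismatches the Chebyshev threshold would be zero, but then every difference vanishes
  -- and the answer is exactly `0`.
  by_cases hH0 : H = 0
  · have hempty : E.mismatches y z i = ∅ := Finset.card_eq_zero.1 hH0
    have : {ω | ¬ IsApprox ε H (E.answer ω y z i)} = ∅ := by
      rw [Set.eq_empty_iff_forall_notMem]
      intro ω hω
      apply hω
      have hg : ∀ r, E.gap ω y z r i = 0 := fun r => by
        have := E.gap_eq y z i r ω
        rw [Layout.diff, hempty] at this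
        simpa using this
      simp [Layout.answer, hg, hH0, IsApprox]
    rw [this]
    simp
  have hHpos : (0 : ℝ) < H := by exact_mod_cast Nat.pos_of_ne_zero hH0
  set c : ℝ := E.R * H / (2 * (2 * q + 1)) with hc
  have hcpos : 0 < c := by positivity
  have hconc := E.concentration (y := y) (z := z) (i := i) (by rw [ef, em, en]; exact hi)
    (fun p hp => by
      rw [ef]; rw [em] at hp; exact ⟨(hy p hp).1, (hy p hp).2.trans_lt hσ⟩)
    (fun p hp => by
      rw [eg]; rw [em] at hp; exact ⟨(hz p hp).1, (hz p hp).2.trans_lt hσ⟩) hcpos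
  refine (measure_mono fun ω hω => ?_).trans (hconc.trans (ENNReal.ofReal_le_ofReal ?_))
  · by_contra hlt
    apply hω
    simp only [Set.mem_ofPred_eq, not_le] at hlt
    rw [Layout.answer, enum, eden]
    exact isApprox_of_close hε hq hR hlt.le
  · rw [← hH]
    -- The distance `H` cancels. With `R = ρ q²` and `2q + 1 ≤ 3q` the bound becomes `18 / ρ`, which
    -- explains the requirement `18 / δ ≤ ρ`.
    have e1 : (E.R : ℝ) * (H : ℝ) ^ 2 / 2 / c ^ 2 = 2 * (2 * q + 1) ^ 2 / E.R := by
      rw [hc]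
      field_simp
    rw [e1, eR]
    push_cast
    rw [div_le_iff₀ (by positivity)]
    have h1 : (1 : ℝ) ≤ q := by exact_mod_cast hqn
    have h18 : 18 ≤ δ * ρ := by
      rw [div_le_iff₀ hδ] at hρ
      linarith
    have h3 : (2 * (q : ℝ) + 1) ^ 2 ≤ 9 * (q * q) := by nlinarith
    nlinarith [mul_le_mul_of_nonneg_right h18 (by positivity : (0 : ℝ) ≤ q * q)]

/-! ### Choice of the parameters -/

theorem size_le_bits (n : ℕ) : Nat.size n ≤ bits n :=
  Nat.size_le.2 (Nat.lt_pow_succ_log_self one_lt_two n)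

theorem succ_le_two_pow_bits (n : ℕ) : n + 1 ≤ 2 ^ bits n :=
  Nat.lt_pow_succ_log_self one_lt_two n

theorem letters_le {c n σ : ℕ} (hσ : σ ≤ c * n ^ c) : σ ≤ (2 ^ bits n) ^ (2 * c) := by
  have h1 : c ≤ (2 ^ bits n) ^ c :=
    (Nat.lt_two_pow_self (n := c)).le.trans
      (Nat.pow_le_pow_left (Nat.le_self_pow (Nat.succ_ne_zero _) 2) c)
  have h2 : n ^ c ≤ (2 ^ bits n) ^ c :=
    Nat.pow_le_pow_left ((Nat.le_succ n).trans (succ_le_two_pow_bits n)) c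
  calc σ ≤ (2 ^ bits n) ^ c * (2 ^ bits n) ^ c := hσ.trans (Nat.mul_le_mul h1 h2)
    _ = _ := by rw [← pow_add, two_mul]

theorem size_letters_le {c n σ : ℕ} (hσ : σ ≤ c * n ^ c) :
    Nat.size σ ≤ (2 * c + 1) * bits n := by
  rw [Nat.size_le, mul_comm, pow_mul]
  exact (letters_le hσ).trans_lt (Nat.pow_lt_pow_right
    (Nat.one_lt_two_pow (Nat.succ_ne_zero _)) (Nat.lt_succ_self _))

/-- The factor in the length of a word. -/
def wordFactor (c ρ : ℕ) : ℕ := ρ + 2 * c + 12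

/-- Every quantity is at most a power of `N = 2 ^ bits n` with exponent depending only on `c` and
`ρ`. Constants are absorbed by `x ≤ 2 ^ x ≤ N ^ x`, and `q ≤ n` takes care of the dependence on `ε`.
-/
theorem good_of_le {c ρ n m σ q : ℕ} (M : Mode) (hm : 1 ≤ m) (hmn : m ≤ n)
    (hσ : σ ≤ c * n ^ c) (hq : 1 ≤ q) (hqn : q ≤ n) (hρ : 1 ≤ ρ) :
    Good M ρ n m σ q (wordFactor c ρ * bits n) ∧ q < 2 ^ (wordFactor c ρ * bits n) := by
  have hw : 2 ^ (wordFactor c ρ * bits n) = (2 ^ bits n) ^ wordFactor c ρ := by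
    rw [mul_comm, pow_mul]
  have hσ' := letters_le hσ
  have hB0 := size_letters_le hσ
  have hbits : bits n ≤ 2 ^ bits n := Nat.lt_two_pow_self.le
  have hV0 := (size_le_bits n).trans hbits
  have hn := succ_le_two_pow_bits n
  have h2N : 2 ≤ 2 ^ bits n := Nat.le_self_pow (Nat.succ_ne_zero _) 2
  have hnV := Nat.lt_size_self n
  set N := 2 ^ bits n with hN
  have hle : ∀ k, 2 ^ k ≤ N ^ k := fun k => Nat.pow_le_pow_left h2N k
  have hpow : ∀ {j k : ℕ}, j ≤ k → N ^ j ≤ N ^ k := fun h => Nat.pow_le_pow_right (by omega) h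
  have hlt : ∀ {j k : ℕ}, j < k → N ^ j < N ^ k := fun h => Nat.pow_lt_pow_right (by omega) h
  have hB : Nat.size σ ≤ N ^ (2 * c + 2) := by
    calc Nat.size σ ≤ N ^ (2 * c + 1) * N := hB0.trans (Nat.mul_le_mul
          ((Nat.lt_two_pow_self (n := 2 * c + 1)).le.trans (hle _)) hbits)
      _ = _ := (pow_succ _ _).symm
  have hρN : ρ ≤ N ^ ρ := (Nat.lt_two_pow_self (n := ρ)).le.trans (hle _)
  have hqN : q ≤ N := by omega
  have hqq : q * q ≤ N ^ 2 := by rw [sq]; exact Nat.mul_le_mul hqN hqN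
  have hR : ρ * (q * q) ≤ N ^ (ρ + 2) := by rw [pow_add]; exact Nat.mul_le_mul hρN hqq
  have hRnB : ρ * (q * q) * (n * Nat.size σ) ≤ N ^ (ρ + 2 * c + 5) := by
    calc _ ≤ N ^ (ρ + 2) * (N * N ^ (2 * c + 2)) :=
          Nat.mul_le_mul hR (Nat.mul_le_mul (by omega) hB)
      _ = _ := by ring
  have hnR : n * (ρ * (q * q)) ≤ N ^ (ρ + 2 * c + 5) := by
    calc _ ≤ N * N ^ (ρ + 2) := Nat.mul_le_mul (by omega) hR
      _ = N ^ (ρ + 3) := by ring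
      _ ≤ _ := hpow (by omega)
  have hRV : ρ * (q * q) * Nat.size n * (n + 1) ≤ N ^ (ρ + 2 * c + 5) := by
    calc _ ≤ N ^ (ρ + 2) * N * N := Nat.mul_le_mul (Nat.mul_le_mul hR hV0) hn
      _ = N ^ (ρ + 4) := by ring
      _ ≤ _ := hpow (by omega)
  have hND : N ≤ N ^ (ρ + 2 * c + 5) := Nat.le_self_pow (by omega) N
  -- `size` has six summands, each at most `N ^ (ρ + 2 * c + 5)`; doubled and increased by `4` they
  -- stay below sixteen such powers.
  have h16 : 16 * N ^ (ρ + 2 * c + 5) ≤ N ^ (ρ + 2 * c + 12) := by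
    calc 16 * N ^ (ρ + 2 * c + 5) ≤ N ^ 4 * N ^ (ρ + 2 * c + 5) :=
          Nat.mul_le_mul_right _ (hle 4)
      _ = N ^ (ρ + 2 * c + 9) := by ring
      _ ≤ _ := hpow (by omega)
  have hsize : (layout M ρ n m σ q).size = m + n + ρ * (q * q) * (n * Nat.size σ) + n +
      n * (ρ * (q * q)) + ρ * (q * q) * Nat.size n * (n + 1) := rfl
  have h2nn : 2 * n * n ≤ N ^ 3 := by
    calc 2 * n * n ≤ N * N * N := Nat.mul_le_mul (Nat.mul_le_mul h2N (by omega)) (by omega)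
      _ = N ^ 3 := by ring
  have hnum : 2 * q + 1 ≤ N ^ 2 * N := by
    have h4 := hle 2
    calc 2 * q + 1 ≤ 4 * N := by omega
      _ ≤ _ := Nat.mul_le_mul_right _ h4
  have hans : ρ * (q * q) * (2 * n * n) * (2 * q + 1) ≤ N ^ (ρ + 8) := by
    calc _ ≤ N ^ (ρ + 2) * N ^ 3 * (N ^ 2 * N) :=
          Nat.mul_le_mul (Nat.mul_le_mul hR h2nn) hnum
      _ = _ := by ring
  have hden : ρ * (q * q) * q ≤ N ^ (ρ + 3) := by
    rw [show ρ + 3 = ρ + 2 + 1 by rfl, pow_succ]; exact Nat.mul_le_mul hR hqN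
  have hσ1 : σ + 1 < N ^ (ρ + 2 * c + 12) := by
    have h1 : 0 < N ^ (2 * c) := by positivity
    have h2 : 4 * N ^ (2 * c) ≤ N ^ (2 * c + 2) := by
      rw [pow_add, mul_comm]; exact Nat.mul_le_mul_left _ (hle 2)
    have h3 : N ^ (2 * c + 2) ≤ N ^ (ρ + 2 * c + 12) := hpow (by omega)
    omega
  refine ⟨⟨⟨?_, ?_, ?_, ?_, hm, hmn, ?_, ?_, ?_, ?_, ?_⟩, ?_, ?_, ?_, ?_, ?_⟩, ?_⟩
  · rw [hw, hsize, wordFactor]; omega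
  · exact hnV
  · rw [hw, wordFactor]
    exact hV0.trans_lt (by simpa using hlt (show 1 < ρ + 2 * c + 12 by omega))
  · rw [hw, wordFactor]
    exact hB.trans_lt (hlt (by omega))
  · show 1 ≤ ρ * (q * q)
    exact Nat.mul_pos hρ (Nat.mul_pos hq hq)
  · cases M <;> simp [layout, Mode.flag]
  · rw [hw, wordFactor]
    exact hans.trans_lt (hlt (by omega))
  · show 1 ≤ 2 * q + 1
    omega
  · rw [hw, wordFactor]
    exact h2nn.trans_lt (hlt (by omega))
  · rw [hw, wordFactor]
    exact hqq.trans_lt (hlt (by omega))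
  · rw [hw, wordFactor]
    exact hρN.trans_lt (hlt (by omega))
  · rw [hw, wordFactor]
    exact hden.trans_lt (hlt (by omega))
  · rw [hw, wordFactor]
    rw [← pow_succ] at hnum
    exact hnum.trans_lt (hlt (by omega))
  · rw [hw, wordFactor]; exact hσ1
  · rw [hw, wordFactor]
    exact hqN.trans_lt (by simpa using hlt (show 1 < ρ + 2 * c + 12 by omega))

/-! ### The Hamming distance -/

/-- In both modes one of the two start offsets is `i` and the other `0`, on the text and the pattern
respectively; the shift of codes by one is injective. -/
theorem card_mismatches {M : Mode} {ρ n m σ q : ℕ} (x : Strings n m σ) (h : m ≤ n)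
    (i : Fin (n - m + 1)) :
    ((layout M ρ n m σ q).mismatches (x.dynCode M) (x.statCode M) i).card = x.dist h i := by
  have hi := i.isLt
  rw [Strings.dist, hammingDist, ← Finset.card_map Fin.valEmbedding]
  congr 1
  ext p
  simp only [Layout.mismatches, Finset.mem_filter, Finset.mem_range, Finset.mem_map,
    Finset.mem_univ, true_and, Fin.valEmbedding_apply]
  change p < m ∧ x.dynCode M (M.flag * i + p) ≠ x.statCode M ((1 - M.flag) * i + p) ↔ _
  have key : ∀ hp : p < m, (x.dynCode M (M.flag * i + p) ≠ x.statCode M ((1 - M.flag) * i + p) ↔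
      x.pattern ⟨p, hp⟩ ≠ x.text ⟨i + p, by omega⟩) := by
    intro hp
    have hip : (i : ℕ) + p < n := by omega
    cases M
    · simp only [Mode.flag, zero_mul, zero_add, Nat.sub_zero, one_mul, Strings.dynCode,
        Strings.statCode]
      rw [dif_pos hp, dif_pos hip]
      exact not_congr ⟨fun h => Fin.ext (by omega), fun h => by rw [h]⟩
    · simp only [Mode.flag, Nat.sub_self, zero_mul, zero_add, one_mul, Strings.dynCode,
        Strings.statCode]
      rw [dif_pos hp, dif_pos hip]
      exact not_congr ⟨fun h => Fin.ext (by omega), fun h => by rw [h]⟩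
  constructor
  · rintro ⟨hp, hne⟩
    exact ⟨⟨p, hp⟩, (key hp).1 hne, rfl⟩
  · rintro ⟨a, hne, rfl⟩
    exact ⟨a.isLt, (key a.isLt).2 hne⟩

theorem Strings.dynCode_ne_zero {n m σ : ℕ} (x : Strings n m σ) (M : Mode) {i p : ℕ}
    (hp : p < m) (hi : i + m ≤ n) : x.dynCode M (M.flag * i + p) ≠ 0 := by
  cases M <;> simp [Mode.flag, dynCode, hp]
  omega

theorem Strings.statCode_ne_zero {n m σ : ℕ} (x : Strings n m σ) (M : Mode) {i p : ℕ}
    (hp : p < m) (hi : i + m ≤ n) : x.statCode M ((1 - M.flag) * i + p) ≠ 0 := by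
  cases M <;> simp [Mode.flag, statCode, hp]
  omega

/-! ### The data structure solves the problem -/

theorem solves {M : Mode} {c ρ n m σ : ℕ} {ε δ : ℝ} (hδ : 0 < δ) (hρ : 18 / δ ≤ ρ) (hm : 1 ≤ m)
    (hmn : m ≤ n) (hσ : σ ≤ c * n ^ c) (hε : 1 / (n : ℝ) < ε) :
    (sketchStructure M ρ).Solves (wordFactor c ρ * bits n) (layout M ρ n m σ ⌈1 / ε⌉₊).size
      (layout M ρ n m σ ⌈1 / ε⌉₊).updateTime (layout M ρ n m σ ⌈1 / ε⌉₊).queryTime M σ hmn ε δ := by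
  have hn0 : (0 : ℝ) < n := by exact_mod_cast hm.trans hmn
  have hε0 : 0 < ε := lt_trans (by positivity) hε
  have hρ1 : 1 ≤ ρ := by
    have : (0 : ℝ) < ρ := lt_of_lt_of_le (by positivity) hρ
    exact_mod_cast this
  -- This is where `ε > 1/n` is used.
  have hqn : ⌈1 / ε⌉₊ ≤ n := by
    rw [Nat.ceil_le]
    rw [div_lt_iff₀ hn0] at hε
    rw [div_le_iff₀ hε0]
    linarith
  have hq1 : 1 ≤ ⌈1 / ε⌉₊ := Nat.ceil_pos.2 (by positivity)
  obtain ⟨H, hqw⟩ := good_of_le M hm hmn hσ hq1 hqn hρ1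
  intro x rs
  refine ⟨fun ω => ?_, fun i => ?_⟩
  · obtain ⟨s, hs, -⟩ := exists_reaches H rfl hqw x rs ω
    exact ⟨s, hs⟩
  · have hi := i.isLt
    have hi' : (i : ℕ) + m ≤ n := by omega
    have hfi : M.flag * i + m ≤ n := by cases M <;> simp [Mode.flag] <;> omega
    have hstat := Strings.statCode_foldl rs x
    have hbound := Layout.answer_isApprox (M := M) (n := n) (m := m) (σ := σ) (i := i)
      (y := (rs.foldl Request.apply x).dynCode M) (z := (rs.foldl Request.apply x).statCode M)
      hε0 (Nat.le_ceil (1 / ε)) hδ hρ hfi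
      (fun p hp => ⟨Strings.dynCode_ne_zero _ M hp hi', Strings.dynCode_le _ M _⟩)
      (fun p hp => ⟨Strings.statCode_ne_zero _ M hp hi', Strings.statCode_le _ M _⟩)
    -- Since every run terminates in a state encoding the current strings, a request can fail only
    -- if the mathematical estimate does.
    refine (measure_mono fun ω hω => ?_).trans hbound
    intro happrox
    apply hω
    obtain ⟨s, hs, hH⟩ := exists_reaches H rfl hqw x rs ω
    obtain ⟨s', hs', -, hans⟩ := exists_serves_query H hH i
    refine ⟨s, s', hs, hs', ?_⟩
    rw [hans, ← card_mismatches (M := M) (ρ := ρ) (q := ⌈1 / ε⌉₊), ← hstat]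
    exact happrox

/-- Since `E = max 1 (1/ε) ≥ 1`, rounding up gives `q ≤ 2E` and hence `R ≤ 4ρE²`; every cost is
essentially `R` times `O(log n)`. -/
theorem resources {M : Mode} {c ρ n m σ : ℕ} {ε : ℝ} (hm : 1 ≤ m) (hmn : m ≤ n)
    (hσ : σ ≤ c * n ^ c) (hε0 : 0 < ε) (C : ℕ) (hC : C = 4 * ρ * (56 * c + 100) + 20) :
    ((layout M ρ n m σ ⌈1 / ε⌉₊).updateTime : ℝ) ≤ C * (max 1 (1 / ε)) ^ 2 * bits n ∧
    ((layout M ρ n m σ ⌈1 / ε⌉₊).queryTime : ℝ) ≤ C * (max 1 (1 / ε)) ^ 2 * bits n ∧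
    ((layout M ρ n m σ ⌈1 / ε⌉₊).size : ℝ) ≤ C * (max 1 (1 / ε)) ^ 2 * n * bits n := by
  set A := max 1 (1 / ε) with hA
  have hA1 : 1 ≤ A := le_max_left _ _
  set q := ⌈1 / ε⌉₊ with hq
  have hqA : (q : ℝ) ≤ 2 * A := by
    have h1 := (Nat.ceil_lt_add_one (a := 1 / ε) (by positivity)).le
    have h2 : 1 / ε ≤ A := le_max_right _ _
    rw [← hq] at h1
    linarith
  have hqq : (q : ℝ) * q ≤ 4 * A ^ 2 := by nlinarith [(Nat.cast_nonneg q : (0 : ℝ) ≤ q)]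
  have hρ0 : (0 : ℝ) ≤ ρ := Nat.cast_nonneg _
  have hR : (ρ : ℝ) * (q * q) ≤ 4 * ρ * A ^ 2 := by nlinarith
  have hR0 : (0 : ℝ) ≤ ρ * (q * q) := by positivity
  have hB : (Nat.size σ : ℝ) ≤ (2 * c + 1) * bits n := by exact_mod_cast size_letters_le hσ
  have hV : (Nat.size n : ℝ) ≤ bits n := by exact_mod_cast size_le_bits n
  have hb : (1 : ℝ) ≤ bits n := by exact_mod_cast Nat.succ_le_succ (Nat.zero_le _)
  have hn1 : (1 : ℝ) ≤ n := by exact_mod_cast hm.trans hmn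
  have hmn' : (m : ℝ) ≤ n := by exact_mod_cast hmn
  have hA2 : 1 ≤ A ^ 2 := one_le_pow₀ hA1
  have hbA : (bits n : ℝ) ≤ A ^ 2 * bits n := le_mul_of_one_le_left (by linarith) hA2
  have hc0 : (0 : ℝ) ≤ c := Nat.cast_nonneg _
  have hCR : (C : ℝ) = 4 * ρ * (56 * c + 100) + 20 := by rw [hC]; push_cast; ring
  set b : ℝ := (bits n : ℝ) with hbdef
  -- The factor `56c + 100` covers all three costs per repetition, the largest being `28(2c + 1) +
  -- 16 + 41` for an update. The term `20 b` absorbs the additive constants and, after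
  -- multiplication by `n`, the cells `m + 2n` for the strings and codes.
  have main : ∀ t : ℝ, 0 ≤ t → t ≤ (56 * c + 100) * b →
      ρ * (q * q) * t + 20 * b ≤ C * A ^ 2 * b := by
    intro t ht0 ht
    calc ρ * (q * q) * t + 20 * b ≤ 4 * ρ * A ^ 2 * ((56 * c + 100) * b) + 20 * (A ^ 2 * b) :=
          add_le_add (mul_le_mul hR ht ht0 (by positivity)) (by linarith)
      _ = C * A ^ 2 * b := by rw [hCR]; ring
  refine ⟨?_, ?_, ?_⟩
  · have hT : ((layout M ρ n m σ q).updateTime : ℝ) =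
        ρ * (q * q) * (28 * Nat.size σ + 16 * Nat.size n + 41) + 17 := by
      simp [Layout.updateTime, layout]
    rw [hT]
    refine le_trans ?_ (main (28 * Nat.size σ + 16 * Nat.size n + 41) (by positivity) (by nlinarith))
    linarith
  · have hT : ((layout M ρ n m σ q).queryTime : ℝ) =
        ρ * (q * q) * (32 * Nat.size n + 46) + 20 := by
      simp [Layout.queryTime, layout]
    rw [hT]
    refine le_trans ?_ (main (32 * Nat.size n + 46) (by positivity) (by nlinarith))
    linarith
  · have hT : ((layout M ρ n m σ q).size : ℝ) = m + n + ρ * (q * q) * (n * Nat.size σ) + n +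
        n * (ρ * (q * q)) + ρ * (q * q) * Nat.size n * (n + 1) := by
      simp [Layout.size, Layout.tb, Layout.sb, Layout.ub, Layout.cb, layout]
    have h1 := main (Nat.size σ + 1 + 2 * Nat.size n) (by positivity) (by nlinarith)
    have h2 := mul_le_mul_of_nonneg_right h1 (by linarith : (0 : ℝ) ≤ n)
    have h3 : (ρ : ℝ) * (q * q) * Nat.size n * (n + 1) ≤ ρ * (q * q) * Nat.size n * (2 * n) :=
      mul_le_mul_of_nonneg_left (by linarith) (by positivity)
    have h4 : (n : ℝ) ≤ b * n := le_mul_of_one_le_left (by linarith) hb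
    rw [hT]
    calc _ ≤ (ρ * (q * q) * (Nat.size σ + 1 + 2 * Nat.size n) + 20 * b) * n := by nlinarith
      _ ≤ _ := h2.trans_eq (by ring)

end DynApproxHD

/-! ### The main theorem -/

theorem mainTheorem9 (c : ℕ) (δ : ℝ) (hδ : 0 < δ) :
    (∃ (D : DynApproxHD.DataStructure) (K C k : ℕ),
      ∀ (n m σ : ℕ) (ε : ℝ) (_ : 1 ≤ m) (hmn : m ≤ n) (_ : σ ≤ c * n ^ c) (_ : 1 / (n : ℝ) < ε),
        ∃ S tu tq : ℕ,
          (tu : ℝ) ≤ C * (max 1 (1 / ε)) ^ 3 * (DynApproxHD.bits n : ℝ) ^ k ∧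
          (tq : ℝ) ≤ C * (max 1 (1 / ε)) ^ 4 * (DynApproxHD.bits n : ℝ) ^ k ∧
          (S : ℝ) ≤ C * (max 1 (1 / ε)) ^ 4 * n * (DynApproxHD.bits n : ℝ) ^ k ∧
          D.Solves (K * DynApproxHD.bits n) S tu tq .patternOnly σ hmn ε δ) ∧
    (∃ (D : DynApproxHD.DataStructure) (K C k : ℕ),
      ∀ (n m σ : ℕ) (ε : ℝ) (_ : 1 ≤ m) (hmn : m ≤ n) (_ : σ ≤ c * n ^ c) (_ : 1 / (n : ℝ) < ε),
        ∃ S tu tq : ℕ,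
          (tu : ℝ) ≤ C * (max 1 (1 / ε)) ^ 4 * (DynApproxHD.bits n : ℝ) ^ k ∧
          (tq : ℝ) ≤ C * (max 1 (1 / ε)) ^ 4 * (DynApproxHD.bits n : ℝ) ^ k ∧
          (S : ℝ) ≤ C * (max 1 (1 / ε)) ^ 4 * n * (DynApproxHD.bits n : ℝ) ^ k ∧
          D.Solves (K * DynApproxHD.bits n) S tu tq .textOnly σ hmn ε δ) := by
  obtain ⟨ρ, hρ⟩ := exists_nat_ge (18 / δ)
  -- One bound with exponent `2` serves both modes; the exponents `3` and `4` follow from `max 1 (1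
  -- / ε) ≥ 1`.
  have key : ∀ M : DynApproxHD.Mode,
      ∃ (D : DynApproxHD.DataStructure) (K C k : ℕ),
        ∀ (n m σ : ℕ) (ε : ℝ) (_ : 1 ≤ m) (hmn : m ≤ n) (_ : σ ≤ c * n ^ c) (_ : 1 / (n : ℝ) < ε),
          ∃ S tu tq : ℕ,
            (tu : ℝ) ≤ C * (max 1 (1 / ε)) ^ 2 * (DynApproxHD.bits n : ℝ) ^ k ∧
            (tq : ℝ) ≤ C * (max 1 (1 / ε)) ^ 2 * (DynApproxHD.bits n : ℝ) ^ k ∧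
            (S : ℝ) ≤ C * (max 1 (1 / ε)) ^ 2 * n * (DynApproxHD.bits n : ℝ) ^ k ∧
            D.Solves (K * DynApproxHD.bits n) S tu tq M σ hmn ε δ := by
    intro M
    refine ⟨DynApproxHD.sketchStructure M ρ, DynApproxHD.wordFactor c ρ,
      4 * ρ * (56 * c + 100) + 20, 1, fun n m σ ε hm hmn hσ hε => ?_⟩
    have hn0 : (0 : ℝ) < n := by exact_mod_cast hm.trans hmn
    obtain ⟨h1, h2, h3⟩ := DynApproxHD.resources (M := M) (ρ := ρ) hm hmn hσ
      (lt_trans (by positivity) hε) _ rfl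
    refine ⟨_, _, _, ?_, ?_, ?_, DynApproxHD.solves hδ hρ hm hmn hσ hε⟩
    · rwa [pow_one]
    · rwa [pow_one]
    · rwa [pow_one]
  constructor
  · obtain ⟨D, K, C, k, h⟩ := key .patternOnly
    refine ⟨D, K, C, k, fun n m σ ε hm hmn hσ hε => ?_⟩
    obtain ⟨S, tu, tq, h1, h2, h3, h4⟩ := h n m σ ε hm hmn hσ hε
    refine ⟨S, tu, tq, h1.trans ?_, h2.trans ?_, h3.trans ?_, h4⟩ <;> gcongr <;>
      first | exact le_max_left _ _ | norm_num
  · obtain ⟨D, K, C, k, h⟩ := key .textOnly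
    refine ⟨D, K, C, k, fun n m σ ε hm hmn hσ hε => ?_⟩
    obtain ⟨S, tu, tq, h1, h2, h3, h4⟩ := h n m σ ε hm hmn hσ hε
    refine ⟨S, tu, tq, h1.trans ?_, h2.trans ?_, h3.trans ?_, h4⟩ <;> gcongr <;>
      first | exact le_max_left _ _ | norm_num
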